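/- Let $P(x,v)=x_1v_2-x_2v_1$ for $x,v\in\mathbb R^3$, and let $Q=Q(f,P)\ge 0$ be a function on $[0,\infty)\times\mathbb R$ such that $Q,\partial_fQ,\partial_f^2Q$ exist and are continuous on $[0,\infty)\times\mathbb R$, $Q(0,\cdot)=0=\partial_fQ(0,\cdot)$, and, with constants $C,C',F,F'>0$ and $0<k,k'<3/2$: - (Q1) $Q(f,P)\ge C f^{1+1/k}$ for $f\ge F$, $P\in\mathbb R$; - (Q2) $\partial_f^2Q(f,P)>0$ for $f>0$, $P\in\mathbb R$; - (Q3) for every $f\ge 0$, $Q(f,\cdot)$ is (weakly) increasing on $(-\infty,0)$ and (weakly) decreasing on $(0,\infty)$; - (Q4) $Q(f,0)\le C' f^{1+1/k'}$ for $0\le f\le F'$. For measurable $f=f(x,v)\ge 0$ on $\mathbb R^6$ put $\rho_f(x)=\int f(x,v)\,dv$, $U_f=-\rho_f*\frac1{|\cdot|}$, and $$E_{\rm kin}(f)=\tfrac12\iint|v|^2f\,dv\,dx,\quad E_{\rm pot}(f)=-\tfrac12\iint\frac{\rho_f(x)\rho_f(y)}{|x-y|}\,dx\,dy,\quad \mathcal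 C(f)=\iint Q(f,P)\,dv\,dx,$$ $\mathcal H_C=E_{\rm kin}+E_{\rm pot}+\mathcal C$. For $M>0$ let $\mathcal F_M$ be the set of all $f\in L^1(\mathbb R^6)$ with $f\ge 0$, $\iint f=M$ and $\mathcal C(f)+E_{\rm kin}(f)<\infty$, and let $\mathcal F_M^S$ be the set of those $f\in\mathcal F_M$ which are axially symmetric, i.e. $f(Ax,Av)=f(x,v)$ for every rotation $A$ about the $x_3$-axis. (As usual in $L^1$, pointwise conditions are understood almost everywhere.) Let $B_R=\{x\in\mathbb R^3: |x|\le R\}$. **Theorem.** Let $M>0$ and let $(f_i)\subset\mathcal F_M^S$ be a minimizing sequence of $\mathcal H_C$ in $\mathcal F_M^S$, i.e. $\mathcal H_C(f_i)\to\inf_{\mathcal F_M^S}\mathcal H_C$. Then there exist a sequence of shifts $(z_i)\subset\mathbb R$, a subsequence, again denoted by $(f_i)$ (with the corresponding $z_i$), and a function $f_0$ on $\mathbb R^6$ such that the following holds. For every $\epsilon>0$ there exists $R>0$ with $$\int_{(0,0,z_i)+B_R}\int f_i(x,v)\,dv\,dx\ge M-\epsilon\ \text{ for all } i\in\mathbb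 N,\qquad \int_{B_R}\int f_0(x,v)\,dv\,dx\ge M-\epsilon .$$ With $Tf_i:=f_i(\cdot+(0,0,z_i),\cdot)$, $$Tf_i\rightharpoonup f_0\ \text{ weakly in } L^{1+1/k}(\mathbb R^6),\qquad \nabla U_{Tf_i}\to\nabla U_{f_0}\ \text{ strongly in } L^2(\mathbb R^3),$$ where the gradients are weak gradients, which exist and lie in $L^2(\mathbb R^3)$. Finally, $f_0\in\mathcal F_M^S$, and $f_0$ is a minimizer of $\mathcal H_C$ over $\mathcal F_M^S$. -/

import Mathlib

open MeasureTheory Filter Set Topology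
open scoped ContDiff ENNReal

namespace VlasovPoisson

/-- Three dimensional Euclidean space, used for positions and for velocities. -/
abbrev Space : Type := EuclideanSpace ℝ (Fin 3)

/-- Phase space `ℝ⁶ = ℝ³ × ℝ³` of pairs `(x, v)`. -/
abbrev Phase : Type := Space × Space

/-- The partial derivative `∂_f Q (f, P)` on `[0, ∞) × ℝ`, one-sided at `f = 0`. -/
noncomputable def partialF (Q : ℝ → ℝ → ℝ) (f P : ℝ) : ℝ :=
  derivWithin (fun s => Q s P) (Ici 0) f

/-- The standing assumptions on the function `Q = Q(f, P)` on `[0, ∞) × ℝ`. The values of `Q`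
at negative first argument are irrelevant. -/
structure CasimirAssumptions (Q : ℝ → ℝ → ℝ) (k : ℝ) : Prop where
  /-- `Q ∈ C([0, ∞) × ℝ)` -/
  cont : ContinuousOn (fun q : ℝ × ℝ => Q q.1 q.2) (Ici 0 ×ˢ univ)
  /-- `∂_f Q` exists -/
  diff : ∀ P, DifferentiableOn ℝ (fun s => Q s P) (Ici 0)
  /-- `∂_f Q ∈ C([0, ∞) × ℝ)` -/
  cont_partial : ContinuousOn (fun q : ℝ × ℝ => partialF Q q.1 q.2) (Ici 0 ×ˢ univ)
  /-- `∂_f² Q` exists -/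
  diff_partial : ∀ P, DifferentiableOn ℝ (fun s => partialF Q s P) (Ici 0)
  /-- `∂_f² Q ∈ C([0, ∞) × ℝ)` -/
  cont_partial_two :
    ContinuousOn (fun q : ℝ × ℝ => partialF (partialF Q) q.1 q.2) (Ici 0 ×ˢ univ)
  nonneg : ∀ f P, 0 ≤ f → 0 ≤ Q f P
  zero : ∀ P, Q 0 P = 0
  partial_zero : ∀ P, partialF Q 0 P = 0
  k_pos : 0 < k
  k_lt : k < 3 / 2
  /-- growth from below for large `f` -/
  growth : ∃ C F : ℝ, 0 < C ∧ 0 < F ∧ ∀ f P, F ≤ f → C * f ^ (1 + 1 / k) ≤ Q f P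
  /-- strict convexity in `f` -/
  convex : ∀ f P, 0 < f → 0 < partialF (partialF Q) f P
  /-- monotonicity in `P` -/
  mono_neg : ∀ f, 0 ≤ f → MonotoneOn (Q f) (Iio 0)
  anti_pos : ∀ f, 0 ≤ f → AntitoneOn (Q f) (Ioi 0)
  /-- bound from above for small `f` at `P = 0` -/
  small : ∃ C' F' k' : ℝ, 0 < C' ∧ 0 < F' ∧ 0 < k' ∧ k' < 3 / 2 ∧
    ∀ f, 0 ≤ f → f ≤ F' → Q f 0 ≤ C' * f ^ (1 + 1 / k')

/-- The `x₃`-component of angular momentum, `P(x, v) = x₁ v₂ - x₂ v₁`. -/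
def angMom (p : Phase) : ℝ := p.1 0 * p.2 1 - p.1 1 * p.2 0

/-- The rotation by the angle `θ` about the `x₃`-axis. -/
noncomputable def rot (θ : ℝ) (x : Space) : Space :=
  !₂[Real.cos θ * x 0 - Real.sin θ * x 1, Real.sin θ * x 0 + Real.cos θ * x 1, x 2]

/-- The point `(0, 0, z)` on the `x₃`-axis. -/
noncomputable def axisPoint (z : ℝ) : Space := !₂[0, 0, z]

/-- The spatial density `ρ_f (x) = ∫ f(x, v) dv`. -/
noncomputable def density (f : Phase → ℝ) (x : Space) : ℝ := ∫ v, f (x, v)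

/-- The gravitational potential `U_f = - ρ_f * 1/|·|`. -/
noncomputable def potential (f : Phase → ℝ) (x : Space) : ℝ :=
  -∫ y, density f y / ‖x - y‖

/-- The kinetic energy `½ ∬ |v|² f(x, v) dv dx ∈ [0, ∞]` of `f ≥ 0`. -/
noncomputable def kineticEnergy (f : Phase → ℝ) : ℝ≥0∞ :=
  (1 / 2) * ∫⁻ p : Phase, ENNReal.ofReal (‖p.2‖ ^ 2 * f p)

/-- The potential energy `- ½ ∬ ρ_f(x) ρ_f(y) / |x - y| dx dy`. -/
noncomputable def potentialEnergy (f : Phase → ℝ) : ℝ :=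
  -(1 / 2) * ∫ x, ∫ y, density f x * density f y / ‖x - y‖

/-- The Casimir functional `∬ Q(f(x, v), P(x, v)) dv dx ∈ [0, ∞]` of `f ≥ 0`. -/
noncomputable def casimir (Q : ℝ → ℝ → ℝ) (f : Phase → ℝ) : ℝ≥0∞ :=
  ∫⁻ p : Phase, ENNReal.ofReal (Q (f p) (angMom p))

/-- The constraint set `F_M`. Elements of `L¹(ℝ⁶)` are represented by integrable functions, so
pointwise conditions are required almost everywhere. -/
def admissible (Q : ℝ → ℝ → ℝ) (M : ℝ) : Set (Phase → ℝ) :=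
  {f | Integrable f ∧ (∀ᵐ p, 0 ≤ f p) ∧ ∫ p, f p = M ∧ casimir Q f + kineticEnergy f < ⊤}

/-- The axially symmetric constraint set `F_M^S`. -/
def admissibleS (Q : ℝ → ℝ → ℝ) (M : ℝ) : Set (Phase → ℝ) :=
  {f | f ∈ admissible Q M ∧ ∀ θ : ℝ, ∀ᵐ p : Phase, f (rot θ p.1, rot θ p.2) = f p}

/-- The energy-Casimir functional `H_C = E_kin + E_pot + C`, considered only on `F_M`, where the
first and the last summand are finite. -/
noncomputable def energyCasimir (Q : ℝ → ℝ → ℝ) (f : Phase → ℝ) : ℝ :=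
  (kineticEnergy f).toReal + potentialEnergy f + (casimir Q f).toReal

/-- The infimum `h_M^S` of `H_C` over `F_M^S`, in `[-∞, ∞]`. -/
noncomputable def infEnergyS (Q : ℝ → ℝ → ℝ) (M : ℝ) : EReal :=
  ⨅ f ∈ admissibleS Q M, (energyCasimir Q f : EReal)

/-- `(f_i) ⊂ F_M^S` is a minimizing sequence of `H_C` in `F_M^S`. -/
def IsMinimizingSeq (Q : ℝ → ℝ → ℝ) (M : ℝ) (f : ℕ → Phase → ℝ) : Prop :=
  (∀ i, f i ∈ admissibleS Q M) ∧
    Tendsto (fun i => (energyCasimir Q (f i) : EReal)) atTop (𝓝 (infEnergyS Q M))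

/-- The shift `f(· + (0, 0, z), ·)` along the `x₃`-axis. -/
noncomputable def shift (z : ℝ) (f : Phase → ℝ) (p : Phase) : ℝ := f (p.1 + axisPoint z, p.2)

/-- The mass of `f` over the closed ball of radius `R` about `a` in position space. -/
noncomputable def massIn (f : Phase → ℝ) (a : Space) (R : ℝ) : ℝ :=
  ∫ p in Metric.closedBall a R ×ˢ (univ : Set Space), f p

/-- Weak convergence in `L^p(ℝ⁶)`, for `1 < p < ∞`: convergence of the pairing with every element
of `L^q(ℝ⁶)`, where `q` is the conjugate exponent. -/
def WeakTendstoLp (p : ℝ) (f : ℕ → Phase → ℝ) (f₀ : Phase → ℝ) : Prop :=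
  (∀ i, MemLp (f i) (ENNReal.ofReal p)) ∧ MemLp f₀ (ENNReal.ofReal p) ∧
    ∀ g : Phase → ℝ, MemLp g (ENNReal.ofReal (Real.conjExponent p)) →
      Tendsto (fun i => ∫ w, f i w * g w) atTop (𝓝 (∫ w, f₀ w * g w))

/-- `G` is the weak (distributional) gradient of `u` on `ℝ³`. -/
def IsWeakGradient (u : Space → ℝ) (G : Space → Space) : Prop :=
  LocallyIntegrable u ∧ LocallyIntegrable G ∧
    ∀ ψ : Space → ℝ, ContDiff ℝ ∞ ψ → HasCompactSupport ψ →
      ∫ x, u x • gradient ψ x = -∫ x, ψ x • G x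

/-- `∇u_i → ∇u₀` strongly in `L²(ℝ³)`, with weak gradients; that these exist and lie in `L²` is
part of the claim. -/
def GradientsTendstoL2 (u : ℕ → Space → ℝ) (u₀ : Space → ℝ) : Prop :=
  ∃ (G : ℕ → Space → Space) (G₀ : Space → Space),
    (∀ i, IsWeakGradient (u i) (G i) ∧ MemLp (G i) 2) ∧
    IsWeakGradient u₀ G₀ ∧ MemLp G₀ 2 ∧
    Tendsto (fun i => eLpNorm (G i - G₀) 2 volume) atTop (𝓝 0)

end VlasovPoisson

namespace VlasovPoisson

/-! Write H = T - D/2, where T (`freeEnergy`) is the Casimir functional plus the kinetic energy and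
D (`coulomb`) is the Coulomb double integral of the density with itself. The proof is a
concentration-compactness argument.

Coercivity. D is controlled by the mass and by the integral of ρ^(4/3) (`lintegral_coulomb_le`), and
the latter by the kinetic energy and the integral of f^(5/3) (`lintegral_density_rpow_le`). These
are the exponents of the endpoint k = 3/2. As k < 3/2, f^(5/3) is bounded by a multiple of f plus an
arbitrarily small multiple of Q, so half of T absorbs D/2. Hence H is bounded below and T is bounded
along minimizing sequences (`exists_freeEnergy_le`).

No splitting. A spread-out uniform ball shows that the infimum h is negative (`exists_energy_neg`).
Dilating positions increases |P| and so does not increase Q; this yields H ≥ (m/M)^(5/3) h at mass m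
≤ M (`scaling_le`). Any density can be cut at a sphere of bounded radius across which the
interaction is small (`exists_small_interaction`). Since h < 0 and x^(5/3) + (1-x)^(5/3) falls
strictly below 1 for 0 < x < 1, an almost minimizer with some mass near a point of the axis has
almost all of its mass there (`exists_concentration`).

No vanishing. Negative energy forces D to stay away from zero, so some ball of fixed radius carries
a fixed amount of mass. By axial symmetry such a ball lies near the axis, for otherwise it would
have too many disjoint rotated copies (`exists_axis_mass`). Shifts along the axis, which preserve H,
therefore make the sequence tight.

Passage to the limit. Tightness and the 5/3 bound give a subsequence converging against all bounded
measurable functions (`exists_weak_limit`). Convexity of Q in f makes T weakly lower semicontinuous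
(`freeEnergy_le_of_weak_limit`). Bilinear forms in ρ_n - ρ₀ whose kernel is dominated by 1/|x-y|
tend to zero (`tendsto_bilinear`). This covers D, and it also covers the squared L² norm of the
difference of the fields, since composing two inverse square kernels gives at most a Coulomb kernel
(`abs_fieldKernel_le`). So D converges, the limit has energy at most h, and the fields converge
strongly; `isWeakGradient_potential` identifies the fields as weak gradients. -/

instance : (volume : Measure Phase).IsAddHaarMeasure :=
  inferInstanceAs ((volume : Measure Space).prod volume).IsAddHaarMeasure

/-! ### Coulomb interaction controlled by L¹ and L^(4/3). -/

/-- The area of the unit sphere in `ℝ³`. -/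
noncomputable def sphereArea : ℝ := 3 * volume.real (Metric.ball (0 : Space) 1)

lemma sphereArea_pos : 0 < sphereArea := by
  unfold sphereArea
  have : 0 < volume.real (Metric.ball (0 : Space) 1) :=
    ENNReal.toReal_pos (Metric.measure_ball_pos _ _ one_pos).ne' measure_ball_lt_top.ne
  positivity

lemma lintegral_radial {g : ℝ → ℝ} (hg : ∀ y, 0 ≤ g y)
    (hi : IntegrableOn (fun y => y ^ 2 * g y) (Ioi 0)) :
    ∫⁻ x : Space, ENNReal.ofReal (g ‖x‖) =
      ENNReal.ofReal (sphereArea * ∫ y in Ioi 0, y ^ 2 * g y) := by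
  have h1 : Integrable (fun x : Space => g ‖x‖) := by
    rw [integrable_fun_norm_addHaar]
    simpa using hi
  rw [← ofReal_integral_eq_lintegral_ofReal h1 (ae_of_all _ fun x => hg _),
    integral_fun_norm_addHaar]
  simp [sphereArea, mul_assoc]

lemma lintegral_ball_inv_sq {r : ℝ} (hr : 0 < r) :
    ∫⁻ x in Metric.ball (0 : Space) r, ENNReal.ofReal ((‖x‖ ^ 2)⁻¹) =
      ENNReal.ofReal (sphereArea * r) := by
  have h0 : ∀ y ∈ Ioi (0 : ℝ), y ^ 2 * (Iio r).indicator (fun y => (y ^ 2)⁻¹) y =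
      (Iio r).indicator (fun _ => (1 : ℝ)) y := by
    intro y hy
    have : y ≠ 0 := (mem_Ioi.1 hy).ne'
    by_cases h : y < r <;> simp [h, this]
  have h2 : ∫ y in Ioi (0 : ℝ), y ^ 2 * (Iio r).indicator (fun y => (y ^ 2)⁻¹) y = r := by
    rw [setIntegral_congr_fun measurableSet_Ioi h0, setIntegral_indicator measurableSet_Iio,
      Ioi_inter_Iio]
    simp [hr.le]
  have := lintegral_radial (g := (Iio r).indicator fun y => (y ^ 2)⁻¹)
    (fun y => indicator_nonneg (fun _ _ => by positivity) _) (by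
      rw [integrableOn_congr_fun h0 measurableSet_Ioi, IntegrableOn,
        integrable_indicator_iff measurableSet_Iio, IntegrableOn,
        Measure.restrict_restrict measurableSet_Iio, Iio_inter_Ioi]
      exact integrableOn_const (by simp))
  rw [h2] at this
  rw [← this, ← lintegral_indicator measurableSet_ball]
  congr 1 with x
  by_cases h : ‖x‖ < r <;> simp [h]

lemma lintegral_compl_ball_inv_pow_four {r : ℝ} (hr : 0 < r) :
    ∫⁻ x in (Metric.ball (0 : Space) r)ᶜ, ENNReal.ofReal ((‖x‖ ^ 4)⁻¹) =
      ENNReal.ofReal (sphereArea / r) := by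
  have h0 : ∀ y ∈ Ioi (0 : ℝ), y ^ 2 * (Ici r).indicator (fun y => (y ^ 4)⁻¹) y =
      (Ici r).indicator (fun y => y ^ (-2 : ℝ)) y := by
    intro y hy
    have h1 : y ≠ 0 := (mem_Ioi.1 hy).ne'
    by_cases h : r ≤ y
    · have : y ^ (-2 : ℝ) = (y ^ 2)⁻¹ := by
        rw [Real.rpow_neg (mem_Ioi.1 hy).le]; norm_num
      simp only [mem_Ici, h, indicator_of_mem, this]
      field_simp
    · simp [h]
  have h3 : Ioi (0 : ℝ) ∩ Ici r = Ici r := by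
    ext y; simp only [mem_inter_iff, mem_Ioi, mem_Ici]
    exact ⟨fun h => h.2, fun h => ⟨hr.trans_le h, h⟩⟩
  have h2 : ∫ y in Ioi (0 : ℝ), y ^ 2 * (Ici r).indicator (fun y => (y ^ 4)⁻¹) y = r⁻¹ := by
    rw [setIntegral_congr_fun measurableSet_Ioi h0, setIntegral_indicator measurableSet_Ici,
      h3, integral_Ici_eq_integral_Ioi, integral_Ioi_rpow_of_lt (by norm_num) hr]
    norm_num [Real.rpow_neg_one]
  have := lintegral_radial (g := (Ici r).indicator fun y => (y ^ 4)⁻¹)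
    (fun y => indicator_nonneg (fun _ _ => by positivity) _) (by
      rw [integrableOn_congr_fun h0 measurableSet_Ioi, IntegrableOn,
        integrable_indicator_iff measurableSet_Ici, IntegrableOn,
        Measure.restrict_restrict measurableSet_Ici, inter_comm, h3]
      exact (integrableOn_Ici_iff_integrableOn_Ioi).2
        (integrableOn_Ioi_rpow_of_lt (by norm_num) hr))
  rw [h2] at this
  rw [div_eq_mul_inv, ← this, ← lintegral_indicator measurableSet_ball.compl]
  congr 1 with x
  by_cases h : r ≤ ‖x‖ <;> simp [h]

/-- `ρ` is a density with mass at most `m` and `∫ |ρ|^{4/3} ≤ A`. -/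
structure DensityBound (ρ : Space → ℝ) (m A : ℝ) : Prop where
  integrable : Integrable ρ
  mass : ∫⁻ x, ENNReal.ofReal |ρ x| ≤ ENNReal.ofReal m
  power : ∫⁻ x, ENNReal.ofReal (|ρ x| ^ (4 / 3 : ℝ)) ≤ ENNReal.ofReal A

/-- The modulus of the integrand of the Coulomb interaction. -/
noncomputable def coulombDensity (ρ σ : Space → ℝ) (z : Space × Space) : ℝ≥0∞ :=
  ENNReal.ofReal (|ρ z.1| * |σ z.2| / ‖z.1 - z.2‖)

/-- The pairs of points at distance less than `r`. -/
def nearSet (r : ℝ) : Set (Space × Space) := {z | ‖z.1 - z.2‖ < r}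

lemma measurableSet_nearSet (r : ℝ) : MeasurableSet (nearSet r) :=
  measurableSet_lt (by fun_prop) measurable_const

/-- With a = α³, b = β³, e = 1/d, the left side is the product of sα²β² and αβe/s for t = s², so the
arithmetic-geometric inequality applies, followed by α²β² ≤ α⁴ + β⁴. The kernel enters only as d⁻²,
which is locally integrable in dimension three. This elementary bound takes the place of the
Hardy-Littlewood-Sobolev inequality. -/
lemma near_pointwise {a b d t : ℝ} (ha : 0 ≤ a) (hb : 0 ≤ b) (hd : 0 ≤ d) (ht : 0 < t) :
    a * b / d ≤ t * (a ^ (4 / 3 : ℝ) * b ^ (4 / 3 : ℝ)) +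
      t⁻¹ * ((a ^ (4 / 3 : ℝ) + b ^ (4 / 3 : ℝ)) * (d ^ 2)⁻¹) := by
  obtain ⟨α, hα, rfl⟩ : ∃ α : ℝ, 0 ≤ α ∧ a = α ^ 3 :=
    ⟨a ^ (1 / 3 : ℝ), by positivity, by
      rw [← Real.rpow_natCast, ← Real.rpow_mul ha]; norm_num⟩
  obtain ⟨β, hβ, rfl⟩ : ∃ β : ℝ, 0 ≤ β ∧ b = β ^ 3 :=
    ⟨b ^ (1 / 3 : ℝ), by positivity, by
      rw [← Real.rpow_natCast, ← Real.rpow_mul hb]; norm_num⟩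
  have h4 : ∀ x : ℝ, 0 ≤ x → (x ^ 3) ^ (4 / 3 : ℝ) = x ^ 4 := by
    intro x hx
    rw [← Real.rpow_natCast, ← Real.rpow_mul hx, ← Real.rpow_natCast]; norm_num
  rw [h4 α hα, h4 β hβ]
  set e := d⁻¹ with he
  have he0 : 0 ≤ e := by positivity
  have hd2 : (d ^ 2)⁻¹ = e ^ 2 := (inv_pow d 2).symm
  rw [div_eq_mul_inv, ← he, hd2]
  obtain ⟨s, hs, rfl⟩ : ∃ s : ℝ, 0 < s ∧ t = s ^ 2 := ⟨√t, by positivity, by simp [ht.le]⟩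
  have h1 : α ^ 3 * β ^ 3 * e ≤ s ^ 2 * (α ^ 4 * β ^ 4) + (s ^ 2)⁻¹ * (α ^ 2 * β ^ 2 * e ^ 2) := by
    have : s ^ 2 * (α ^ 4 * β ^ 4) + (s ^ 2)⁻¹ * (α ^ 2 * β ^ 2 * e ^ 2) - α ^ 3 * β ^ 3 * e =
      (s * α ^ 2 * β ^ 2 - s⁻¹ * α * β * e) ^ 2 + α ^ 3 * β ^ 3 * e := by
      field_simp; ring
    have : 0 ≤ α ^ 3 * β ^ 3 * e := by positivity
    nlinarith [sq_nonneg (s * α ^ 2 * β ^ 2 - s⁻¹ * α * β * e)]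
  have h2 : α ^ 2 * β ^ 2 ≤ α ^ 4 + β ^ 4 := by nlinarith [sq_nonneg (α ^ 2 - β ^ 2), sq_nonneg (α^2), sq_nonneg (β^2)]
  refine h1.trans ?_
  gcongr

lemma DensityBound.aemeasurable {ρ : Space → ℝ} {m A : ℝ} (h : DensityBound ρ m A) :
    AEMeasurable ρ := h.integrable.aestronglyMeasurable.aemeasurable

lemma lintegral_near_kernel (r : ℝ) (hr : 0 < r) (x : Space) :
    ∫⁻ y, (nearSet r).indicator (fun z => ENNReal.ofReal ((‖z.1 - z.2‖ ^ 2)⁻¹)) (x, y) =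
      ENNReal.ofReal (sphereArea * r) := by
  rw [← lintegral_ball_inv_sq hr, ← lintegral_indicator measurableSet_ball,
    ← lintegral_sub_left_eq_self _ x]
  congr 1 with y
  simp [indicator, nearSet]

lemma lintegral_near_kernel' (r : ℝ) (hr : 0 < r) (y : Space) :
    ∫⁻ x, (nearSet r).indicator (fun z => ENNReal.ofReal ((‖z.1 - z.2‖ ^ 2)⁻¹)) (x, y) =
      ENNReal.ofReal (sphereArea * r) := by
  rw [← lintegral_near_kernel r hr y]
  congr 1 with x
  by_cases h : ‖y - x‖ < r <;> simp [nearSet, norm_sub_rev x y, h]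

lemma measurable_near_kernel (r : ℝ) :
    Measurable ((nearSet r).indicator
      (fun z : Space × Space => ENNReal.ofReal ((‖z.1 - z.2‖ ^ 2)⁻¹))) :=
  (by fun_prop : Measurable fun z : Space × Space =>
    ENNReal.ofReal ((‖z.1 - z.2‖ ^ 2)⁻¹)).indicator (measurableSet_nearSet r)

/-- The point is the two free parameters: with r = t² the bound becomes a multiple of t, so the
interaction at short distance is small uniformly over all densities with the same A. -/
lemma lintegral_near_le {ρ σ : Space → ℝ} {m A : ℝ} (hρ : DensityBound ρ m A)
    (hσ : DensityBound σ m A) (hA : 0 ≤ A) {t r : ℝ} (ht : 0 < t) (hr : 0 < r) :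
    ∫⁻ z in nearSet r, coulombDensity ρ σ z ≤
      ENNReal.ofReal (t * A ^ 2 + 2 * sphereArea * A * r / t) := by
  set a : Space → ℝ≥0∞ := fun x => ENNReal.ofReal (|ρ x| ^ (4 / 3 : ℝ)) with ha
  set b : Space → ℝ≥0∞ := fun x => ENNReal.ofReal (|σ x| ^ (4 / 3 : ℝ)) with hb
  set k := (nearSet r).indicator
      (fun z : Space × Space => ENNReal.ofReal ((‖z.1 - z.2‖ ^ 2)⁻¹)) with hk
  have hkm : Measurable k := measurable_near_kernel r
  have ham : AEMeasurable a := by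
    have := hρ.aemeasurable
    fun_prop
  have hbm : AEMeasurable b := by
    have := hσ.aemeasurable
    fun_prop
  have hκ := sphereArea_pos
  have hpt : ∀ z, (nearSet r).indicator (coulombDensity ρ σ) z ≤
      ENNReal.ofReal t * (a z.1 * b z.2) +
        ENNReal.ofReal t⁻¹ * (a z.1 * k z + b z.2 * k z) := by
    intro z
    by_cases hz : z ∈ nearSet r
    · simp only [indicator_of_mem hz, hk, ha, hb, coulombDensity]
      rw [← ENNReal.ofReal_mul (by positivity), ← ENNReal.ofReal_mul (by positivity),
        ← ENNReal.ofReal_mul (by positivity), ← ENNReal.ofReal_mul (by positivity),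
        ← ENNReal.ofReal_add (by positivity) (by positivity),
        ← ENNReal.ofReal_mul (by positivity), ← ENNReal.ofReal_add (by positivity) (by positivity),
        ← add_mul]
      exact ENNReal.ofReal_le_ofReal
        (near_pointwise (abs_nonneg _) (abs_nonneg _) (norm_nonneg _) ht)
    · simp [hz]
  have ham' : AEMeasurable (fun z : Space × Space => a z.1) := ham.comp_quasiMeasurePreserving Measure.quasiMeasurePreserving_fst
  have hbm' : AEMeasurable (fun z : Space × Space => b z.2) := hbm.comp_quasiMeasurePreserving Measure.quasiMeasurePreserving_snd
  have hab : AEMeasurable (fun z : Space × Space => a z.1 * b z.2) := ham'.mul hbm'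
  have hak : AEMeasurable (fun z : Space × Space => a z.1 * k z) := ham'.mul hkm.aemeasurable
  have hbk : AEMeasurable (fun z : Space × Space => b z.2 * k z) := hbm'.mul hkm.aemeasurable
  have h1 : ∫⁻ z : Space × Space, a z.1 * b z.2 = (∫⁻ x, a x) * ∫⁻ y, b y :=
    lintegral_prod_mul ham hbm
  have h2 : ∫⁻ z : Space × Space, a z.1 * k z =
      (∫⁻ x, a x) * ENNReal.ofReal (sphereArea * r) := by
    rw [Measure.volume_eq_prod, lintegral_prod _ hak]
    have (x : Space) : ∫⁻ y, a x * k (x, y) = a x * ENNReal.ofReal (sphereArea * r) := by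
      rw [lintegral_const_mul' _ _ ENNReal.ofReal_ne_top, hk, lintegral_near_kernel r hr]
    simp only [this]
    rw [lintegral_mul_const'' _ ham]
  have h3 : ∫⁻ z : Space × Space, b z.2 * k z =
      (∫⁻ x, b x) * ENNReal.ofReal (sphereArea * r) := by
    rw [Measure.volume_eq_prod, lintegral_prod_symm _ hbk]
    have (y : Space) : ∫⁻ x, b y * k (x, y) = b y * ENNReal.ofReal (sphereArea * r) := by
      rw [lintegral_const_mul' _ _ ENNReal.ofReal_ne_top, hk, lintegral_near_kernel' r hr]
    simp only [this]
    rw [lintegral_mul_const'' _ hbm]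
  rw [← lintegral_indicator (measurableSet_nearSet r)]
  refine (lintegral_mono hpt).trans ?_
  rw [lintegral_add_left' (hab.const_mul _), lintegral_const_mul'' _ hab,
    lintegral_const_mul' _ _ ENNReal.ofReal_ne_top, lintegral_add_left' hak, h1, h2, h3]
  refine (add_le_add (mul_le_mul_right (mul_le_mul' hρ.power hσ.power) _)
    (mul_le_mul_right (add_le_add (mul_le_mul_left hρ.power _)
      (mul_le_mul_left hσ.power _)) _)).trans ?_
  rw [← ENNReal.ofReal_mul (by positivity), ← ENNReal.ofReal_mul (by positivity),
    ← ENNReal.ofReal_mul (by positivity),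
    ← ENNReal.ofReal_add (by positivity) (by positivity),
    ← ENNReal.ofReal_mul (by positivity), ← ENNReal.ofReal_add (by positivity) (by positivity)]
  apply ENNReal.ofReal_le_ofReal
  apply le_of_eq
  field_simp
  ring

lemma lintegral_abs_mul_abs {ρ σ : Space → ℝ} (hρ : AEMeasurable ρ) (hσ : AEMeasurable σ) :
    ∫⁻ z : Space × Space, ENNReal.ofReal (|ρ z.1| * |σ z.2|) =
      (∫⁻ x, ENNReal.ofReal |ρ x|) * ∫⁻ y, ENNReal.ofReal |σ y| := by
  simp_rw [ENNReal.ofReal_mul (abs_nonneg _)]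
  exact lintegral_prod_mul (f := fun x => ENNReal.ofReal |ρ x|)
    (g := fun x => ENNReal.ofReal |σ x|) (by fun_prop) (by fun_prop)

lemma lintegral_far_le {ρ σ : Space → ℝ} (hρ : AEMeasurable ρ) (hσ : AEMeasurable σ)
    {r : ℝ} (hr : 0 < r) {s : Set (Space × Space)}  (hs : ∀ z ∈ s, r ≤ ‖z.1 - z.2‖)
    (hsm : MeasurableSet s) :
    ∫⁻ z in s, coulombDensity ρ σ z ≤
      ENNReal.ofReal r⁻¹ * ((∫⁻ x, ENNReal.ofReal |ρ x|) * ∫⁻ y, ENNReal.ofReal |σ y|) := by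
  rw [← lintegral_abs_mul_abs hρ hσ, ← lintegral_indicator hsm,
    ← lintegral_const_mul' _ _ ENNReal.ofReal_ne_top]
  refine lintegral_mono fun z => ?_
  by_cases hz : z ∈ s
  · rw [indicator_of_mem hz, ← ENNReal.ofReal_mul (by positivity)]
    apply ENNReal.ofReal_le_ofReal
    rw [div_eq_inv_mul]
    gcongr
    exact hs z hz
  · simp [hz]

/-- Estimate of the Coulomb interaction by the mass and by `∫ |ρ|^{4/3}`. -/
lemma lintegral_coulomb_le {ρ σ : Space → ℝ} {m A μ ν : ℝ} (hρ : DensityBound ρ m A)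
    (hσ : DensityBound σ m A) (hμ : ∫⁻ x, ENNReal.ofReal |ρ x| ≤ ENNReal.ofReal μ)
    (hν : ∫⁻ x, ENNReal.ofReal |σ x| ≤ ENNReal.ofReal ν) (hA : 0 ≤ A)
    (hμ0 : 0 ≤ μ) (hν0 : 0 ≤ ν) {t r : ℝ} (ht : 0 < t) (hr : 0 < r) :
    ∫⁻ z, coulombDensity ρ σ z ≤
      ENNReal.ofReal (t * A ^ 2 + 2 * sphereArea * A * r / t + μ * ν / r) := by
  have hκ := sphereArea_pos
  rw [← lintegral_add_compl _ (measurableSet_nearSet r), ENNReal.ofReal_add (by positivity) (by positivity)]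
  refine add_le_add (lintegral_near_le hρ hσ hA ht hr) ?_
  refine (lintegral_far_le hρ.aemeasurable hσ.aemeasurable hr (s := (nearSet r)ᶜ)
    (fun z hz => not_lt.1 hz) (measurableSet_nearSet r).compl).trans ?_
  refine (mul_le_mul_right (mul_le_mul' hμ hν) _).trans (le_of_eq ?_)
  rw [← ENNReal.ofReal_mul hμ0, ← ENNReal.ofReal_mul (by positivity)]
  congr 1
  field_simp

end VlasovPoisson

/-! ### Spatial density controlled by kinetic energy and L^(5/3). -/

namespace VlasovPoisson

/-- The constant in the estimate of `∫ ρ^{4/3}`. -/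
noncomputable def densityConst : ℝ := max 1 (2 * volume.real (Metric.ball (0 : Space) 1))

lemma densityConst_pos : 0 < densityConst := lt_max_of_lt_left one_pos

/-- Truncation at height β³: above it, g = g^(5/3) g^(-2/3) ≤ β⁻² g^(5/3). -/
lemma le_add_rpow_five_thirds {β : ℝ} (hβ : 0 < β) {g : ℝ} (hg : 0 ≤ g) :
    g ≤ β ^ 3 + (β ^ 2)⁻¹ * g ^ (5 / 3 : ℝ) := by
  obtain ⟨α, hα, rfl⟩ : ∃ α : ℝ, 0 ≤ α ∧ g = α ^ 3 :=
    ⟨g ^ (1 / 3 : ℝ), by positivity, by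
      rw [← Real.rpow_natCast, ← Real.rpow_mul hg]; norm_num⟩
  have : (α ^ 3) ^ (5 / 3 : ℝ) = α ^ 5 := by
    rw [← Real.rpow_natCast, ← Real.rpow_mul hα, ← Real.rpow_natCast]; norm_num
  rw [this]
  rcases le_total α β with h | h
  · have : α ^ 3 ≤ β ^ 3 := by gcongr
    have : 0 ≤ (β ^ 2)⁻¹ * α ^ 5 := by positivity
    linarith
  · have h1 : α ^ 3 ≤ (β ^ 2)⁻¹ * α ^ 5 := by
      rw [inv_mul_eq_div, le_div_iff₀ (by positivity)]
      have : β ^ 2 ≤ α ^ 2 := by gcongr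
      calc α ^ 3 * β ^ 2 ≤ α ^ 3 * α ^ 2 := by gcongr
        _ = α ^ 5 := by ring
    have : 0 ≤ β ^ 3 := by positivity
    linarith

lemma volume_real_ball {V : ℝ} (hV : 0 < V) :
    volume (Metric.ball (0 : Space) V) =
      ENNReal.ofReal (V ^ 3 * volume.real (Metric.ball (0 : Space) 1)) := by
  rw [Measure.addHaar_ball_of_pos _ _ hV, ENNReal.ofReal_mul (by positivity)]
  simp [Measure.real]

/-- The estimate of a velocity average by its kinetic energy and its `5/3`-moment. -/
lemma rpow_integral_velocity_le {g : Space → ℝ} (hg : Integrable g) {τ : ℝ} (hτ : 0 < τ) :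
    ENNReal.ofReal (|∫ v, g v| ^ (4 / 3 : ℝ)) ≤
      ENNReal.ofReal (2 * densityConst) *
        (ENNReal.ofReal τ * (∫⁻ v, ENNReal.ofReal (‖v‖ ^ 2 * |g v|)) +
          ENNReal.ofReal τ⁻¹ * ∫⁻ v, ENNReal.ofReal (|g v| ^ (5 / 3 : ℝ))) := by
  set a := ∫⁻ v, ENNReal.ofReal (|g v| ^ (5 / 3 : ℝ)) with ha
  set b := ∫⁻ v, ENNReal.ofReal (‖v‖ ^ 2 * |g v|) with hb
  set κ := densityConst with hκ
  have hκ0 : 0 < κ := densityConst_pos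
  set w := volume.real (Metric.ball (0 : Space) 1) with hw
  have hgm := hg.aestronglyMeasurable.aemeasurable
  by_cases hat : a = ⊤
  · rw [hat, ENNReal.mul_top (by simpa using hτ), add_top, ENNReal.mul_top (by simpa using hκ0)]
    exact le_top
  by_cases hbt : b = ⊤
  · rw [hbt, ENNReal.mul_top (by simpa using hτ), top_add, ENNReal.mul_top (by simpa using hκ0)]
    exact le_top
  set r := |∫ v, g v| with hr
  rcases (abs_nonneg (∫ v, g v)).eq_or_lt with h0 | h0
  · rw [hr, ← h0, Real.zero_rpow (by norm_num), ENNReal.ofReal_zero]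
    exact zero_le
  obtain ⟨s, hs, hrs⟩ : ∃ s : ℝ, 0 < s ∧ r = s ^ 3 :=
    ⟨r ^ (1 / 3 : ℝ), by positivity, by
      rw [← Real.rpow_natCast, ← Real.rpow_mul (abs_nonneg _)]; norm_num [hr]⟩
  -- The density is split at speed V and at height β³. Since βV = s/κ, the contribution of the
  -- velocity ball is at most (s/κ)³w ≤ s³/2, because κ ≥ 1 and κ ≥ 2w, and is absorbed into r = s³.
  -- The ratio of β and V turns the remaining terms into κ(τb + τ⁻¹a)/s.
  set V := √(s / (κ * τ)) with hV
  set β := √(τ * s / κ) with hβ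
  have hV0 : 0 < V := by positivity
  have hβ0 : 0 < β := by positivity
  have hV2 : V ^ 2 = s / (κ * τ) := Real.sq_sqrt (by positivity)
  have hβ2 : β ^ 2 = τ * s / κ := Real.sq_sqrt (by positivity)
  have hβV : β * V = s / κ := by
    have : (β * V) ^ 2 = (s / κ) ^ 2 := by
      rw [mul_pow, hV2, hβ2]; field_simp
    exact (pow_left_inj₀ (by positivity) (by positivity) two_ne_zero).1 this
  have hpt : ∀ v, ENNReal.ofReal |g v| ≤
      ENNReal.ofReal (β ^ 3) * (Metric.ball (0 : Space) V).indicator 1 v +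
        (ENNReal.ofReal (β ^ 2)⁻¹ * ENNReal.ofReal (|g v| ^ (5 / 3 : ℝ)) +
          ENNReal.ofReal (V ^ 2)⁻¹ * ENNReal.ofReal (‖v‖ ^ 2 * |g v|)) := by
    intro v
    by_cases hv : v ∈ Metric.ball (0 : Space) V
    · rw [indicator_of_mem hv, Pi.one_apply, mul_one, ← ENNReal.ofReal_mul (by positivity),
        ← add_assoc, ← ENNReal.ofReal_add (by positivity) (by positivity)]
      exact (ENNReal.ofReal_le_ofReal (le_add_rpow_five_thirds hβ0 (abs_nonneg _))).trans
        le_self_add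
    · have hv' : V ≤ ‖v‖ := by simpa using hv
      refine le_trans ?_ (le_add_left (le_add_left le_rfl))
      rw [← ENNReal.ofReal_mul (by positivity)]
      apply ENNReal.ofReal_le_ofReal
      rw [inv_mul_eq_div, le_div_iff₀ (by positivity), mul_comm]
      gcongr
  have hint : ENNReal.ofReal r ≤ ENNReal.ofReal (β ^ 3) * ENNReal.ofReal (V ^ 3 * w) +
      (ENNReal.ofReal (β ^ 2)⁻¹ * a + ENNReal.ofReal (V ^ 2)⁻¹ * b) := by
    have h1 : ENNReal.ofReal r ≤ ∫⁻ v, ENNReal.ofReal |g v| := by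
      have := enorm_integral_le_lintegral_enorm (μ := volume) g
      simpa [hr, Real.enorm_eq_ofReal_abs] using this
    refine h1.trans ((lintegral_mono hpt).trans ?_)
    rw [lintegral_add_left (f := fun v => ENNReal.ofReal (β ^ 3) *
        (Metric.ball (0 : Space) V).indicator 1 v)
        (measurable_const.mul (measurable_one.indicator measurableSet_ball)),
      lintegral_const_mul' _ _ ENNReal.ofReal_ne_top, lintegral_indicator_one measurableSet_ball,
      volume_real_ball hV0, lintegral_add_left' (by fun_prop),
      lintegral_const_mul' _ _ ENNReal.ofReal_ne_top,
      lintegral_const_mul' _ _ ENNReal.ofReal_ne_top]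
  rw [← ENNReal.ofReal_toReal hat, ← ENNReal.ofReal_toReal hbt] at hint ⊢
  set a' := a.toReal
  set b' := b.toReal
  have ha' : 0 ≤ a' := ENNReal.toReal_nonneg
  have hb' : 0 ≤ b' := ENNReal.toReal_nonneg
  have hw0 : 0 ≤ w := measureReal_nonneg
  rw [← ENNReal.ofReal_mul (by positivity), ← ENNReal.ofReal_mul (by positivity),
    ← ENNReal.ofReal_mul (by positivity), ← ENNReal.ofReal_add (by positivity) (by positivity),
    ← ENNReal.ofReal_add (by positivity) (by positivity),
    ENNReal.ofReal_le_ofReal_iff (by positivity)] at hint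
  rw [← ENNReal.ofReal_mul (by positivity), ← ENNReal.ofReal_mul (by positivity),
    ← ENNReal.ofReal_add (by positivity) (by positivity), ← ENNReal.ofReal_mul (by positivity)]
  apply ENNReal.ofReal_le_ofReal
  have h43 : r ^ (4 / 3 : ℝ) = s ^ 4 := by
    rw [hrs, ← Real.rpow_natCast, ← Real.rpow_mul hs.le, ← Real.rpow_natCast]; norm_num
  rw [h43]
  have hκw : 2 * w ≤ κ ^ 3 := by
    have h1 : 1 ≤ κ := le_max_left _ _
    have h2 : 2 * w ≤ κ := le_max_right _ _
    nlinarith [mul_nonneg (sub_nonneg.2 h1) (sub_nonneg.2 h1)]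
  have e1 : β ^ 3 * (V ^ 3 * w) ≤ s ^ 3 / 2 := by
    have : β ^ 3 * (V ^ 3 * w) = (s / κ) ^ 3 * w := by rw [← hβV]; ring
    rw [this, div_pow, div_mul_eq_mul_div, div_le_div_iff₀ (by positivity) two_pos]
    nlinarith [mul_le_mul_of_nonneg_left hκw (by positivity : 0 ≤ s ^ 3)]
  rw [hβ2, hV2] at hint
  have h5 : s ^ 3 / 2 ≤ (τ * s / κ)⁻¹ * a' + (s / (κ * τ))⁻¹ * b' := by rw [hrs] at hint; linarith
  have h6 : (τ * s / κ)⁻¹ * a' + (s / (κ * τ))⁻¹ * b' = κ * (τ * b' + τ⁻¹ * a') / s := by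
    field_simp; ring
  rw [h6, le_div_iff₀ hs] at h5
  nlinarith

/-- Twice the kinetic energy of `|f|`. -/
noncomputable def velocityMoment (f : Phase → ℝ) : ℝ≥0∞ :=
  ∫⁻ p : Phase, ENNReal.ofReal (‖p.2‖ ^ 2 * |f p|)

/-- The integral `∬ |f|^{5/3}`. -/
noncomputable def fiveThirds (f : Phase → ℝ) : ℝ≥0∞ :=
  ∫⁻ p : Phase, ENNReal.ofReal (|f p| ^ (5 / 3 : ℝ))

lemma lintegral_phase {F : Phase → ℝ≥0∞} (hF : AEMeasurable F) :
    ∫⁻ p, F p = ∫⁻ x, ∫⁻ v, F (x, v) := by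
  rw [Measure.volume_eq_prod, lintegral_prod _ hF]

/-- As τ does not depend on x, the estimate at fixed x integrates directly, and the result is linear
in the two moments. -/
lemma lintegral_density_rpow_le {f : Phase → ℝ} (hf : Integrable f) {τ : ℝ} (hτ : 0 < τ) :
    ∫⁻ x, ENNReal.ofReal (|density f x| ^ (4 / 3 : ℝ)) ≤
      ENNReal.ofReal (2 * densityConst) *
        (ENNReal.ofReal τ * velocityMoment f + ENNReal.ofReal τ⁻¹ * fiveThirds f) := by
  have hm := hf.aestronglyMeasurable.aemeasurable
  have h1 : AEMeasurable (fun p : Phase => ENNReal.ofReal (‖p.2‖ ^ 2 * |f p|)) := by fun_prop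
  have h2 : AEMeasurable (fun p : Phase => ENNReal.ofReal (|f p| ^ (5 / 3 : ℝ))) := by fun_prop
  have h3 : ∀ᵐ x : Space, Integrable (fun v => f (x, v)) := hf.prod_right_ae
  refine (lintegral_mono_ae (h3.mono fun x hx => rpow_integral_velocity_le hx hτ)).trans ?_
  rw [velocityMoment, fiveThirds, lintegral_phase h1, lintegral_phase h2,
    lintegral_const_mul' _ _ ENNReal.ofReal_ne_top]
  rw [lintegral_add_left' (h1.lintegral_prod_right'.const_mul _),
      lintegral_const_mul' _ _ ENNReal.ofReal_ne_top,
      lintegral_const_mul' _ _ ENNReal.ofReal_ne_top]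

lemma integrable_density {f : Phase → ℝ} (hf : Integrable f) : Integrable (density f) :=
  hf.integral_prod_left

lemma lintegral_abs_density_le {f : Phase → ℝ} (hf : Integrable f) :
    ∫⁻ x, ENNReal.ofReal |density f x| ≤ ∫⁻ p, ENNReal.ofReal |f p| := by
  have hm := hf.aestronglyMeasurable.aemeasurable
  rw [lintegral_phase (by fun_prop)]
  refine lintegral_mono fun x => ?_
  have := enorm_integral_le_lintegral_enorm (μ := volume) (fun v => f (x, v))
  simpa [density, Real.enorm_eq_ofReal_abs] using this

end VlasovPoisson

namespace VlasovPoisson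

/-! ### Consequences of the assumptions on Q. -/

section Casimir

variable {Q : ℝ → ℝ → ℝ} {k : ℝ}

/-- Nothing is known about Q at negative first argument; replacing f by its positive part gives a
globally continuous function, through which measurability is obtained. -/
lemma CasimirAssumptions.continuous_max (hQ : CasimirAssumptions Q k) :
    Continuous (fun q : ℝ × ℝ => Q (max q.1 0) q.2) := by
  have h : Continuous (fun q : ℝ × ℝ => (max q.1 0, q.2)) := by fun_prop
  exact hQ.cont.comp_continuous h (fun q => mk_mem_prod (mem_Ici.2 (le_max_right _ _)) (mem_univ _))

lemma CasimirAssumptions.continuous_partial_max (hQ : CasimirAssumptions Q k) :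
    Continuous (fun q : ℝ × ℝ => partialF Q (max q.1 0) q.2) := by
  have h : Continuous (fun q : ℝ × ℝ => (max q.1 0, q.2)) := by fun_prop
  exact hQ.cont_partial.comp_continuous h (fun q => mk_mem_prod (mem_Ici.2 (le_max_right _ _)) (mem_univ _))

lemma continuous_angMom : Continuous angMom := by
  unfold angMom
  fun_prop

lemma CasimirAssumptions.aemeasurable (hQ : CasimirAssumptions Q k) {f : Phase → ℝ}
    (hf : AEMeasurable f) (h0 : ∀ᵐ p, 0 ≤ f p) :
    AEMeasurable (fun p => Q (f p) (angMom p)) := by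
  have h1 : AEMeasurable (fun p => Q (max (f p) 0) (angMom p)) :=
    hQ.continuous_max.measurable.comp_aemeasurable
      (hf.prodMk continuous_angMom.measurable.aemeasurable)
  refine h1.congr (h0.mono fun p hp => ?_)
  simp [max_eq_left hp]

lemma CasimirAssumptions.continuous_angular (hQ : CasimirAssumptions Q k) {s : ℝ} (hs : 0 ≤ s) :
    Continuous (Q s) := by
  have : Continuous (fun P : ℝ => Q (max s 0) P) :=
    hQ.continuous_max.comp (by fun_prop : Continuous fun P : ℝ => (s, P))
  simpa [max_eq_left hs] using this

/-- Monotonicity is assumed only on the open half lines; continuity in P carries it to P = 0. -/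
lemma CasimirAssumptions.le_zero (hQ : CasimirAssumptions Q k) {s : ℝ} (hs : 0 ≤ s) (P : ℝ) :
    Q s P ≤ Q s 0 := by
  have hc := hQ.continuous_angular hs
  rcases lt_trichotomy P 0 with h | h | h
  · refine ge_of_tendsto (hc.continuousWithinAt (s := Iio 0) (x := 0)) ?_
    filter_upwards [mem_nhdsWithin_of_mem_nhds (Ioi_mem_nhds h), self_mem_nhdsWithin] with y hy hy'
    exact hQ.mono_neg s hs h hy' (mem_Ioi.1 hy).le
  · rw [h]
  · refine ge_of_tendsto (hc.continuousWithinAt (s := Ioi 0) (x := 0)) ?_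
    filter_upwards [mem_nhdsWithin_of_mem_nhds (Iio_mem_nhds h), self_mem_nhdsWithin] with y hy hy'
    exact hQ.anti_pos s hs hy' h (mem_Iio.1 hy).le

/-- Moving P away from zero lowers Q. This is what the dilation argument needs. -/
lemma CasimirAssumptions.mul_le (hQ : CasimirAssumptions Q k) {s : ℝ} (hs : 0 ≤ s) (P : ℝ)
    {c : ℝ} (hc : 1 ≤ c) : Q s (c * P) ≤ Q s P := by
  rcases lt_trichotomy P 0 with h | h | h
  · exact hQ.mono_neg s hs (mem_Iio.2 (by nlinarith)) h (by nlinarith)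
  · simp [h]
  · exact hQ.anti_pos s hs h (mem_Ioi.2 (by nlinarith)) (by nlinarith)

lemma CasimirAssumptions.rpow_le (hQ : CasimirAssumptions Q k) :
    ∃ a b : ℝ, 0 < a ∧ 0 < b ∧ ∀ s P, 0 ≤ s → s ^ (1 + 1 / k) ≤ a * s + b * Q s P := by
  obtain ⟨C, F, hC, hF, h⟩ := hQ.growth
  have hk := hQ.k_pos
  refine ⟨F ^ (1 / k), C⁻¹, by positivity, by positivity, fun s P hs => ?_⟩
  have hQ0 := hQ.nonneg s P hs
  rcases le_total s F with hsF | hsF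
  · have : s ^ (1 + 1 / k) ≤ F ^ (1 / k) * s := by
      rw [Real.rpow_add' hs (by positivity), Real.rpow_one, mul_comm]
      gcongr
    have : 0 ≤ C⁻¹ * Q s P := by positivity
    linarith
  · have h1 := h s P hsF
    have : s ^ (1 + 1 / k) ≤ C⁻¹ * Q s P := by
      rw [inv_mul_eq_div, le_div_iff₀ hC]; linarith
    have : 0 ≤ F ^ (1 / k) * s := by positivity
    linarith

/-- Because k < 3/2, the growth exponent 1 + 1/k exceeds 5/3. Above a threshold l the power s^(5/3)
is at most ηQ, and below it at most l^(2/3) s. The smallness of η makes the energy coercive. -/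
lemma CasimirAssumptions.five_thirds_le (hQ : CasimirAssumptions Q k) {η : ℝ} (hη : 0 < η) :
    ∃ L : ℝ, 0 < L ∧ ∀ s P, 0 ≤ s → s ^ (5 / 3 : ℝ) ≤ L * s + η * Q s P := by
  obtain ⟨C, F, hC, hF, h⟩ := hQ.growth
  have hk := hQ.k_pos
  have hk1 : 2 / 3 < 1 / k := by
    rw [lt_div_iff₀ hk]; linarith [hQ.k_lt]
  have ht : Tendsto (fun l : ℝ => C⁻¹ * l ^ (-(1 / k - 2 / 3))) atTop (𝓝 (C⁻¹ * 0)) :=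
    (tendsto_rpow_neg_atTop (by linarith)).const_mul _
  rw [mul_zero] at ht
  obtain ⟨l, hl1, hl2, hl3⟩ := ((ht.eventually_lt_const hη).and
    ((eventually_ge_atTop F).and (eventually_gt_atTop 0))).exists
  refine ⟨l ^ (2 / 3 : ℝ), by positivity, fun s P hs => ?_⟩
  have hQ0 := hQ.nonneg s P hs
  rcases le_total s l with hsl | hsl
  · have : s ^ (5 / 3 : ℝ) ≤ l ^ (2 / 3 : ℝ) * s := by
      rw [show (5 / 3 : ℝ) = 2 / 3 + 1 by norm_num, Real.rpow_add' hs (by norm_num), Real.rpow_one]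
      gcongr
    have : 0 ≤ η * Q s P := by positivity
    linarith
  · have hs0 : 0 < s := hl3.trans_le hsl
    have h1 := h s P (hl2.trans hsl)
    have h2 : s ^ (5 / 3 : ℝ) = s ^ (-(1 / k - 2 / 3)) * s ^ (1 + 1 / k) := by
      rw [← Real.rpow_add hs0]; ring_nf
    have h3 : s ^ (-(1 / k - 2 / 3)) ≤ l ^ (-(1 / k - 2 / 3)) :=
      Real.rpow_le_rpow_of_nonpos hl3 hsl (by linarith)
    have h4 : s ^ (1 + 1 / k) ≤ C⁻¹ * Q s P := by
      rw [inv_mul_eq_div, le_div_iff₀ hC]; linarith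
    have : s ^ (5 / 3 : ℝ) ≤ η * Q s P := by
      rw [h2]
      calc _ ≤ l ^ (-(1 / k - 2 / 3)) * (C⁻¹ * Q s P) := by gcongr
        _ = (C⁻¹ * l ^ (-(1 / k - 2 / 3))) * Q s P := by ring
        _ ≤ _ := by gcongr
    have : 0 ≤ l ^ (2 / 3 : ℝ) * s := by positivity
    linarith

lemma CasimirAssumptions.hasDerivAt (hQ : CasimirAssumptions Q k) {s : ℝ} (hs : 0 < s) (P : ℝ) :
    HasDerivAt (fun s => Q s P) (partialF Q s P) s :=
  ((hQ.diff P s hs.le).hasDerivWithinAt).hasDerivAt (Ici_mem_nhds hs)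

lemma CasimirAssumptions.convexOn (hQ : CasimirAssumptions Q k) (P : ℝ) :
    ConvexOn ℝ (Ici 0) (fun s => Q s P) := by
  have hcont : ContinuousOn (fun s => Q s P) (Ici 0) := (hQ.diff P).continuousOn
  have hmono : MonotoneOn (fun s => partialF Q s P) (Ioi 0) := by
    refine monotoneOn_of_deriv_nonneg (convex_Ioi 0)
      ((hQ.diff_partial P).continuousOn.mono Ioi_subset_Ici_self)
      ((hQ.diff_partial P).mono (by simp)) ?_
    intro s hs
    rw [interior_Ioi] at hs
    have h1 : HasDerivAt (fun s => partialF Q s P) (partialF (partialF Q) s P) s :=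
      ((hQ.diff_partial P s (mem_Ioi.1 hs).le).hasDerivWithinAt).hasDerivAt (Ici_mem_nhds hs)
    rw [h1.deriv]
    exact (hQ.convex s P hs).le
  refine MonotoneOn.convexOn_of_deriv (convex_Ici 0) hcont
    ((hQ.diff P).mono interior_subset) ?_
  rw [interior_Ici]
  intro a ha b hb hab
  rw [(hQ.hasDerivAt ha P).deriv, (hQ.hasDerivAt hb P).deriv]
  exact hmono ha hb hab

/-- Convexity in the form used for weak lower semicontinuity. At s₀ = 0 only a one-sided derivative
exists, but there the tangent vanishes and Q ≥ 0 suffices. -/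
lemma CasimirAssumptions.tangent_le (hQ : CasimirAssumptions Q k) {s s₀ : ℝ} (hs : 0 ≤ s)
    (hs₀ : 0 ≤ s₀) (P : ℝ) : Q s₀ P + partialF Q s₀ P * (s - s₀) ≤ Q s P := by
  rcases hs₀.eq_or_lt with h | h
  · rw [← h, hQ.zero, hQ.partial_zero]
    simpa using hQ.nonneg s P hs
  · have hd := hQ.hasDerivAt h P
    rcases lt_trichotomy s s₀ with h1 | h1 | h1
    · have := (hQ.convexOn P).slope_le_of_hasDerivAt hs hs₀ h1 hd
      rw [slope_def_field, div_le_iff₀ (by linarith)] at this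
      linarith
    · simp [h1]
    · have := (hQ.convexOn P).le_slope_of_hasDerivAt hs₀ hs h1 hd
      rw [slope_def_field, le_div_iff₀ (by linarith)] at this
      linarith

end Casimir

/-! ### The Coulomb form as an absolutely convergent double integral. -/

/-- The Coulomb interaction of two densities. -/
noncomputable def coulomb (ρ σ : Space → ℝ) : ℝ :=
  ∫ z : Space × Space, ρ z.1 * σ z.2 / ‖z.1 - z.2‖

section Coulomb

variable {ρ σ : Space → ℝ}

lemma aestronglyMeasurable_coulomb (hρ : AEMeasurable ρ) (hσ : AEMeasurable σ) :
    AEStronglyMeasurable (fun z : Space × Space => ρ z.1 * σ z.2 / ‖z.1 - z.2‖) := by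
  have h1 : AEMeasurable (fun z : Space × Space => ρ z.1) :=
    hρ.comp_quasiMeasurePreserving Measure.quasiMeasurePreserving_fst
  have h2 : AEMeasurable (fun z : Space × Space => σ z.2) :=
    hσ.comp_quasiMeasurePreserving Measure.quasiMeasurePreserving_snd
  exact AEMeasurable.aestronglyMeasurable (by fun_prop)

lemma enorm_coulomb (z : Space × Space) :
    ‖ρ z.1 * σ z.2 / ‖z.1 - z.2‖‖ₑ = coulombDensity ρ σ z := by
  rw [Real.enorm_eq_ofReal_abs, coulombDensity, abs_div, abs_mul, abs_norm]

lemma integrable_coulomb (hρ : AEMeasurable ρ) (hσ : AEMeasurable σ)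
    (h : ∫⁻ z, coulombDensity ρ σ z < ⊤) :
    Integrable (fun z : Space × Space => ρ z.1 * σ z.2 / ‖z.1 - z.2‖) := by
  refine ⟨aestronglyMeasurable_coulomb hρ hσ, ?_⟩
  simpa only [HasFiniteIntegral, enorm_coulomb] using h

lemma abs_coulomb_le {c : ℝ} (hc : 0 ≤ c) (h : ∫⁻ z, coulombDensity ρ σ z ≤ ENNReal.ofReal c) :
    |coulomb ρ σ| ≤ c := by
  have h1 := enorm_integral_le_lintegral_enorm (μ := volume)
    (fun z : Space × Space => ρ z.1 * σ z.2 / ‖z.1 - z.2‖)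
  simp only [enorm_coulomb] at h1
  have h2 := h1.trans h
  rwa [Real.enorm_eq_ofReal_abs, ENNReal.ofReal_le_ofReal_iff hc] at h2

lemma DensityBound.coulomb_lt_top {m A m' A' : ℝ} (hρ : DensityBound ρ m A)
    (hσ : DensityBound σ m' A') : ∫⁻ z, coulombDensity ρ σ z < ⊤ := by
  have h1 : DensityBound ρ (max |m| |m'|) (max (max A A') 0) :=
    ⟨hρ.integrable, hρ.mass.trans (ENNReal.ofReal_le_ofReal
      ((le_abs_self m).trans (le_max_left _ _))),
      hρ.power.trans (ENNReal.ofReal_le_ofReal ((le_max_left _ _).trans (le_max_left _ _)))⟩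
  have h2 : DensityBound σ (max |m| |m'|) (max (max A A') 0) :=
    ⟨hσ.integrable, hσ.mass.trans (ENNReal.ofReal_le_ofReal
      ((le_abs_self m').trans (le_max_right _ _))),
      hσ.power.trans (ENNReal.ofReal_le_ofReal ((le_max_right _ _).trans (le_max_left _ _)))⟩
  have h0 : 0 ≤ max |m| |m'| := (abs_nonneg m).trans (le_max_left _ _)
  exact (lintegral_coulomb_le h1 h2 h1.mass h2.mass (le_max_right _ _) h0 h0 one_pos
    one_pos).trans_lt ENNReal.ofReal_lt_top

lemma potentialEnergy_eq {f : Phase → ℝ}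
    (h : Integrable (fun z : Space × Space => density f z.1 * density f z.2 / ‖z.1 - z.2‖)) :
    potentialEnergy f = -(1 / 2) * coulomb (density f) (density f) := by
  rw [potentialEnergy, coulomb, Measure.volume_eq_prod, integral_prod _ h]

end Coulomb

end VlasovPoisson

/-! ### Coercivity and lower bound of the energy-Casimir functional. -/

namespace VlasovPoisson

variable {Q : ℝ → ℝ → ℝ} {k : ℝ}

/-- The sum of the Casimir functional and the kinetic energy. -/
noncomputable def freeEnergy (Q : ℝ → ℝ → ℝ) (f : Phase → ℝ) : ℝ≥0∞ :=
  casimir Q f + kineticEnergy f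

lemma two_mul_kineticEnergy {f : Phase → ℝ} (h0 : ∀ᵐ p, 0 ≤ f p) :
    velocityMoment f = 2 * kineticEnergy f := by
  rw [kineticEnergy, ← mul_assoc, one_div, ENNReal.mul_inv_cancel two_ne_zero ENNReal.ofNat_ne_top,
    one_mul, velocityMoment]
  refine lintegral_congr_ae (h0.mono fun p hp => ?_)
  simp only [abs_of_nonneg hp]

lemma lintegral_abs_eq {f : Phase → ℝ} (hf : Integrable f) (h0 : ∀ᵐ p, 0 ≤ f p) :
    ∫⁻ p, ENNReal.ofReal |f p| = ENNReal.ofReal (∫ p, f p) := by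
  rw [ofReal_integral_eq_lintegral_ofReal hf h0]
  exact lintegral_congr_ae (h0.mono fun p hp => by simp only [abs_of_nonneg hp])

lemma lintegral_le_of_pointwise (hQ : CasimirAssumptions Q k) {f : Phase → ℝ}
    (hf : Integrable f) (h0 : ∀ᵐ p, 0 ≤ f p) {Φ : ℝ → ℝ} {a b : ℝ} (ha : 0 ≤ a) (hb : 0 ≤ b)
    (h : ∀ s P, 0 ≤ s → Φ s ≤ a * s + b * Q s P) :
    ∫⁻ p, ENNReal.ofReal (Φ |f p|) ≤
      ENNReal.ofReal (a * ∫ p, f p) + ENNReal.ofReal b * casimir Q f := by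
  have hm := hf.aestronglyMeasurable.aemeasurable
  calc ∫⁻ p, ENNReal.ofReal (Φ |f p|)
      ≤ ∫⁻ p, (ENNReal.ofReal a * ENNReal.ofReal |f p| +
          ENNReal.ofReal b * ENNReal.ofReal (Q (f p) (angMom p))) := by
        refine lintegral_mono_ae (h0.mono fun p hp => ?_)
        rw [← ENNReal.ofReal_mul ha, ← ENNReal.ofReal_mul hb, abs_of_nonneg hp,
          ← ENNReal.ofReal_add (by positivity) (mul_nonneg hb (hQ.nonneg _ _ hp))]
        exact ENNReal.ofReal_le_ofReal (h _ _ hp)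
    _ = _ := by
        rw [lintegral_add_left' (by fun_prop), lintegral_const_mul' _ _ ENNReal.ofReal_ne_top,
          lintegral_const_mul' _ _ ENNReal.ofReal_ne_top, lintegral_abs_eq hf h0,
          ENNReal.ofReal_mul ha, casimir]

lemma DensityBound.of_admissible {f : Phase → ℝ} {m : ℝ} (hf : f ∈ admissible Q m) {M A : ℝ}
    (hmM : m ≤ M)
    (hA : ∫⁻ x, ENNReal.ofReal (|density f x| ^ (4 / 3 : ℝ)) ≤ ENNReal.ofReal A) :
    DensityBound (density f) M A := by
  refine ⟨integrable_density hf.1, ?_, hA⟩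
  refine (lintegral_abs_density_le hf.1).trans ?_
  rw [lintegral_abs_eq hf.1 hf.2.1, hf.2.2.1]
  exact ENNReal.ofReal_le_ofReal hmM

/-- The estimate of `∫ ρ^{4/3}` with an arbitrarily small share of the Casimir functional. -/
lemma exists_density_power_le (hQ : CasimirAssumptions Q k) {η : ℝ} (hη : 0 < η) :
    ∃ L : ℝ, 0 < L ∧ ∀ (f : Phase → ℝ) (m τ : ℝ), 0 < τ → f ∈ admissible Q m →
      ∫⁻ x, ENNReal.ofReal (|density f x| ^ (4 / 3 : ℝ)) ≤ ENNReal.ofReal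
        (2 * densityConst * (2 * τ * (kineticEnergy f).toReal +
          τ⁻¹ * (L * m + η * (casimir Q f).toReal))) := by
  obtain ⟨L, hL, h⟩ := hQ.five_thirds_le hη
  refine ⟨L, hL, fun f m τ hτ hf => ?_⟩
  obtain ⟨hfi, h0, hm, hT⟩ := hf
  have hm0 : 0 ≤ m := hm ▸ integral_nonneg_of_ae h0
  have hC : casimir Q f ≠ ⊤ := (ENNReal.add_lt_top.1 hT).1.ne
  have hK : kineticEnergy f ≠ ⊤ := (ENNReal.add_lt_top.1 hT).2.ne
  have h53 : fiveThirds f ≤ _ := lintegral_le_of_pointwise hQ hfi h0 hL.le hη.le h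
  refine (lintegral_density_rpow_le hfi hτ).trans ?_
  rw [two_mul_kineticEnergy h0]
  refine (mul_le_mul_right (add_le_add_right (mul_le_mul_right h53 _) _) _).trans (le_of_eq ?_)
  have hd := densityConst_pos
  rw [hm]
  nth_rewrite 1 [← ENNReal.ofReal_toReal hC]
  nth_rewrite 1 [← ENNReal.ofReal_toReal hK]
  rw [show (2 : ℝ≥0∞) = ENNReal.ofReal 2 by simp, ← ENNReal.ofReal_mul (by positivity),
    ← ENNReal.ofReal_mul (by positivity), ← ENNReal.ofReal_mul (by positivity),
    ← ENNReal.ofReal_add (by positivity) (by positivity), ← ENNReal.ofReal_mul (by positivity),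
    ← ENNReal.ofReal_add (by positivity) (by positivity), ← ENNReal.ofReal_mul (by positivity)]
  congr 1
  ring

lemma toReal_freeEnergy {f : Phase → ℝ} {m : ℝ} (hf : f ∈ admissible Q m) :
    (freeEnergy Q f).toReal = (casimir Q f).toReal + (kineticEnergy f).toReal :=
  ENNReal.toReal_add (ENNReal.add_lt_top.1 hf.2.2.2).1.ne (ENNReal.add_lt_top.1 hf.2.2.2).2.ne

lemma exists_densityBound_of_freeEnergy_le (hQ : CasimirAssumptions Q k) (M S : ℝ) :
    ∃ A : ℝ, 0 < A ∧ ∀ (f : Phase → ℝ) (m : ℝ), m ≤ M → f ∈ admissible Q m →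
      (freeEnergy Q f).toReal ≤ S → DensityBound (density f) M A := by
  obtain ⟨L, hL, h⟩ := exists_density_power_le hQ one_pos
  have hd := densityConst_pos
  refine ⟨2 * densityConst * (2 * |S| + (L * |M| + |S|)) + 1, by positivity,
    fun f m hm hf hS => DensityBound.of_admissible hf hm ((h f m 1 one_pos hf).trans ?_)⟩
  apply ENNReal.ofReal_le_ofReal
  rw [toReal_freeEnergy hf] at hS
  have h1 : 0 ≤ (casimir Q f).toReal := ENNReal.toReal_nonneg
  have h2 : 0 ≤ (kineticEnergy f).toReal := ENNReal.toReal_nonneg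
  have h3 := le_abs_self S
  have h4 : m ≤ |M| := hm.trans (le_abs_self M)
  have : 2 * 1 * (kineticEnergy f).toReal + 1⁻¹ * (L * m + 1 * (casimir Q f).toReal) ≤
      2 * |S| + (L * |M| + |S|) := by
    have : L * m ≤ L * |M| := by gcongr
    rw [inv_one]
    linarith
  nlinarith

lemma exists_densityBound (hQ : CasimirAssumptions Q k) {f : Phase → ℝ} {m : ℝ}
    (hf : f ∈ admissible Q m) : ∃ A : ℝ, 0 < A ∧ DensityBound (density f) m A := by
  obtain ⟨A, hA, h⟩ := exists_densityBound_of_freeEnergy_le hQ m (freeEnergy Q f).toReal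
  exact ⟨A, hA, h f m le_rfl hf le_rfl⟩

lemma energyCasimir_eq (hQ : CasimirAssumptions Q k) {f : Phase → ℝ} {m : ℝ}
    (hf : f ∈ admissible Q m) :
    energyCasimir Q f =
      (freeEnergy Q f).toReal - 1 / 2 * coulomb (density f) (density f) := by
  obtain ⟨A, hA, h⟩ := exists_densityBound hQ hf
  rw [energyCasimir, toReal_freeEnergy hf, potentialEnergy_eq
    (integrable_coulomb h.aemeasurable h.aemeasurable (h.coulomb_lt_top h))]
  ring

/-- The energy-Casimir functional is bounded from below and controls the free energy. -/
lemma exists_freeEnergy_le (hQ : CasimirAssumptions Q k) {M : ℝ} (hM : 0 < M) :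
    ∃ K : ℝ, ∀ (f : Phase → ℝ) (m : ℝ), m ≤ M → f ∈ admissible Q m →
      (freeEnergy Q f).toReal ≤ 2 * (energyCasimir Q f + K) := by
  have hd := densityConst_pos
  have hs := sphereArea_pos
  -- The constants are such that the bound for D/2 contains exactly half of the kinetic energy (2Bτ
  -- = 1/2) and half of the Casimir functional (Bτ⁻¹ · τ/(2B) = 1/2).
  set B : ℝ := (1 + 2 * sphereArea + M ^ 2) * densityConst with hB
  have hB0 : 0 < B := by positivity
  set τ : ℝ := (4 * B)⁻¹ with hτ
  have hτ0 : 0 < τ := by positivity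
  obtain ⟨L, hL, h⟩ := exists_density_power_le hQ (η := τ / (2 * B)) (by positivity)
  refine ⟨B * τ⁻¹ * (L * M), fun f m hm hf => ?_⟩
  have h1 : 0 ≤ (casimir Q f).toReal := ENNReal.toReal_nonneg
  have h2 : 0 ≤ (kineticEnergy f).toReal := ENNReal.toReal_nonneg
  set c := (casimir Q f).toReal with hc
  set e := (kineticEnergy f).toReal with he
  set A := 2 * densityConst * (2 * τ * e + τ⁻¹ * (L * M + τ / (2 * B) * c)) with hA
  have hA0 : 0 < A := by positivity
  have hb : DensityBound (density f) M A := by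
    refine DensityBound.of_admissible hf hm ((h f m τ hτ0 hf).trans ?_)
    apply ENNReal.ofReal_le_ofReal
    rw [hA]
    gcongr
  -- The choice t = r = 1/A makes all three terms of the Coulomb bound linear in A.
  have hD := abs_coulomb_le (by positivity) (lintegral_coulomb_le hb hb hb.mass hb.mass hA0.le
    hM.le hM.le (inv_pos.2 hA0) (inv_pos.2 hA0))
  have hD' : coulomb (density f) (density f) ≤ (1 + 2 * sphereArea + M ^ 2) * A := by
    refine (le_abs_self _).trans (hD.trans (le_of_eq ?_))
    field_simp
  have hA2 : 1 / 2 * ((1 + 2 * sphereArea + M ^ 2) * A) =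
      B * (2 * τ * e + τ⁻¹ * (L * M + τ / (2 * B) * c)) := by rw [hA, hB]; ring
  have hA3 : B * (2 * τ * e + τ⁻¹ * (L * M + τ / (2 * B) * c)) =
      1 / 2 * e + B * τ⁻¹ * (L * M) + 1 / 2 * c := by
    have : B * (2 * τ * e) = 1 / 2 * e := by rw [hτ]; field_simp; ring
    have : B * (τ⁻¹ * (τ / (2 * B) * c)) = 1 / 2 * c := by field_simp
    linarith
  rw [energyCasimir_eq hQ hf, toReal_freeEnergy hf]
  linarith

end VlasovPoisson

namespace VlasovPoisson

variable {Q : ℝ → ℝ → ℝ} {k : ℝ}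

/-! ### Rotations about the axis. -/

section Rotation

lemma norm_sq_space (x : Space) : ‖x‖ ^ 2 = x 0 ^ 2 + x 1 ^ 2 + x 2 ^ 2 := by
  rw [EuclideanSpace.norm_sq_eq, Fin.sum_univ_three]
  simp

lemma rot_zero_apply (θ : ℝ) (x : Space) : rot θ x 0 = Real.cos θ * x 0 - Real.sin θ * x 1 := rfl

lemma rot_one_apply (θ : ℝ) (x : Space) : rot θ x 1 = Real.sin θ * x 0 + Real.cos θ * x 1 := rfl

lemma rot_two_apply (θ : ℝ) (x : Space) : rot θ x 2 = x 2 := rfl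

lemma space_ext {x y : Space} (h0 : x 0 = y 0) (h1 : x 1 = y 1) (h2 : x 2 = y 2) : x = y := by
  ext i
  fin_cases i
  exacts [h0, h1, h2]

/-- The rotation about the `x₃`-axis as a linear isometry. -/
noncomputable def rotEquiv (θ : ℝ) : Space ≃ₗᵢ[ℝ] Space where
  toFun := rot θ
  invFun := rot (-θ)
  map_add' x y := by
    apply space_ext <;> simp [rot_zero_apply, rot_one_apply, rot_two_apply] <;> ring
  map_smul' c x := by
    apply space_ext <;> simp [rot_zero_apply, rot_one_apply, rot_two_apply] <;> ring
  left_inv x := by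
    have := Real.sin_sq_add_cos_sq θ
    apply space_ext <;> simp [rot_zero_apply, rot_one_apply, rot_two_apply]
    · linear_combination x 0 * this
    · linear_combination x 1 * this
  right_inv x := by
    have := Real.sin_sq_add_cos_sq θ
    apply space_ext <;> simp [rot_zero_apply, rot_one_apply, rot_two_apply]
    · linear_combination x 0 * this
    · linear_combination x 1 * this
  norm_map' x := by
    have := Real.sin_sq_add_cos_sq θ
    rw [← pow_left_inj₀ (norm_nonneg _) (norm_nonneg _) two_ne_zero, norm_sq_space, norm_sq_space]
    change rot θ x 0 ^ 2 + rot θ x 1 ^ 2 + rot θ x 2 ^ 2 = _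
    rw [rot_zero_apply, rot_one_apply, rot_two_apply]
    linear_combination (x 0 ^ 2 + x 1 ^ 2) * this

lemma norm_rot (θ : ℝ) (x : Space) : ‖rot θ x‖ = ‖x‖ := (rotEquiv θ).norm_map x

lemma rot_axisPoint (θ z : ℝ) : rot θ (axisPoint z) = axisPoint z := by
  apply space_ext <;> simp [rot_zero_apply, rot_one_apply, rot_two_apply, axisPoint]

lemma rot_sub (θ : ℝ) (x y : Space) : rot θ (x - y) = rot θ x - rot θ y := (rotEquiv θ).map_sub x y

lemma rot_smul (θ c : ℝ) (x : Space) : rot θ (c • x) = c • rot θ x := (rotEquiv θ).map_smul c x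

lemma rot_add (θ : ℝ) (x y : Space) : rot θ (x + y) = rot θ x + rot θ y := (rotEquiv θ).map_add x y

lemma rot_mem_closedBall (θ : ℝ) (a x : Space) (r : ℝ) :
    rot θ x ∈ Metric.closedBall (rot θ a) r ↔ x ∈ Metric.closedBall a r := by
  rw [mem_closedBall_iff_norm, mem_closedBall_iff_norm, ← rot_sub, norm_rot]

/-- The simultaneous rotation of positions and velocities. -/
noncomputable def rotPhase (θ : ℝ) (p : Phase) : Phase := (rot θ p.1, rot θ p.2)

lemma measurePreserving_rotPhase (θ : ℝ) : MeasurePreserving (rotPhase θ) volume volume :=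
  (rotEquiv θ).measurePreserving.prod (rotEquiv θ).measurePreserving

lemma measurableEmbedding_rotPhase (θ : ℝ) : MeasurableEmbedding (rotPhase θ) :=
  ((rotEquiv θ).toHomeomorph.prodCongr (rotEquiv θ).toHomeomorph).measurableEmbedding

end Rotation

/-! ### Dilation of positions and comparison of energies at different masses. -/

section Scaling

/-- The dilation of the position variable. -/
def dilate (a : ℝ) (p : Phase) : Phase := (a • p.1, p.2)

lemma measurableEmbedding_dilate {a : ℝ} (ha : a ≠ 0) : MeasurableEmbedding (dilate a) :=
  ((Homeomorph.smulOfNeZero a ha).prodCongr (Homeomorph.refl Space)).measurableEmbedding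

lemma map_dilate {a : ℝ} (ha : 0 < a) :
    Measure.map (dilate a) volume = ENNReal.ofReal (a ^ 3)⁻¹ • (volume : Measure Phase) := by
  have h := Measure.map_prod_map (volume : Measure Space) (volume : Measure Space)
    (f := fun x => a • x) (g := id) (by fun_prop) measurable_id
  rw [Measure.map_addHaar_smul _ ha.ne', Measure.map_id, Measure.prod_smul_left] at h
  rw [Measure.volume_eq_prod, show dilate a = Prod.map (fun x => a • x) id from rfl, ← h]
  simp [abs_of_pos ha]

lemma lintegral_dilate {a : ℝ} (ha : 0 < a) (F : Phase → ℝ≥0∞) :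
    ∫⁻ p, F (dilate a p) = ENNReal.ofReal (a ^ 3)⁻¹ * ∫⁻ p, F p := by
  rw [← (measurableEmbedding_dilate ha.ne').lintegral_map, map_dilate ha, lintegral_smul_measure,
    smul_eq_mul]

lemma integral_dilate {a : ℝ} (ha : 0 < a) (F : Phase → ℝ) :
    ∫ p, F (dilate a p) = (a ^ 3)⁻¹ * ∫ p, F p := by
  rw [← (measurableEmbedding_dilate ha.ne').integral_map, map_dilate ha, integral_smul_measure,
    smul_eq_mul, ENNReal.toReal_ofReal (by positivity)]

lemma ae_dilate {a : ℝ} (ha : 0 < a) {p : Phase → Prop} (h : ∀ᵐ z, p z) :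
    ∀ᵐ z, p (dilate a z) := by
  rw [← (measurableEmbedding_dilate ha.ne').ae_map_iff, map_dilate ha]
  exact Measure.ae_smul_measure h _

lemma integrable_dilate {a : ℝ} (ha : 0 < a) {f : Phase → ℝ} (h : Integrable f) :
    Integrable (fun p => f (dilate a p)) := by
  have : Integrable f (Measure.map (dilate a) volume) := by
    rw [map_dilate ha]
    exact h.smul_measure ENNReal.ofReal_ne_top
  exact ((measurableEmbedding_dilate ha.ne').integrable_map_iff).1 this

/-- The six-dimensional volume contributes a⁻⁶ and the homogeneity of the kernel contributes a. -/
lemma coulomb_dilate {a : ℝ} (ha : 0 < a) (ρ σ : Space → ℝ) :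
    coulomb (fun x => ρ (a • x)) (fun x => σ (a • x)) = (a ^ 5)⁻¹ * coulomb ρ σ := by
  have h := Measure.integral_comp_smul (volume : Measure Phase)
    (fun z : Space × Space => ρ z.1 * σ z.2 / ‖z.1 - z.2‖) a
  have h6 : Module.finrank ℝ Phase = 6 := by simp [Phase]
  rw [h6, abs_of_pos (by positivity), smul_eq_mul] at h
  have h2 : ∀ z : Space × Space, ρ (a • z.1) * σ (a • z.2) / ‖z.1 - z.2‖ =
      a * (ρ (a • z).1 * σ (a • z).2 / ‖(a • z).1 - (a • z).2‖) := by
    intro z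
    simp only [Prod.smul_fst, Prod.smul_snd]
    rw [← smul_sub, norm_smul, Real.norm_of_nonneg ha.le]
    field_simp
  unfold coulomb
  simp_rw [h2]
  rw [integral_const_mul]
  erw [h]
  field_simp

lemma energyCasimir_of_mass_zero (hQ : CasimirAssumptions Q k) {f : Phase → ℝ}
    (hf : f ∈ admissible Q 0) : 0 ≤ energyCasimir Q f := by
  obtain ⟨A, hA, h⟩ := exists_densityBound hQ hf
  have h0 : (fun x => ENNReal.ofReal |density f x|) =ᵐ[volume] 0 := by
    have := h.aemeasurable
    rw [← lintegral_eq_zero_iff' (by fun_prop)]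
    simpa using h.mass
  have h1 : ∀ᵐ z : Space × Space, density f z.1 * density f z.2 / ‖z.1 - z.2‖ = 0 := by
    have h3 := Measure.quasiMeasurePreserving_fst (μ := (volume : Measure Space))
      (ν := (volume : Measure Space)) |>.ae h0
    filter_upwards [h3] with z hz
    have : density f z.1 = 0 := by simpa using hz
    simp [this]
  rw [energyCasimir_eq hQ hf, coulomb, integral_eq_zero_of_ae h1]
  simp

/-- Compare g with f(x,v) = g(ax,v), where a³ = m/M ≤ 1, so that f has mass M. The angular momentum
at (x,v) is a⁻¹ times the one at (ax,v), hence T(f) ≤ a⁻³ T(g), while D scales by a⁻⁵. As T ≥ 0 and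
a ≤ 1, H(f) ≤ a⁻⁵ H(g). Mass zero admits no such dilation and is treated apart. -/
lemma scaling_le (hQ : CasimirAssumptions Q k) {M : ℝ} {h : ℝ} (hM : 0 < M)
    (hh : ∀ g ∈ admissibleS Q M, h ≤ energyCasimir Q g) {m : ℝ} (hm : m ≤ M) {g : Phase → ℝ}
    (hg : g ∈ admissibleS Q m) : (m / M) ^ (5 / 3 : ℝ) * h ≤ energyCasimir Q g := by
  obtain ⟨⟨hgi, hg0, hgm, hgT⟩, hgs⟩ := hg
  have hg' : g ∈ admissible Q m := ⟨hgi, hg0, hgm, hgT⟩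
  have hm0 : 0 ≤ m := hgm ▸ integral_nonneg_of_ae hg0
  rcases hm0.eq_or_lt with hm0 | hm0
  · subst hm0
    simpa [Real.zero_rpow] using energyCasimir_of_mass_zero hQ hg'
  set a : ℝ := (m / M) ^ (1 / 3 : ℝ) with ha
  have ha0 : 0 < a := by positivity
  have ha3 : a ^ 3 = m / M := by
    rw [ha, ← Real.rpow_natCast, ← Real.rpow_mul (by positivity)]; norm_num
  have ha5 : a ^ 5 = (m / M) ^ (5 / 3 : ℝ) := by
    rw [ha, ← Real.rpow_natCast, ← Real.rpow_mul (by positivity)]; norm_num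
  have ha1 : a ≤ 1 := Real.rpow_le_one (by positivity) ((div_le_one hM).2 hm) (by norm_num)
  set f : Phase → ℝ := fun p => g (dilate a p) with hf
  have hcas : casimir Q f ≤ ENNReal.ofReal (a ^ 3)⁻¹ * casimir Q g := by
    rw [casimir, casimir, ← lintegral_dilate ha0]
    refine lintegral_mono_ae ((ae_dilate ha0 hg0).mono fun p hp => ENNReal.ofReal_le_ofReal ?_)
    have : angMom p = a⁻¹ * angMom (dilate a p) := by
      simp only [angMom, dilate, PiLp.smul_apply, smul_eq_mul]
      field_simp
    rw [this]
    exact hQ.mul_le hp _ ((one_le_inv₀ ha0).2 ha1)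
  have hkin : kineticEnergy f = ENNReal.ofReal (a ^ 3)⁻¹ * kineticEnergy g := by
    rw [kineticEnergy, kineticEnergy, mul_left_comm, ← lintegral_dilate ha0]
    rfl
  have hTle : freeEnergy Q f ≤ ENNReal.ofReal (a ^ 3)⁻¹ * freeEnergy Q g := by
    rw [freeEnergy, freeEnergy, mul_add, hkin]
    gcongr
  have hfT : freeEnergy Q f < ⊤ := hTle.trans_lt (ENNReal.mul_lt_top ENNReal.ofReal_lt_top hgT)
  have hfa : f ∈ admissible Q M := by
    refine ⟨integrable_dilate ha0 hgi, ae_dilate ha0 hg0, ?_, hfT⟩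
    rw [integral_dilate ha0, hgm, ha3]
    field_simp
  have hfs : f ∈ admissibleS Q M := by
    refine ⟨hfa, fun θ => ?_⟩
    refine (ae_dilate ha0 (hgs θ)).mono fun p hp => ?_
    simp only [hf, dilate] at hp ⊢
    rw [← rot_smul, hp]
  have h1 := hh f hfs
  have hD : coulomb (density f) (density f) = (a ^ 5)⁻¹ * coulomb (density g) (density g) := by
    rw [← coulomb_dilate ha0]
    rfl
  have hT' : (freeEnergy Q f).toReal ≤ (a ^ 3)⁻¹ * (freeEnergy Q g).toReal := by
    have := ENNReal.toReal_mono (ENNReal.mul_lt_top ENNReal.ofReal_lt_top hgT).ne hTle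
    rwa [ENNReal.toReal_mul, ENNReal.toReal_ofReal (by positivity)] at this
  rw [energyCasimir_eq hQ hfa, hD] at h1
  rw [energyCasimir_eq hQ hg', ← ha5]
  have hT0 : 0 ≤ (freeEnergy Q g).toReal := ENNReal.toReal_nonneg
  have h35 : (a ^ 3)⁻¹ ≤ (a ^ 5)⁻¹ :=
    inv_anti₀ (by positivity) (pow_le_pow_of_le_one ha0.le ha1 (by norm_num))
  have h2 : h ≤ (a ^ 5)⁻¹ * ((freeEnergy Q g).toReal
      - 1 / 2 * coulomb (density g) (density g)) := by
    have := mul_le_mul_of_nonneg_right h35 hT0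
    linarith
  rwa [inv_mul_eq_div, le_div_iff₀ (by positivity), mul_comm] at h2

end Scaling

end VlasovPoisson

/-! ### Competitors with negative energy. -/

namespace VlasovPoisson

variable {Q : ℝ → ℝ → ℝ} {k : ℝ}

/-- The phase space density of a uniform ball with velocities uniformly distributed in a ball. -/
noncomputable def uniformBall (c R V : ℝ) : Phase → ℝ :=
  (Metric.closedBall 0 R ×ˢ Metric.closedBall 0 V).indicator fun _ => c

lemma measurableSet_ball_prod (R V : ℝ) :
    MeasurableSet (Metric.closedBall (0 : Space) R ×ˢ Metric.closedBall (0 : Space) V) :=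
  measurableSet_closedBall.prod measurableSet_closedBall

lemma volume_closedBall {R : ℝ} (hR : 0 ≤ R) :
    volume (Metric.closedBall (0 : Space) R) =
      ENNReal.ofReal (R ^ 3 * volume.real (Metric.ball (0 : Space) 1)) := by
  rw [Measure.addHaar_closedBall _ _ hR, ENNReal.ofReal_mul (by positivity)]
  simp [Measure.real]

lemma volume_ball_prod {R V : ℝ} (hR : 0 ≤ R) (hV : 0 ≤ V) :
    volume (Metric.closedBall (0 : Space) R ×ˢ Metric.closedBall (0 : Space) V) =
      ENNReal.ofReal ((R * V) ^ 3 * volume.real (Metric.ball (0 : Space) 1) ^ 2) := by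
  rw [Measure.volume_eq_prod, Measure.prod_prod, volume_closedBall hR, volume_closedBall hV,
    ← ENNReal.ofReal_mul (by positivity)]
  congr 1
  ring

lemma density_uniformBall {c R V : ℝ} (hV : 0 ≤ V) (x : Space) :
    density (uniformBall c R V) x = (Metric.closedBall (0 : Space) R).indicator
      (fun _ => V ^ 3 * volume.real (Metric.ball (0 : Space) 1) * c) x := by
  by_cases hx : x ∈ Metric.closedBall (0 : Space) R
  · have : (fun v => uniformBall c R V (x, v)) =
        (Metric.closedBall (0 : Space) V).indicator fun _ => c := by
      ext v
      by_cases hv : v ∈ Metric.closedBall (0 : Space) V <;>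
        simp only [uniformBall, indicator, mem_prod, hx, hv] <;> simp
    rw [density, this, indicator_of_mem hx, integral_indicator measurableSet_closedBall,
      setIntegral_const, Measure.real, volume_closedBall hV,
      ENNReal.toReal_ofReal (by positivity), smul_eq_mul]
  · have : (fun v => uniformBall c R V (x, v)) = 0 := by
      ext v
      exact indicator_of_notMem (fun h => hx h.1) _
    rw [density, this, indicator_of_notMem hx]
    simp

lemma ae_ne_diagonal : ∀ᵐ z : Space × Space, z.1 ≠ z.2 := by
  have hm : MeasurableSet {z : Space × Space | z.1 = z.2} :=
    measurableSet_eq_fun measurable_fst measurable_snd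
  have : volume {z : Space × Space | z.1 = z.2} = 0 := by
    rw [Measure.volume_eq_prod, Measure.measure_prod_null hm]
    refine ae_of_all _ fun x => ?_
    have : Prod.mk x ⁻¹' {z : Space × Space | z.1 = z.2} = {x} := by
      ext y; simp [eq_comm]
    simp [this]
  simpa [ae_iff] using this

lemma uniformBall_rot (c R V θ : ℝ) (p : Phase) :
    uniformBall c R V (rot θ p.1, rot θ p.2) = uniformBall c R V p := by
  simp only [uniformBall, indicator, mem_prod, mem_closedBall_zero_iff, norm_rot]

/-- A competitor with negative energy exists as soon as its parameters satisfy an inequality. -/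
lemma exists_energy_lt (hQ : CasimirAssumptions Q k) {M : ℝ} (hM : 0 < M) {C' F' p : ℝ}
    (hC' : 0 < C') (h : ∀ f, 0 ≤ f → f ≤ F' → Q f 0 ≤ C' * f ^ (1 + p))
    {R V c : ℝ} (hR : 0 < R) (hV : 0 < V)
    (hc : c = M / ((R * V) ^ 3 * volume.real (Metric.ball (0 : Space) 1) ^ 2)) (hcF : c ≤ F')
    (hneg : 1 / 2 * V ^ 2 + C' * c ^ p < M / (4 * R)) :
    ∃ f ∈ admissibleS Q M, energyCasimir Q f < 0 := by
  set w := volume.real (Metric.ball (0 : Space) 1) with hw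
  have hw0 : 0 < w := ENNReal.toReal_pos (Metric.measure_ball_pos _ _ one_pos).ne'
    measure_ball_lt_top.ne
  have hc0 : 0 < c := by rw [hc]; positivity
  set S := Metric.closedBall (0 : Space) R ×ˢ Metric.closedBall (0 : Space) V with hS
  have hSm : MeasurableSet S := measurableSet_ball_prod R V
  have hvol : volume S = ENNReal.ofReal ((R * V) ^ 3 * w ^ 2) := volume_ball_prod hR.le hV.le
  have hcM : c * ((R * V) ^ 3 * w ^ 2) = M := by rw [hc]; field_simp
  set f := uniformBall c R V with hf
  have hfi : Integrable f := (integrable_indicator_iff hSm).2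
    (integrableOn_const (by rw [hvol]; exact ENNReal.ofReal_ne_top))
  have hf0 : ∀ q, 0 ≤ f q := fun q => indicator_nonneg (fun _ _ => hc0.le) q
  have hfm : ∫ q, f q = M := by
    rw [hf, uniformBall, integral_indicator hSm, setIntegral_const, Measure.real, hvol,
      ENNReal.toReal_ofReal (by positivity), smul_eq_mul, mul_comm, hcM]
  have hcas : casimir Q f ≤ ENNReal.ofReal (C' * c ^ p * M) := by
    have : ∀ q, ENNReal.ofReal (Q (f q) (angMom q)) ≤
        S.indicator (fun _ => ENNReal.ofReal (C' * c ^ (1 + p))) q := by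
      intro q
      by_cases hq : q ∈ S
      · have : f q = c := indicator_of_mem hq _
        rw [indicator_of_mem hq, this]
        exact ENNReal.ofReal_le_ofReal ((hQ.le_zero hc0.le _).trans (h c hc0.le hcF))
      · have : f q = 0 := indicator_of_notMem hq _
        rw [indicator_of_notMem hq, this, hQ.zero]
        simp
    refine (lintegral_mono this).trans (le_of_eq ?_)
    rw [lintegral_indicator_const hSm, hvol, ← ENNReal.ofReal_mul (by positivity),
      Real.rpow_add hc0, Real.rpow_one, ← hcM]
    congr 1
    ring
  have hkin : kineticEnergy f ≤ ENNReal.ofReal (1 / 2 * V ^ 2 * M) := by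
    have : ∀ q : Phase, ENNReal.ofReal (‖q.2‖ ^ 2 * f q) ≤
        S.indicator (fun _ => ENNReal.ofReal (V ^ 2 * c)) q := by
      intro q
      by_cases hq : q ∈ S
      · have h1 : f q = c := indicator_of_mem hq _
        have h2 : ‖q.2‖ ≤ V := mem_closedBall_zero_iff.1 hq.2
        rw [indicator_of_mem hq, h1]
        exact ENNReal.ofReal_le_ofReal (by gcongr)
      · have : f q = 0 := indicator_of_notMem hq _
        rw [indicator_of_notMem hq, this]
        simp
    rw [kineticEnergy]
    refine (mul_le_mul_right (lintegral_mono this) _).trans (le_of_eq ?_)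
    rw [lintegral_indicator_const hSm, hvol, ← ENNReal.ofReal_mul (by positivity),
      show (1 / 2 : ℝ≥0∞) = ENNReal.ofReal (1 / 2) by
        rw [ENNReal.ofReal_div_of_pos two_pos]; simp, ← ENNReal.ofReal_mul (by positivity), ← hcM]
    congr 1
    ring
  have hT : freeEnergy Q f ≤ ENNReal.ofReal (C' * c ^ p * M + 1 / 2 * V ^ 2 * M) := by
    rw [ENNReal.ofReal_add (by positivity) (by positivity)]
    exact add_le_add hcas hkin
  have hfa : f ∈ admissible Q M :=
    ⟨hfi, ae_of_all _ hf0, hfm, hT.trans_lt ENNReal.ofReal_lt_top⟩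
  refine ⟨f, ⟨hfa, fun θ => ae_of_all _ fun q => uniformBall_rot c R V θ q⟩, ?_⟩
  have hT' : (freeEnergy Q f).toReal ≤ C' * c ^ p * M + 1 / 2 * V ^ 2 * M :=
    ENNReal.toReal_le_of_le_ofReal (by positivity) hT
  -- Points of the ball are at distance at most 2R from each other.
  have hD : M ^ 2 / (2 * R) ≤ coulomb (density f) (density f) := by
    obtain ⟨A, hA, hb⟩ := exists_densityBound hQ hfa
    have hi := integrable_density hfi
    have hprod : ∫ z : Space × Space, density f z.1 * density f z.2 / (2 * R) = M ^ 2 / (2 * R) := by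
      rw [integral_div, Measure.volume_eq_prod, integral_prod_mul]
      have : ∫ x, density f x = M := by
        rw [← hfm, Measure.volume_eq_prod, integral_prod _ hfi]
        rfl
      rw [this, sq]
    rw [← hprod]
    refine integral_mono_ae ((hi.mul_prod hi).div_const _)
      (integrable_coulomb hb.aemeasurable hb.aemeasurable (hb.coulomb_lt_top hb)) ?_
    filter_upwards [ae_ne_diagonal] with z hz
    have hz' : 0 < ‖z.1 - z.2‖ := norm_pos_iff.2 (sub_ne_zero.2 hz)
    simp only [hf, density_uniformBall hV.le]
    by_cases h1 : z.1 ∈ Metric.closedBall (0 : Space) R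
    · by_cases h2 : z.2 ∈ Metric.closedBall (0 : Space) R
      · rw [indicator_of_mem h1, indicator_of_mem h2]
        have : ‖z.1 - z.2‖ ≤ 2 * R := by
          have := norm_sub_le z.1 z.2
          rw [mem_closedBall_zero_iff] at h1 h2
          linarith
        gcongr
      · simp [indicator_of_notMem h2]
    · simp [indicator_of_notMem h1]
  rw [energyCasimir_eq hQ hfa]
  have : M ^ 2 / (2 * R) = 2 * M * (M / (4 * R)) := by field_simp; ring
  nlinarith

/-- The energy-Casimir functional attains negative values. -/
lemma exists_energy_neg (hQ : CasimirAssumptions Q k) {M : ℝ} (hM : 0 < M) :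
    ∃ f ∈ admissibleS Q M, energyCasimir Q f < 0 := by
  obtain ⟨C', F', k', hC', hF', hk', hk1, h⟩ := hQ.small
  set w := volume.real (Metric.ball (0 : Space) 1) with hw
  have hw0 : 0 < w := ENNReal.toReal_pos (Metric.measure_ball_pos _ _ one_pos).ne'
    measure_ball_lt_top.ne
  -- With V = R^(-s), the phase space density is of order R^(-3(1-s)). As R tends to infinity,
  -- kinetic energy and Casimir functional must decay faster than the potential energy, which is of
  -- order 1/R; this requires 2s > 1 and 3(1-s) > k'. The value chosen is the midpoint of 1/2 and 1
  -- - k'/3, an interval that is nonempty because k' < 3/2.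
  set s : ℝ := 3 / 4 - k' / 6 with hs
  have hs1 : 0 < 2 * s - 1 := by rw [hs]; linarith
  have hs2 : 0 < 3 * (1 - s) / k' - 1 := by
    rw [sub_pos, lt_div_iff₀ hk', hs]; linarith
  have hs3 : 0 < 3 * (1 - s) := by rw [hs]; linarith
  set D := M / w ^ 2 with hD
  have hD0 : 0 < D := by positivity
  have t1 : Tendsto (fun R : ℝ => 1 / 2 * R ^ (-(2 * s - 1)) +
      C' * D ^ (1 / k') * R ^ (-(3 * (1 - s) / k' - 1))) atTop
        (𝓝 (1 / 2 * 0 + C' * D ^ (1 / k') * 0)) :=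
    ((tendsto_rpow_neg_atTop hs1).const_mul _).add ((tendsto_rpow_neg_atTop hs2).const_mul _)
  have t2 : Tendsto (fun R : ℝ => D * R ^ (-(3 * (1 - s)))) atTop (𝓝 (D * 0)) :=
    (tendsto_rpow_neg_atTop hs3).const_mul _
  simp only [mul_zero, add_zero] at t1 t2
  obtain ⟨R, hR1, hR2, hR0⟩ := ((t1.eventually_lt_const (by positivity : 0 < M / 4)).and
    ((t2.eventually_lt_const hF').and (eventually_gt_atTop 0))).exists
  have hc : D * R ^ (-(3 * (1 - s))) = M / ((R * R ^ (-s)) ^ 3 * w ^ 2) := by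
    have h1 : R * R ^ (-s) = R ^ (1 - s) := by
      rw [show 1 - s = 1 + -s by ring, Real.rpow_add hR0, Real.rpow_one]
    have h2 : (R ^ (1 - s)) ^ 3 = R ^ (3 * (1 - s)) := by
      rw [← Real.rpow_natCast, ← Real.rpow_mul hR0.le]; ring_nf
    rw [h1, h2, Real.rpow_neg hR0.le, hD]
    have : 0 < R ^ (3 * (1 - s)) := by positivity
    field_simp
  refine exists_energy_lt hQ hM hC' h hR0
    (by positivity : 0 < R ^ (-s)) hc hR2.le ?_
  have h3 : (R ^ (-s)) ^ 2 = R ^ (-(2 * s - 1)) / R := by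
    rw [eq_div_iff hR0.ne', ← Real.rpow_natCast, ← Real.rpow_mul hR0.le]
    nth_rewrite 2 [← Real.rpow_one R]
    rw [← Real.rpow_add hR0]
    congr 1; push_cast; ring
  have h4 : (D * R ^ (-(3 * (1 - s)))) ^ (1 / k') =
      D ^ (1 / k') * R ^ (-(3 * (1 - s) / k' - 1)) / R := by
    rw [Real.mul_rpow hD0.le (by positivity), ← Real.rpow_mul hR0.le, mul_div_assoc]
    congr 1
    rw [eq_div_iff hR0.ne']
    nth_rewrite 2 [← Real.rpow_one R]
    rw [← Real.rpow_add hR0]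
    congr 1; field_simp; ring
  rw [h3, h4, ← div_div, lt_div_iff₀ hR0]
  refine lt_of_eq_of_lt ?_ hR1
  field_simp

end VlasovPoisson

namespace VlasovPoisson

variable {Q : ℝ → ℝ → ℝ} {k : ℝ}

/-! ### Cutting a density into two pieces in position space. -/

section Restriction

/-- The restriction of a phase space density to positions in `B`. -/
noncomputable def restrictTo (B : Set Space) (f : Phase → ℝ) : Phase → ℝ :=
  (B ×ˢ (univ : Set Space)).indicator f

lemma restrictTo_of_mem {B : Set Space} (f : Phase → ℝ) {p : Phase} (h : p.1 ∈ B) :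
    restrictTo B f p = f p := indicator_of_mem (mk_mem_prod h (mem_univ _)) f

lemma restrictTo_of_notMem {B : Set Space} (f : Phase → ℝ) {p : Phase} (h : p.1 ∉ B) :
    restrictTo B f p = 0 := indicator_of_notMem (fun h' => h h'.1) f

lemma density_restrictTo (B : Set Space) (f : Phase → ℝ) :
    density (restrictTo B f) = B.indicator (density f) := by
  ext x
  by_cases hx : x ∈ B
  · rw [indicator_of_mem hx, density, density]
    congr 1 with v
    exact restrictTo_of_mem f hx
  · rw [indicator_of_notMem hx, density]
    exact integral_eq_zero_of_ae (ae_of_all _ fun v => restrictTo_of_notMem f hx)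

/-- Both integrands vanish where f does; for the Casimir part this is Q(0, P) = 0. -/
lemma freeEnergy_restrictTo_add (hQ : CasimirAssumptions Q k) {B : Set Space}
    (hB : MeasurableSet B) {f : Phase → ℝ} :
    freeEnergy Q (restrictTo B f) + freeEnergy Q (restrictTo Bᶜ f) = freeEnergy Q f := by
  have hm : MeasurableSet (B ×ˢ (univ : Set Space)) := hB.prod MeasurableSet.univ
  have key : ∀ (Φ : ℝ → Phase → ℝ≥0∞), (∀ p, Φ 0 p = 0) →
      (∫⁻ p, Φ (restrictTo B f p) p) + ∫⁻ p, Φ (restrictTo Bᶜ f p) p = ∫⁻ p, Φ (f p) p := by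
    intro Φ hΦ
    rw [← lintegral_add_compl (fun p => Φ (f p) p) hm, ← lintegral_indicator hm,
      ← lintegral_indicator hm.compl]
    congr 1
    · congr 1 with p
      by_cases hp : p.1 ∈ B
      · rw [restrictTo_of_mem f hp, indicator_of_mem (mk_mem_prod hp (mem_univ _))]
      · rw [restrictTo_of_notMem f hp, indicator_of_notMem (fun h => hp h.1), hΦ]
    · congr 1 with p
      by_cases hp : p.1 ∈ B
      · rw [restrictTo_of_notMem (B := Bᶜ) f (fun h => h hp), hΦ,
          indicator_of_notMem (s := (B ×ˢ (univ : Set Space))ᶜ)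
            (fun h => h (mk_mem_prod hp (mem_univ _)))]
      · rw [restrictTo_of_mem (B := Bᶜ) f hp,
          indicator_of_mem (s := (B ×ˢ (univ : Set Space))ᶜ) (fun h => hp h.1)]
  have h1 := key (fun s p => ENNReal.ofReal (Q s (angMom p))) (fun p => by simp [hQ.zero])
  have h2 := key (fun s p => ENNReal.ofReal (‖p.2‖ ^ 2 * s)) (fun p => by simp)
  simp only [freeEnergy, casimir, kineticEnergy]
  rw [← h1, ← h2]
  ring

lemma restrictTo_mem_admissible (hQ : CasimirAssumptions Q k) {B : Set Space}
    (hB : MeasurableSet B) {f : Phase → ℝ} {M : ℝ} (hf : f ∈ admissible Q M) :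
    restrictTo B f ∈ admissible Q (∫ p in B ×ˢ (univ : Set Space), f p) := by
  have hm : MeasurableSet (B ×ˢ (univ : Set Space)) := hB.prod MeasurableSet.univ
  refine ⟨hf.1.indicator hm, hf.2.1.mono fun p hp => indicator_nonneg' hp,
    integral_indicator hm, ?_⟩
  have := freeEnergy_restrictTo_add hQ hB (f := f)
  exact (le_self_add.trans this.le).trans_lt hf.2.2.2
where
  indicator_nonneg' {s : Set Phase} {f : Phase → ℝ} {p : Phase} (h : 0 ≤ f p) :
      0 ≤ s.indicator f p := by
    by_cases hp : p ∈ s <;> simp [hp, h]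

lemma restrictTo_mem_admissibleS (hQ : CasimirAssumptions Q k) {B : Set Space}
    (hB : MeasurableSet B) (hrot : ∀ θ x, rot θ x ∈ B ↔ x ∈ B) {f : Phase → ℝ} {M : ℝ}
    (hf : f ∈ admissibleS Q M) :
    restrictTo B f ∈ admissibleS Q (∫ p in B ×ˢ (univ : Set Space), f p) := by
  refine ⟨restrictTo_mem_admissible hQ hB hf.1, fun θ => (hf.2 θ).mono fun p hp => ?_⟩
  by_cases h : p.1 ∈ B
  · rw [restrictTo_of_mem f h, restrictTo_of_mem f ((hrot θ p.1).2 h), hp]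
  · rw [restrictTo_of_notMem f h, restrictTo_of_notMem f (fun h' => h ((hrot θ p.1).1 h'))]

lemma DensityBound.indicator {ρ : Space → ℝ} {m A : ℝ} (h : DensityBound ρ m A) {B : Set Space}
    (hB : MeasurableSet B) : DensityBound (B.indicator ρ) m A := by
  refine ⟨h.integrable.indicator hB, (lintegral_mono fun x => ?_).trans h.mass,
    (lintegral_mono fun x => ?_).trans h.power⟩
  · by_cases hx : x ∈ B <;> simp [hx]
  · by_cases hx : x ∈ B
    · simp [hx]
    · simp only [indicator_of_notMem hx, abs_zero]
      rw [Real.zero_rpow (by norm_num)]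
      simp

lemma coulomb_comm (ρ σ : Space → ℝ) : coulomb ρ σ = coulomb σ ρ := by
  unfold coulomb
  rw [Measure.volume_eq_prod, ← integral_prod_swap]
  congr 1 with z
  rw [Prod.fst_swap, Prod.snd_swap, norm_sub_rev, mul_comm (ρ z.2)]

lemma coulomb_add_left {ρ₁ ρ₂ σ : Space → ℝ}
    (h₁ : Integrable (fun z : Space × Space => ρ₁ z.1 * σ z.2 / ‖z.1 - z.2‖))
    (h₂ : Integrable (fun z : Space × Space => ρ₂ z.1 * σ z.2 / ‖z.1 - z.2‖)) :
    coulomb (ρ₁ + ρ₂) σ = coulomb ρ₁ σ + coulomb ρ₂ σ := by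
  unfold coulomb
  rw [← integral_add h₁ h₂]
  congr 1 with z
  simp only [Pi.add_apply]
  ring

lemma DensityBound.integrable_coulomb {ρ σ : Space → ℝ} {m A m' A' : ℝ} (hρ : DensityBound ρ m A)
    (hσ : DensityBound σ m' A') :
    Integrable (fun z : Space × Space => ρ z.1 * σ z.2 / ‖z.1 - z.2‖) :=
  VlasovPoisson.integrable_coulomb hρ.aemeasurable hσ.aemeasurable (hρ.coulomb_lt_top hσ)

lemma DensityBound.add {ρ₁ ρ₂ : Space → ℝ} {m m' A A' : ℝ} (h₁ : DensityBound ρ₁ m A)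
    (h₂ : DensityBound ρ₂ m' A') :
    DensityBound (ρ₁ + ρ₂) (|m| + |m'|) (2 ^ (4 / 3 : ℝ) * (|A| + |A'|)) := by
  refine ⟨h₁.integrable.add h₂.integrable, ?_, ?_⟩
  · rw [ENNReal.ofReal_add (abs_nonneg _) (abs_nonneg _)]
    refine le_trans ?_ (add_le_add (h₁.mass.trans (ENNReal.ofReal_le_ofReal (le_abs_self _)))
      (h₂.mass.trans (ENNReal.ofReal_le_ofReal (le_abs_self _))))
    have := h₁.aemeasurable
    rw [← lintegral_add_left' (by fun_prop)]
    refine lintegral_mono fun x => ?_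
    rw [← ENNReal.ofReal_add (abs_nonneg _) (abs_nonneg _)]
    exact ENNReal.ofReal_le_ofReal (abs_add_le _ _)
  · rw [ENNReal.ofReal_mul (by positivity), ENNReal.ofReal_add (abs_nonneg _) (abs_nonneg _)]
    refine le_trans ?_ (mul_le_mul_right (add_le_add
      (h₁.power.trans (ENNReal.ofReal_le_ofReal (le_abs_self _)))
      (h₂.power.trans (ENNReal.ofReal_le_ofReal (le_abs_self _)))) _)
    have := h₁.aemeasurable
    rw [← lintegral_add_left' (by fun_prop), ← lintegral_const_mul' _ _ ENNReal.ofReal_ne_top]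
    refine lintegral_mono fun x => ?_
    rw [← ENNReal.ofReal_add (by positivity) (by positivity), ← ENNReal.ofReal_mul (by positivity)]
    apply ENNReal.ofReal_le_ofReal
    have h3 : |(ρ₁ + ρ₂) x| ≤ 2 * max |ρ₁ x| |ρ₂ x| := by
      refine (abs_add_le _ _).trans ?_
      linarith [le_max_left |ρ₁ x| |ρ₂ x|, le_max_right |ρ₁ x| |ρ₂ x|]
    calc |(ρ₁ + ρ₂) x| ^ (4 / 3 : ℝ) ≤ (2 * max |ρ₁ x| |ρ₂ x|) ^ (4 / 3 : ℝ) := by gcongr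
      _ = 2 ^ (4 / 3 : ℝ) * (max |ρ₁ x| |ρ₂ x|) ^ (4 / 3 : ℝ) :=
        Real.mul_rpow (by norm_num) (by positivity)
      _ ≤ _ := by
        gcongr
        rcases max_cases |ρ₁ x| |ρ₂ x| with ⟨h, _⟩ | ⟨h, _⟩ <;> rw [h]
        · exact le_add_of_nonneg_right (by positivity)
        · exact le_add_of_nonneg_left (by positivity)

/-- T is additive over the two pieces, and expanding the symmetric form D leaves the mixed term
twice, which the factor 1/2 compensates. -/
lemma energyCasimir_split (hQ : CasimirAssumptions Q k) {B : Set Space}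
    (hB : MeasurableSet B) {f : Phase → ℝ} {M : ℝ} (hf : f ∈ admissible Q M) :
    energyCasimir Q f = energyCasimir Q (restrictTo B f) + energyCasimir Q (restrictTo Bᶜ f) -
      coulomb (B.indicator (density f)) (Bᶜ.indicator (density f)) := by
  obtain ⟨A, hA, hb⟩ := exists_densityBound hQ hf
  have h1 := restrictTo_mem_admissible hQ hB hf
  have h2 := restrictTo_mem_admissible hQ hB.compl hf
  rw [energyCasimir_eq hQ hf, energyCasimir_eq hQ h1, energyCasimir_eq hQ h2,
    density_restrictTo, density_restrictTo, ← freeEnergy_restrictTo_add hQ hB (f := f),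
    ENNReal.toReal_add (a := freeEnergy Q _) (b := freeEnergy Q _) h1.2.2.2.ne h2.2.2.2.ne]
  set ρ₁ := B.indicator (density f)
  set ρ₂ := Bᶜ.indicator (density f)
  have hρ₁ : DensityBound ρ₁ M A := hb.indicator hB
  have hρ₂ : DensityBound ρ₂ M A := hb.indicator hB.compl
  have hsum : density f = ρ₁ + ρ₂ := (indicator_self_add_compl B _).symm
  rw [hsum, coulomb_add_left (hρ₁.integrable_coulomb (hρ₁.add hρ₂))
    (hρ₂.integrable_coulomb (hρ₁.add hρ₂)), coulomb_comm ρ₁ (ρ₁ + ρ₂), coulomb_comm ρ₂ (ρ₁ + ρ₂),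
    coulomb_add_left (hρ₁.integrable_coulomb hρ₁) (hρ₂.integrable_coulomb hρ₁),
    coulomb_add_left (hρ₁.integrable_coulomb hρ₂) (hρ₂.integrable_coulomb hρ₂),
    coulomb_comm ρ₂ ρ₁]
  ring

end Restriction

/-! ### Cutting along a shell of small mass. -/

section Shells

lemma lintegral_separated_le {ρ σ : Space → ℝ} (hρ : AEMeasurable ρ) (hσ : AEMeasurable σ)
    {r : ℝ} (hr : 0 < r) (h : ∀ x y, ρ x ≠ 0 → σ y ≠ 0 → r ≤ ‖x - y‖) :
    ∫⁻ z, coulombDensity ρ σ z ≤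
      ENNReal.ofReal r⁻¹ * ((∫⁻ x, ENNReal.ofReal |ρ x|) * ∫⁻ y, ENNReal.ofReal |σ y|) := by
  rw [← lintegral_abs_mul_abs hρ hσ, ← lintegral_const_mul' _ _ ENNReal.ofReal_ne_top]
  refine lintegral_mono fun z => ?_
  rw [← ENNReal.ofReal_mul (by positivity)]
  apply ENNReal.ofReal_le_ofReal
  by_cases h1 : ρ z.1 = 0
  · simp [h1]
  by_cases h2 : σ z.2 = 0
  · simp [h2]
  rw [div_eq_inv_mul]
  gcongr
  exact h _ _ h1 h2

lemma lintegral_indicator_abs (ρ : Space → ℝ) {B : Set Space} (hB : MeasurableSet B) :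
    ∫⁻ x, ENNReal.ofReal |B.indicator ρ x| = ∫⁻ x in B, ENNReal.ofReal |ρ x| := by
  rw [← lintegral_indicator hB]
  congr 1 with x
  by_cases hx : x ∈ B <;> simp [hx]

/-- One of `N` disjoint shells carries at most the `N`-th part of the mass. -/
lemma exists_light_shell {ρ : Space → ℝ} {M : ℝ} (hM : 0 < M)
    (hρ : ∫⁻ x, ENNReal.ofReal |ρ x| ≤ ENNReal.ofReal M) (a : Space) (R : ℝ) {N : ℕ} (hN : 0 < N) :
    ∃ j : ℕ, 1 ≤ j ∧ j ≤ N ∧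
      ∫⁻ x in Metric.closedBall a ((j + 1) * R) \ Metric.closedBall a (j * R), ENNReal.ofReal |ρ x| ≤
        ENNReal.ofReal (M / N) := by
  have hm : ∀ j : ℕ, MeasurableSet (Metric.closedBall a ((j + 1) * R) \ Metric.closedBall a (j * R)) := fun j =>
    measurableSet_closedBall.diff measurableSet_closedBall
  rcases le_total R 0 with hR | hR
  · refine ⟨1, le_rfl, hN, ?_⟩
    have : Metric.closedBall a (((1 : ℕ) + 1) * R) \ Metric.closedBall a ((1 : ℕ) * R) = ∅ := by
      rw [sdiff_eq_empty]
      apply Metric.closedBall_subset_closedBall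
      push_cast
      linarith
    rw [this]
    simp
  have hd : ∀ i j : ℕ, i < j → Disjoint (Metric.closedBall a ((i + 1) * R) \ Metric.closedBall a (i * R))
      (Metric.closedBall a ((j + 1) * R) \ Metric.closedBall a (j * R)) := by
    intro i j hij
    refine Set.disjoint_left.2 fun x hx hx' => ?_
    have h1 : ((i : ℝ) + 1) * R ≤ j * R := by
      gcongr
      exact_mod_cast hij
    exact hx'.2 (Metric.closedBall_subset_closedBall h1 hx.1)
  have hsum : ∑ j ∈ Finset.Icc 1 N, ∫⁻ x in
      Metric.closedBall a ((j + 1) * R) \ Metric.closedBall a (j * R), ENNReal.ofReal |ρ x| ≤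
        ∑ _j ∈ Finset.Icc 1 N, ENNReal.ofReal (M / N) := by
    rw [← lintegral_biUnion_finset _ (fun j _ => hm j)]
    · refine ((setLIntegral_le_lintegral _ _).trans hρ).trans (le_of_eq ?_)
      have : (0 : ℝ) < N := by exact_mod_cast hN
      rw [Finset.sum_const, Nat.card_Icc, Nat.add_sub_cancel, nsmul_eq_mul,
        ← ENNReal.ofReal_natCast, ← ENNReal.ofReal_mul (by positivity)]
      congr 1
      field_simp
    · intro i _ j _ hij
      rcases lt_or_gt_of_ne hij with h | h
      · exact hd i j h
      · exact (hd j i h).symm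
  by_contra! hcon
  refine (ENNReal.sum_lt_sum_of_nonempty (Finset.nonempty_Icc.2 hN) fun j hj => ?_).not_ge hsum
  rw [Finset.mem_Icc] at hj
  exact hcon j hj.1 hj.2

/-- The interaction between the inside and the outside of a suitable ball is small. -/
lemma exists_small_interaction {M A η R₁ : ℝ} (hM : 0 < M) (hA : 0 < A) (hη : 0 < η) :
    ∃ R₂ : ℝ, ∀ ρ : Space → ℝ, DensityBound ρ M A → ∀ a : Space, ∃ s : ℝ, R₁ ≤ s ∧ s ≤ R₂ ∧
      coulomb ((Metric.closedBall a s).indicator ρ) ((Metric.closedBall a s)ᶜ.indicator ρ) ≤ η := by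
  have hκ := sphereArea_pos
  have ht : Tendsto (fun t : ℝ => t * A ^ 2 + 2 * sphereArea * A * t) (𝓝[>] 0) (𝓝 0) := by
    have : Continuous (fun t : ℝ => t * A ^ 2 + 2 * sphereArea * A * t) := by fun_prop
    simpa using (this.tendsto 0).mono_left nhdsWithin_le_nhds
  -- The ball is separated from the far exterior by a shell of width R. First t, with r = t², makes
  -- the short range part of the shell interaction less than η/3; then N makes its long range part
  -- M²/(N t²) at most η/3, as the shell has mass at most M/N; finally R makes the exterior
  -- contribution M²/R at most η/3. The cut radius stays below NR, whatever the density and the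
  -- centre.
  obtain ⟨t, ht1, ht0⟩ := ((ht.eventually_lt_const (by positivity : 0 < η / 3)).and
    self_mem_nhdsWithin).exists
  replace ht0 : 0 < t := ht0
  obtain ⟨N, hN⟩ := exists_nat_gt (M ^ 2 / t ^ 2 / (η / 3))
  have hN0 : (0 : ℝ) < N := lt_of_le_of_lt (by positivity) hN
  set R := max (max R₁ 1) (M ^ 2 / (η / 3)) with hR
  have hR0 : 0 < R := lt_max_of_lt_left (lt_max_of_lt_right one_pos)
  refine ⟨N * R, fun ρ hρ a => ?_⟩
  obtain ⟨j, hj1, hjN, hj⟩ := exists_light_shell hM hρ.mass a R (Nat.cast_pos.1 hN0)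
  have hj1' : (1 : ℝ) ≤ j := by exact_mod_cast hj1
  refine ⟨j * R, ?_, by gcongr, ?_⟩
  · have : R₁ ≤ R := (le_max_left _ _).trans (le_max_left _ _)
    nlinarith
  set B := Metric.closedBall a (j * R) with hB
  set Sh := Metric.closedBall a ((j + 1) * R) \ Metric.closedBall a (j * R) with hSh
  set O := (Metric.closedBall a ((j + 1) * R))ᶜ with hO
  have hBm : MeasurableSet B := measurableSet_closedBall
  have hShm : MeasurableSet Sh := measurableSet_closedBall.diff measurableSet_closedBall
  have hOm : MeasurableSet O := measurableSet_closedBall.compl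
  have hb := hρ.indicator hBm
  have hs := hρ.indicator hShm
  have ho := hρ.indicator hOm
  have hdec : Bᶜ.indicator ρ = Sh.indicator ρ + O.indicator ρ := by
    ext x
    simp only [Pi.add_apply]
    by_cases h1 : x ∈ B
    · rw [indicator_of_notMem (s := Bᶜ) (fun h => h h1), indicator_of_notMem (s := Sh) fun h => h.2 h1,
        indicator_of_notMem (s := O)
          (fun h => h (Metric.closedBall_subset_closedBall (by nlinarith) h1)), add_zero]
    · rw [indicator_of_mem (s := Bᶜ) h1]
      by_cases h2 : x ∈ Metric.closedBall a ((j + 1) * R)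
      · rw [indicator_of_mem (s := Sh) ⟨h2, h1⟩, indicator_of_notMem (s := O) (fun h => h h2),
          add_zero]
      · rw [indicator_of_notMem (s := Sh) (fun h => h2 h.1), indicator_of_mem (s := O) h2, zero_add]
  rw [hdec, coulomb_comm, coulomb_add_left (hs.integrable_coulomb hb) (ho.integrable_coulomb hb)]
  have hshell : coulomb (Sh.indicator ρ) (B.indicator ρ) ≤ η / 3 + η / 3 := by
    rw [← lintegral_indicator_abs ρ hShm] at hj
    have := abs_coulomb_le (by positivity) (lintegral_coulomb_le hs hb hj hb.mass hA.le
      (by positivity) hM.le ht0 (by positivity : 0 < t ^ 2))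
    refine (le_abs_self _).trans (this.trans ?_)
    have e1 : 2 * sphereArea * A * t ^ 2 / t = 2 * sphereArea * A * t := by field_simp
    have e2 : M / N * M / t ^ 2 ≤ η / 3 := by
      have : M / N * M / t ^ 2 = M ^ 2 / t ^ 2 / N := by field_simp
      rw [this, div_le_iff₀ hN0]
      rw [div_lt_iff₀ (by positivity)] at hN
      linarith
    rw [e1]
    linarith
  have hout : coulomb (O.indicator ρ) (B.indicator ρ) ≤ η / 3 := by
    refine (le_abs_self _).trans (abs_coulomb_le (by positivity) ?_)
    refine (lintegral_separated_le ho.aemeasurable hb.aemeasurable hR0 ?_).trans ?_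
    · intro x y hx hy
      have hx' : (j + 1) * R < ‖x - a‖ := by
        have : x ∈ O := mem_of_indicator_ne_zero hx
        rwa [hO, mem_compl_iff, mem_closedBall_iff_norm, not_le] at this
      have hy' : ‖y - a‖ ≤ j * R := mem_closedBall_iff_norm.1 (mem_of_indicator_ne_zero hy)
      have : ‖x - a‖ ≤ ‖x - y‖ + ‖y - a‖ := by
        simpa using norm_add_le (x - y) (y - a)
      linarith
    · refine (mul_le_mul_right (mul_le_mul' ho.mass hb.mass) _).trans ?_
      rw [← ENNReal.ofReal_mul hM.le, ← ENNReal.ofReal_mul (by positivity)]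
      apply ENNReal.ofReal_le_ofReal
      rw [inv_mul_le_iff₀ hR0]
      have : M ^ 2 / (η / 3) ≤ R := le_max_right _ _
      rw [div_le_iff₀ (by positivity)] at this
      linarith
  linarith

end Shells

end VlasovPoisson

namespace VlasovPoisson

variable {Q : ℝ → ℝ → ℝ} {k : ℝ}

/-! ### Almost minimizers do not split. -/

section Concentration

lemma massIn_nonneg {f : Phase → ℝ} (h0 : ∀ᵐ p, 0 ≤ f p) (a : Space) (R : ℝ) :
    0 ≤ massIn f a R :=
  setIntegral_nonneg_of_ae h0

lemma massIn_mono {f : Phase → ℝ} (hf : Integrable f) (h0 : ∀ᵐ p, 0 ≤ f p) {a b : Space}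
    {R S : ℝ} (h : Metric.closedBall a R ⊆ Metric.closedBall b S) :
    massIn f a R ≤ massIn f b S :=
  setIntegral_mono_set hf.integrableOn (ae_restrict_of_ae h0)
    (LE.le.eventuallyLE (prod_mono h Subset.rfl))

lemma massIn_le {f : Phase → ℝ} (hf : Integrable f) (h0 : ∀ᵐ p, 0 ≤ f p) (a : Space) (R : ℝ) :
    massIn f a R ≤ ∫ p, f p :=
  setIntegral_le_integral hf h0

lemma compl_prod_univ (B : Set Space) :
    (B ×ˢ (univ : Set Space))ᶜ = Bᶜ ×ˢ (univ : Set Space) := by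
  ext p
  simp

lemma massIn_add_compl {f : Phase → ℝ} (hf : Integrable f) (a : Space) (R : ℝ) :
    massIn f a R + ∫ p in (Metric.closedBall a R)ᶜ ×ˢ (univ : Set Space), f p = ∫ p, f p := by
  rw [massIn, ← compl_prod_univ]
  exact integral_add_compl (measurableSet_closedBall.prod MeasurableSet.univ) hf

lemma rot_mem_axisBall (θ z r : ℝ) (x : Space) :
    rot θ x ∈ Metric.closedBall (axisPoint z) r ↔ x ∈ Metric.closedBall (axisPoint z) r := by
  conv_lhs => rw [← rot_axisPoint θ z]
  exact rot_mem_closedBall θ _ _ _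

/-- A ball centred on the axis and its complement are invariant under rotations, so both pieces are
admissible for the symmetric problem at their own mass and the scaling inequality applies to each.
Up to η the interaction between them is negligible, and the radius is bounded independently of f and
z. -/
lemma exists_splitting (hQ : CasimirAssumptions Q k) {M h S η R₁ : ℝ} (hM : 0 < M)
    (hh : ∀ g ∈ admissibleS Q M, h ≤ energyCasimir Q g) (hη : 0 < η) :
    ∃ R₂ : ℝ, ∀ f ∈ admissibleS Q M, (freeEnergy Q f).toReal ≤ S → ∀ z : ℝ, ∃ s, R₁ ≤ s ∧ s ≤ R₂ ∧
      ((massIn f (axisPoint z) s / M) ^ (5 / 3 : ℝ) +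
        ((M - massIn f (axisPoint z) s) / M) ^ (5 / 3 : ℝ)) * h - η ≤ energyCasimir Q f := by
  obtain ⟨A, hA, hb⟩ := exists_densityBound_of_freeEnergy_le hQ M S
  obtain ⟨R₂, hR₂⟩ := exists_small_interaction (R₁ := R₁) hM hA hη
  refine ⟨R₂, fun f hf hfS z => ?_⟩
  obtain ⟨s, hs1, hs2, hs⟩ := hR₂ _ (hb f M le_rfl hf.1 hfS) (axisPoint z)
  refine ⟨s, hs1, hs2, ?_⟩
  set B := Metric.closedBall (axisPoint z) s with hB
  have hBm : MeasurableSet B := measurableSet_closedBall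
  have h1 := restrictTo_mem_admissibleS hQ hBm (fun θ x => rot_mem_axisBall θ z s x) hf
  have h2 := restrictTo_mem_admissibleS hQ hBm.compl
    (fun θ x => not_congr (rot_mem_axisBall θ z s x)) hf
  have hc := massIn_add_compl hf.1.1 (axisPoint z) s
  have h0 := massIn_nonneg hf.1.2.1 (axisPoint z) s
  have hle := massIn_le hf.1.1 hf.1.2.1 (axisPoint z) s
  rw [hf.1.2.2.1] at hc hle
  have h3 : ∫ p in Bᶜ ×ˢ (univ : Set Space), f p = M - massIn f (axisPoint z) s := by linarith
  rw [h3] at h2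
  have e1 := scaling_le hQ hM hh hle h1
  have e2 := scaling_le hQ hM hh (by linarith) h2
  rw [energyCasimir_split hQ hBm hf.1]
  linarith

/-- Bernoulli's inequality for the concave power y^(2/3), multiplied by y and applied to y = x and y
= 1 - x. It quantifies the energy lost when mass is split. -/
lemma rpow_add_rpow_le {x : ℝ} (h0 : 0 ≤ x) (h1 : x ≤ 1) :
    x ^ (5 / 3 : ℝ) + (1 - x) ^ (5 / 3 : ℝ) ≤ 1 - 4 / 3 * (x * (1 - x)) := by
  have key : ∀ y : ℝ, 0 ≤ y → y ≤ 1 → y ^ (5 / 3 : ℝ) ≤ y * (1 - 2 / 3 * (1 - y)) := by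
    intro y hy0 hy1
    rw [show (5 / 3 : ℝ) = 1 + 2 / 3 by norm_num, Real.rpow_add' hy0 (by norm_num), Real.rpow_one]
    have := rpow_one_add_le_one_add_mul_self (s := y - 1) (by linarith) (p := 2 / 3)
      (by norm_num) (by norm_num)
    rw [show 1 + (y - 1) = y by ring] at this
    nlinarith
  have e1 := key x h0 h1
  have e2 := key (1 - x) (by linarith) (by linarith)
  nlinarith

/-- Almost minimizers with some mass near a point of the axis are concentrated there. -/
lemma exists_concentration (hQ : CasimirAssumptions Q k) {M h S δ R₀ ε : ℝ} (hM : 0 < M)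
    (hh : ∀ g ∈ admissibleS Q M, h ≤ energyCasimir Q g) (hneg : h < 0) (hδ : 0 < δ)
    (hε : 0 < ε) :
    ∃ R η : ℝ, 0 < η ∧ ∀ f ∈ admissibleS Q M, (freeEnergy Q f).toReal ≤ S →
      energyCasimir Q f ≤ h + η → ∀ z, δ ≤ massIn f (axisPoint z) R₀ →
        M - ε ≤ massIn f (axisPoint z) R := by
  -- Twice η is available: once for the energy above h, once for the interaction across the cut.
  -- Then (-h)(4/3)x(1-x) ≤ 2η, and x ≥ δ/M turns this into 1 - x ≤ ε/M.
  set η : ℝ := (-h) * (2 / 3) * (δ / M) * (ε / M) with hη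
  have hη0 : 0 < η := by
    have : 0 < -h := by linarith
    positivity
  obtain ⟨R, hR⟩ := exists_splitting (S := S) (R₁ := R₀) hQ hM hh hη0
  refine ⟨R, η, hη0, fun f hf hfS hfh z hz => ?_⟩
  obtain ⟨s, hs1, hs2, hs⟩ := hR f hf hfS z
  have hmono := massIn_mono hf.1.1 hf.1.2.1 (Metric.closedBall_subset_closedBall (x := axisPoint z) hs1)
  have hmono' := massIn_mono hf.1.1 hf.1.2.1 (Metric.closedBall_subset_closedBall (x := axisPoint z) hs2)
  have hle := massIn_le hf.1.1 hf.1.2.1 (axisPoint z) s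
  rw [hf.1.2.2.1] at hle
  set m := massIn f (axisPoint z) s with hm
  have hx : (M - m) / M = 1 - m / M := by field_simp
  rw [hx] at hs
  set x := m / M with hx'
  have hx0 : δ / M ≤ x := by rw [hx']; gcongr; linarith
  have hx1 : x ≤ 1 := (div_le_one hM).2 hle
  have hδM : 0 < δ / M := by positivity
  have e1 := rpow_add_rpow_le (hδM.le.trans hx0) hx1
  have e2 : (1 - 4 / 3 * (x * (1 - x))) * h ≤ h + 2 * η := by
    have := mul_le_mul_of_nonpos_right e1 hneg.le
    linarith
  have e3 : (-h) * (x * (1 - x)) ≤ (-h) * (δ / M * (ε / M)) := by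
    rw [hη] at e2
    linarith
  have e4 : x * (1 - x) ≤ δ / M * (ε / M) := le_of_mul_le_mul_left e3 (by linarith)
  have e5 : δ / M * (1 - x) ≤ δ / M * (ε / M) := by nlinarith
  have e6 : 1 - x ≤ ε / M := le_of_mul_le_mul_left e5 hδM
  have e7 : M * (1 - x) ≤ ε := by
    rw [le_div_iff₀ hM] at e6
    linarith
  have e8 : M * x = m := by rw [hx']; field_simp
  nlinarith

end Concentration

/-! ### Mass near the axis. -/

section Nonvanishing

lemma lintegral_density_ball_le {f : Phase → ℝ} (hf : Integrable f) (h0 : ∀ᵐ p, 0 ≤ f p)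
    (a : Space) (R : ℝ) :
    ∫⁻ x in Metric.closedBall a R, ENNReal.ofReal |density f x| ≤
      ENNReal.ofReal (massIn f a R) := by
  have hBm : MeasurableSet (Metric.closedBall a R) := measurableSet_closedBall
  have hm : MeasurableSet (Metric.closedBall a R ×ˢ (univ : Set Space)) :=
    hBm.prod MeasurableSet.univ
  rw [← lintegral_indicator_abs _ hBm, ← density_restrictTo]
  refine (lintegral_abs_density_le (hf.indicator hm)).trans ?_
  rw [lintegral_abs_eq (hf.indicator hm), integral_indicator hm]
  · exact le_rfl
  · filter_upwards [h0] with p hp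
    by_cases h : p ∈ Metric.closedBall a R ×ˢ (univ : Set Space) <;> simp only [indicator, h, if_true, if_false, le_refl, hp]

/-- The interaction at distances between `r` and `R` is controlled by the mass in balls. -/
lemma lintegral_middle_le {ρ : Space → ℝ} (hρ : AEMeasurable ρ) {r R : ℝ} (hr : 0 < r) {δ : ℝ≥0∞}
    (hδ : ∀ a, ∫⁻ x in Metric.closedBall a R, ENNReal.ofReal |ρ x| ≤ δ) :
    ∫⁻ z in {z : Space × Space | r ≤ ‖z.1 - z.2‖ ∧ ‖z.1 - z.2‖ ≤ R}, coulombDensity ρ ρ z ≤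
      ENNReal.ofReal r⁻¹ * ((∫⁻ x, ENNReal.ofReal |ρ x|) * δ) := by
  have hset : {z : Space × Space | r ≤ ‖z.1 - z.2‖ ∧ ‖z.1 - z.2‖ ≤ R} =
      {z | r ≤ ‖z.1 - z.2‖} ∩ {z | ‖z.1 - z.2‖ ≤ R} := by ext; simp
  have hsm : MeasurableSet {z : Space × Space | r ≤ ‖z.1 - z.2‖ ∧ ‖z.1 - z.2‖ ≤ R} := by
    rw [hset]
    exact (measurableSet_le measurable_const (by fun_prop)).inter
      (measurableSet_le (by fun_prop) measurable_const)
  have hRm : MeasurableSet {z : Space × Space | ‖z.1 - z.2‖ ≤ R} :=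
    measurableSet_le (by fun_prop) measurable_const
  have h1 : AEMeasurable (fun z : Space × Space => ρ z.1) :=
    hρ.comp_quasiMeasurePreserving Measure.quasiMeasurePreserving_fst
  have h2 : AEMeasurable (fun z : Space × Space => ρ z.2) :=
    hρ.comp_quasiMeasurePreserving Measure.quasiMeasurePreserving_snd
  have hm : AEMeasurable ({z : Space × Space | ‖z.1 - z.2‖ ≤ R}.indicator
      fun z => ENNReal.ofReal |ρ z.1| * ENNReal.ofReal |ρ z.2|) :=
    AEMeasurable.indicator (by fun_prop) hRm
  calc ∫⁻ z in {z : Space × Space | r ≤ ‖z.1 - z.2‖ ∧ ‖z.1 - z.2‖ ≤ R}, coulombDensity ρ ρ z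
      ≤ ∫⁻ z, ENNReal.ofReal r⁻¹ * {z : Space × Space | ‖z.1 - z.2‖ ≤ R}.indicator
          (fun z => ENNReal.ofReal |ρ z.1| * ENNReal.ofReal |ρ z.2|) z := by
        rw [← lintegral_indicator hsm]
        refine lintegral_mono fun z => ?_
        by_cases hz : z ∈ {z : Space × Space | r ≤ ‖z.1 - z.2‖ ∧ ‖z.1 - z.2‖ ≤ R}
        · have hz' : r ≤ ‖z.1 - z.2‖ ∧ ‖z.1 - z.2‖ ≤ R := hz
          rw [indicator_of_mem hz, indicator_of_mem (show z ∈ {z : Space × Space | ‖z.1 - z.2‖ ≤ R} from hz'.2),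
            ← ENNReal.ofReal_mul (abs_nonneg _), ← ENNReal.ofReal_mul (by positivity)]
          apply ENNReal.ofReal_le_ofReal
          rw [div_eq_inv_mul]
          gcongr
          exact hz'.1
        · simp [indicator_of_notMem hz]
    _ = ENNReal.ofReal r⁻¹ * ∫⁻ x, ENNReal.ofReal |ρ x| *
          ∫⁻ y in Metric.closedBall x R, ENNReal.ofReal |ρ y| := by
        rw [lintegral_const_mul' _ _ ENNReal.ofReal_ne_top, Measure.volume_eq_prod,
          lintegral_prod _ hm]
        congr 2 with x
        rw [← lintegral_const_mul' _ _ ENNReal.ofReal_ne_top,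
          ← lintegral_indicator measurableSet_closedBall]
        congr 1 with y
        by_cases hy : ‖x - y‖ ≤ R
        · rw [indicator_of_mem (show (x, y) ∈ {z : Space × Space | ‖z.1 - z.2‖ ≤ R} from hy),
            indicator_of_mem (mem_closedBall_iff_norm'.2 hy)]
        · rw [indicator_of_notMem (show (x, y) ∉ {z : Space × Space | ‖z.1 - z.2‖ ≤ R} from hy),
            indicator_of_notMem (fun h => hy (mem_closedBall_iff_norm'.1 h))]
    _ ≤ _ := by
        rw [← lintegral_mul_const'' _ (by fun_prop)]
        gcongr with x
        exact hδ x

/-- A density with nontrivial self-interaction has mass in some ball of fixed radius. -/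
lemma exists_ball_mass {M A c : ℝ} (hM : 0 < M) (hA : 0 < A) (hc : 0 < c) :
    ∃ δ R : ℝ, 0 < δ ∧ 0 < R ∧ ∀ ρ : Space → ℝ, DensityBound ρ M A → c ≤ coulomb ρ ρ →
      ∃ a, ENNReal.ofReal δ < ∫⁻ x in Metric.closedBall a R, ENNReal.ofReal |ρ x| := by
  have hκ := sphereArea_pos
  have ht : Tendsto (fun t : ℝ => t * A ^ 2 + 2 * sphereArea * A * t) (𝓝[>] 0) (𝓝 0) := by
    have : Continuous (fun t : ℝ => t * A ^ 2 + 2 * sphereArea * A * t) := by fun_prop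
    simpa using (this.tendsto 0).mono_left nhdsWithin_le_nhds
  obtain ⟨t, ht1, ht0⟩ := ((ht.eventually_lt_const (by positivity : 0 < c / 4)).and
    self_mem_nhdsWithin).exists
  replace ht0 : 0 < t := ht0
  -- If every ball of radius R had mass at most δ, the interaction at distances below t², between t²
  -- and R, and above R would each be at most c/4, by the choice of t, δ and R respectively. The
  -- total 3c/4 contradicts the lower bound c.
  set R := M ^ 2 / (c / 4) with hR
  set δ := t ^ 2 * (c / 4) / M with hδ
  have hR0 : 0 < R := by positivity
  refine ⟨δ, R, by positivity, hR0, fun ρ hρ hcρ => ?_⟩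
  by_contra! hcon
  have h1 := lintegral_near_le hρ hρ hA.le ht0 (by positivity : 0 < t ^ 2)
  have h2 := lintegral_middle_le hρ.aemeasurable (by positivity : 0 < t ^ 2) hcon
  have h3 := lintegral_far_le hρ.aemeasurable hρ.aemeasurable hR0
    (s := {z : Space × Space | R ≤ ‖z.1 - z.2‖}) (fun z hz => hz)
    (measurableSet_le measurable_const (by fun_prop))
  have hcover : (univ : Set (Space × Space)) ⊆ nearSet (t ^ 2) ∪
      ({z : Space × Space | t ^ 2 ≤ ‖z.1 - z.2‖ ∧ ‖z.1 - z.2‖ ≤ R} ∪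
        {z : Space × Space | R ≤ ‖z.1 - z.2‖}) := by
    intro z _
    rcases lt_or_ge ‖z.1 - z.2‖ (t ^ 2) with h | h
    · exact Or.inl h
    · rcases le_total ‖z.1 - z.2‖ R with h' | h'
      · exact Or.inr (Or.inl ⟨h, h'⟩)
      · exact Or.inr (Or.inr h')
  have htot : ∫⁻ z, coulombDensity ρ ρ z ≤ ENNReal.ofReal (3 * (c / 4)) := by
    rw [← setLIntegral_univ]
    refine (lintegral_mono_set hcover).trans ((lintegral_union_le _ _ _).trans
      ((add_le_add h1 ((lintegral_union_le _ _ _).trans (add_le_add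
        (h2.trans (mul_le_mul_right (mul_le_mul_left hρ.mass _) _))
        (h3.trans (mul_le_mul_right (mul_le_mul' hρ.mass hρ.mass) _))))).trans ?_))
    rw [← ENNReal.ofReal_mul hM.le, ← ENNReal.ofReal_mul hM.le, ← ENNReal.ofReal_mul (by positivity),
      ← ENNReal.ofReal_mul (by positivity), ← ENNReal.ofReal_add (by positivity) (by positivity),
      ← ENNReal.ofReal_add (by positivity) (by positivity)]
    apply ENNReal.ofReal_le_ofReal
    have e1 : 2 * sphereArea * A * t ^ 2 / t = 2 * sphereArea * A * t := by field_simp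
    have e2 : (t ^ 2)⁻¹ * (M * δ) = c / 4 := by rw [hδ]; field_simp
    have e3 : R⁻¹ * (M * M) = c / 4 := by rw [hR]; field_simp
    rw [e1, e2, e3]
    linarith
  have := (le_abs_self _).trans (abs_coulomb_le (by positivity) htot)
  linarith

lemma massIn_rot {f : Phase → ℝ} {M : ℝ} (hf : f ∈ admissibleS Q M) (θ : ℝ) (a : Space) (R : ℝ) :
    massIn f (rot θ a) R = massIn f a R := by
  rw [massIn, massIn, ← (measurePreserving_rotPhase θ).setIntegral_preimage_emb
    (measurableEmbedding_rotPhase θ)]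
  have : rotPhase θ ⁻¹' (Metric.closedBall (rot θ a) R ×ˢ (univ : Set Space)) =
      Metric.closedBall a R ×ˢ (univ : Set Space) := by
    ext p
    rw [mem_preimage, mem_prod, mem_prod]
    exact and_congr (rot_mem_closedBall θ a p.1 R) Iff.rfl
  rw [this]
  exact integral_congr_ae (ae_restrict_of_ae (hf.2 θ))

/-- The distance from the axis. -/
noncomputable def axisDist (a : Space) : ℝ := √(a 0 ^ 2 + a 1 ^ 2)

/-- The squared distance also contains the difference of the sines, which is dropped: the angles
used below are prescribed through their cosines. -/
lemma norm_rot_sub_rot (θ φ : ℝ) (a : Space) :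
    axisDist a * |Real.cos θ - Real.cos φ| ≤ ‖rot θ a - rot φ a‖ := by
  refine abs_le_of_sq_le_sq' ?_ (norm_nonneg _) |>.2
  rw [mul_pow, axisDist, Real.sq_sqrt (by positivity), sq_abs, norm_sq_space]
  simp only [PiLp.sub_apply, rot_zero_apply, rot_one_apply, rot_two_apply]
  have : 0 ≤ (a 0 ^ 2 + a 1 ^ 2) * (Real.sin θ - Real.sin φ) ^ 2 := by positivity
  linarith

lemma norm_sub_axisPoint (a : Space) : ‖a - axisPoint (a 2)‖ = axisDist a := by
  rw [axisDist, eq_comm, Real.sqrt_eq_iff_mul_self_eq (by positivity) (norm_nonneg _), ← sq,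
    norm_sq_space]
  simp [axisPoint]

/-- Balls of a given mass cannot be far from the axis of symmetry. -/
lemma axisDist_le {f : Phase → ℝ} {M : ℝ} (hf : f ∈ admissibleS Q M) {δ R : ℝ}
    {N : ℕ} (hN : M < N * δ) (hN0 : 0 < N) {a : Space} (ha : δ ≤ massIn f a R) :
    axisDist a ≤ 2 * R * N := by
  by_contra! hcon
  have hN' : (0 : ℝ) < N := by exact_mod_cast hN0
  -- Equally spaced cosines put the rotated centres at mutual distance at least `axisDist a / N`,
  -- which exceeds 2R. The N disjoint balls have equal mass at least δ, too much in total.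
  set c : ℕ → Space := fun j => rot (Real.arccos (j / N)) a with hc
  have hcos : ∀ j : ℕ, j < N → Real.cos (Real.arccos (j / N)) = j / N := by
    intro j hj
    have : (j : ℝ) / N ≤ 1 := (div_le_one hN').2 (by exact_mod_cast hj.le)
    have h0 : (0 : ℝ) ≤ (j : ℝ) / N := by positivity
    exact Real.cos_arccos (by linarith) this
  have hdist : ∀ i j : ℕ, i < N → j < N → i ≠ j → 2 * R < ‖c i - c j‖ := by
    intro i j hi hj hij
    refine lt_of_lt_of_le ?_ (norm_rot_sub_rot _ _ a)
    rw [hcos i hi, hcos j hj, ← sub_div, abs_div, abs_of_pos hN']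
    have h1 : (1 : ℝ) ≤ |(i : ℝ) - j| := by
      have : (1 : ℤ) ≤ |(i : ℤ) - j| := Int.one_le_abs (by omega)
      exact_mod_cast this
    have h2 : axisDist a * (1 / N) ≤ axisDist a * (|(i : ℝ) - j| / N) := by
      have : 0 ≤ axisDist a := Real.sqrt_nonneg _
      gcongr
    refine lt_of_lt_of_le ?_ h2
    rw [mul_one_div, lt_div_iff₀ hN']
    exact hcon
  have hsum : ∑ j ∈ Finset.range N, massIn f (c j) R ≤ M := by
    simp only [massIn]
    rw [← integral_biUnion_finset]
    · rw [← hf.1.2.2.1]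
      exact setIntegral_le_integral hf.1.1 hf.1.2.1
    · exact fun j _ => measurableSet_closedBall.prod MeasurableSet.univ
    · intro i hi j hj hij
      have := hdist i j (Finset.mem_range.1 hi) (Finset.mem_range.1 hj) hij
      refine Set.disjoint_left.2 fun p hp hp' => ?_
      have h1 := mem_closedBall_iff_norm'.1 hp.1
      have h2 := mem_closedBall_iff_norm.1 hp'.1
      have h3 : ‖c i - c j‖ ≤ ‖c i - p.1‖ + ‖p.1 - c j‖ := by
        simpa using norm_add_le (c i - p.1) (p.1 - c j)
      linarith
    · exact fun j _ => hf.1.1.integrableOn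
  have hsum' : ∑ j ∈ Finset.range N, massIn f (c j) R = N * massIn f a R := by
    rw [Finset.sum_congr rfl fun j _ => massIn_rot hf _ a R]
    simp
  rw [hsum'] at hsum
  nlinarith

/-- Axially symmetric densities with nontrivial self-interaction have mass near the axis. -/
lemma exists_axis_mass (hQ : CasimirAssumptions Q k) {M S c : ℝ} (hM : 0 < M) (hc : 0 < c) :
    ∃ δ R : ℝ, 0 < δ ∧ ∀ f ∈ admissibleS Q M, (freeEnergy Q f).toReal ≤ S →
      c ≤ coulomb (density f) (density f) → ∃ z, δ ≤ massIn f (axisPoint z) R := by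
  obtain ⟨A, hA, hb⟩ := exists_densityBound_of_freeEnergy_le hQ M S
  obtain ⟨δ, R, hδ, hR, h⟩ := exists_ball_mass hM hA hc
  obtain ⟨N, hN⟩ := exists_nat_gt (M / δ)
  have hN0 : (0 : ℝ) < N := lt_of_le_of_lt (by positivity) hN
  refine ⟨δ, R + 2 * R * N, hδ, fun f hf hfS hfc => ?_⟩
  obtain ⟨a, ha⟩ := h _ (hb f M le_rfl hf.1 hfS) hfc
  have ha' : δ ≤ massIn f a R := by
    have := (ha.le.trans (lintegral_density_ball_le hf.1.1 hf.1.2.1 a R))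
    rwa [ENNReal.ofReal_le_ofReal_iff (massIn_nonneg hf.1.2.1 a R)] at this
  have hd := axisDist_le hf ((div_lt_iff₀ hδ).1 hN) (Nat.cast_pos.1 hN0) ha'
  refine ⟨a 2, ha'.trans (massIn_mono hf.1.1 hf.1.2.1 ?_)⟩
  apply Metric.closedBall_subset_closedBall'
  rw [dist_eq_norm, norm_sub_axisPoint]
  linarith

end Nonvanishing

end VlasovPoisson

namespace VlasovPoisson

variable {Q : ℝ → ℝ → ℝ} {k : ℝ}

/-! ### Finite infimum and choice of the shifts. -/

section MinimizingSequence

lemma exists_le_massIn {f : Phase → ℝ} (hf : Integrable f) (a : Space) {ε : ℝ} (hε : 0 < ε) :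
    ∃ R : ℝ, (∫ p, f p) - ε ≤ massIn f a R := by
  have h := tendsto_setIntegral_of_monotone (μ := (volume : Measure Phase)) (f := f)
    (s := fun n : ℕ => Metric.closedBall a (n : ℝ) ×ˢ (univ : Set Space))
    (fun n => measurableSet_closedBall.prod MeasurableSet.univ)
    (fun m n hmn => prod_mono (Metric.closedBall_subset_closedBall (by exact_mod_cast hmn))
      Subset.rfl) hf.integrableOn
  have hU : ⋃ n : ℕ, Metric.closedBall a (n : ℝ) ×ˢ (univ : Set Space) = univ := by
    rw [← iUnion_prod_const, Metric.iUnion_closedBall_nat, univ_prod_univ]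
  rw [hU, setIntegral_univ] at h
  obtain ⟨n, hn⟩ := (h.eventually_const_lt (sub_lt_self _ hε)).exists
  exact ⟨n, hn.le⟩

/-- The extended real infimum is finite: coercivity bounds it below and the first member of the
sequence bounds it above. -/
lemma IsMinimizingSeq.exists_inf (hQ : CasimirAssumptions Q k) {M : ℝ} (hM : 0 < M)
    {f : ℕ → Phase → ℝ} (hf : IsMinimizingSeq Q M f) :
    ∃ h : ℝ, (∀ g ∈ admissibleS Q M, h ≤ energyCasimir Q g) ∧
      Tendsto (fun i => energyCasimir Q (f i)) atTop (𝓝 h) := by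
  obtain ⟨K, hK⟩ := exists_freeEnergy_le hQ hM
  have hbot : ((-K : ℝ) : EReal) ≤ infEnergyS Q M := by
    refine le_iInf₂ fun g hg => ?_
    have h1 := hK g M le_rfl hg.1
    have h2 : 0 ≤ (freeEnergy Q g).toReal := ENNReal.toReal_nonneg
    exact_mod_cast (by linarith : -K ≤ energyCasimir Q g)
  have htop : infEnergyS Q M ≤ (energyCasimir Q (f 0) : EReal) := iInf₂_le _ (hf.1 0)
  have h1 : infEnergyS Q M ≠ ⊥ := ne_bot_of_le_ne_bot (EReal.coe_ne_bot _) hbot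
  have h2 : infEnergyS Q M ≠ ⊤ := ne_top_of_le_ne_top (EReal.coe_ne_top _) htop
  have h3 : ((infEnergyS Q M).toReal : EReal) = infEnergyS Q M := EReal.coe_toReal h2 h1
  refine ⟨(infEnergyS Q M).toReal, fun g hg => ?_, ?_⟩
  · have : infEnergyS Q M ≤ (energyCasimir Q g : EReal) := iInf₂_le _ hg
    rw [← h3] at this
    exact_mod_cast this
  · have := hf.2
    rw [← h3] at this
    exact EReal.tendsto_coe.1 this

/-- Minimizing sequences are concentrated near suitable points of the axis of symmetry. -/
lemma IsMinimizingSeq.exists_shifts (hQ : CasimirAssumptions Q k) {M : ℝ} (hM : 0 < M)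
    {f : ℕ → Phase → ℝ} (hf : IsMinimizingSeq Q M f) :
    ∃ (h S : ℝ) (z : ℕ → ℝ), (∀ g ∈ admissibleS Q M, h ≤ energyCasimir Q g) ∧
      Tendsto (fun i => energyCasimir Q (f i)) atTop (𝓝 h) ∧
      (∀ i, (freeEnergy Q (f i)).toReal ≤ S) ∧
      ∀ ε : ℝ, 0 < ε → ∃ R : ℝ, 0 < R ∧ ∀ i, M - ε ≤ massIn (f i) (axisPoint (z i)) R := by
  obtain ⟨h, hh, hlim⟩ := hf.exists_inf hQ hM
  obtain ⟨K, hK⟩ := exists_freeEnergy_le hQ hM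
  have hneg : h < 0 := by
    obtain ⟨g, hg, hg0⟩ := exists_energy_neg hQ hM
    exact (hh g hg).trans_lt hg0
  obtain ⟨E, hE⟩ := hlim.bddAbove_range
  set S := 2 * (E + K)
  have hS : ∀ i, (freeEnergy Q (f i)).toReal ≤ S := by
    intro i
    have h1 := hK (f i) M le_rfl (hf.1 i).1
    have h2 : energyCasimir Q (f i) ≤ E := hE (mem_range_self i)
    linarith
  obtain ⟨δ, R₀, hδ, haxis⟩ := exists_axis_mass (S := S) hQ hM (neg_pos.2 hneg)
  -- From T - D/2 < h/2 and T ≥ 0 it follows that D ≥ -h > 0.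
  have hev : ∀ᶠ i in atTop, ∃ z, δ ≤ massIn (f i) (axisPoint z) R₀ := by
    filter_upwards [hlim.eventually_lt_const (by linarith : h < h / 2)] with i hi
    refine haxis (f i) (hf.1 i) (hS i) ?_
    rw [energyCasimir_eq hQ (hf.1 i).1] at hi
    have : 0 ≤ (freeEnergy Q (f i)).toReal := ENNReal.toReal_nonneg
    linarith
  -- The shifts must not depend on ε. For the finitely many indices without a good point the value 0
  -- serves; these are handled below by enlarging the radius.
  have hz : ∀ i, ∃ z, (∃ z, δ ≤ massIn (f i) (axisPoint z) R₀) →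
      δ ≤ massIn (f i) (axisPoint z) R₀ := by
    intro i
    by_cases hi : ∃ z, δ ≤ massIn (f i) (axisPoint z) R₀
    · obtain ⟨z, hz⟩ := hi
      exact ⟨z, fun _ => hz⟩
    · exact ⟨0, fun h => absurd h hi⟩
  choose z hz using hz
  refine ⟨h, S, z, hh, hlim, hS, fun ε hε => ?_⟩
  obtain ⟨R, η, hη, hconc⟩ := exists_concentration (S := S) (R₀ := R₀) hQ hM hh hneg hδ hε
  have hev2 : ∀ᶠ i in atTop, M - ε ≤ massIn (f i) (axisPoint (z i)) R := by
    filter_upwards [hev, hlim.eventually_lt_const (by linarith : h < h + η)] with i h1 h2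
    exact hconc (f i) (hf.1 i) (hS i) h2.le (z i) (hz i h1)
  obtain ⟨n, hn⟩ := eventually_atTop.1 hev2
  have hsmall : ∀ i, ∃ r, M - ε ≤ massIn (f i) (axisPoint (z i)) r := by
    intro i
    obtain ⟨r, hr⟩ := exists_le_massIn (hf.1 i).1.1 (axisPoint (z i)) hε
    rw [(hf.1 i).1.2.2.1] at hr
    exact ⟨r, hr⟩
  choose r hr using hsmall
  obtain ⟨B, hB⟩ := ((Finset.range n).image r).bddAbove
  have hmono : ∀ i s t, s ≤ t → massIn (f i) (axisPoint (z i)) s ≤ massIn (f i) (axisPoint (z i)) t :=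
    fun i s t hst => massIn_mono (hf.1 i).1.1 (hf.1 i).1.2.1 (Metric.closedBall_subset_closedBall hst)
  refine ⟨max 1 (max R B), lt_max_of_lt_left one_pos, fun i => ?_⟩
  rcases lt_or_ge i n with hi | hi
  · refine (hr i).trans (hmono i _ _ ?_)
    refine le_trans ?_ ((le_max_right R B).trans (le_max_right _ _))
    exact hB (by simpa using ⟨i, hi, rfl⟩)
  · exact (hn i hi).trans (hmono i _ _ ((le_max_left R B).trans (le_max_right _ _)))

end MinimizingSequence

/-! ### Invariance under shifts along the axis. -/

section Shift

/-- The translation of the position variable along the axis. -/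
noncomputable def translate (z : ℝ) (p : Phase) : Phase := (p.1 + axisPoint z, p.2)

lemma measurePreserving_translate (z : ℝ) : MeasurePreserving (translate z) volume volume :=
  (measurePreserving_add_right volume (axisPoint z)).prod (MeasurePreserving.id volume)

lemma measurableEmbedding_translate (z : ℝ) : MeasurableEmbedding (translate z) :=
  ((Homeomorph.addRight (axisPoint z)).prodCongr (Homeomorph.refl Space)).measurableEmbedding

/-- The third position coordinate does not enter P; this is why shifts along the axis are harmless.
-/
lemma angMom_translate (z : ℝ) (p : Phase) : angMom (translate z p) = angMom p := by
  simp [angMom, translate, axisPoint]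

lemma casimir_shift (z : ℝ) (f : Phase → ℝ) : casimir Q (shift z f) = casimir Q f := by
  have h := (measurePreserving_translate z).lintegral_comp_emb (measurableEmbedding_translate z)
    (fun p => ENNReal.ofReal (Q (f p) (angMom p)))
  simp only [angMom_translate] at h
  exact h

lemma kineticEnergy_shift (z : ℝ) (f : Phase → ℝ) :
    kineticEnergy (shift z f) = kineticEnergy f := by
  have h := (measurePreserving_translate z).lintegral_comp_emb (measurableEmbedding_translate z)
    (fun p : Phase => ENNReal.ofReal (‖p.2‖ ^ 2 * f p))
  rw [kineticEnergy, kineticEnergy, ← h]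
  rfl

lemma freeEnergy_shift (z : ℝ) (f : Phase → ℝ) : freeEnergy Q (shift z f) = freeEnergy Q f := by
  rw [freeEnergy, freeEnergy, casimir_shift, kineticEnergy_shift]

lemma shift_mem_admissibleS {M : ℝ} {f : Phase → ℝ} (hf : f ∈ admissibleS Q M) (z : ℝ) :
    shift z f ∈ admissibleS Q M := by
  have hmp := measurePreserving_translate z
  refine ⟨⟨hmp.integrable_comp_of_integrable hf.1.1, hmp.quasiMeasurePreserving.ae hf.1.2.1, ?_, ?_⟩,
    fun θ => ?_⟩
  · rw [← hf.1.2.2.1]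
    exact hmp.integral_comp (measurableEmbedding_translate z) f
  · rw [casimir_shift, kineticEnergy_shift]
    exact hf.1.2.2.2
  · refine (hmp.quasiMeasurePreserving.ae (hf.2 θ)).mono fun p hp => ?_
    simp only [translate, rot_add, rot_axisPoint] at hp
    exact hp

lemma energyCasimir_shift (hQ : CasimirAssumptions Q k) {M : ℝ} {f : Phase → ℝ}
    (hf : f ∈ admissibleS Q M) (z : ℝ) : energyCasimir Q (shift z f) = energyCasimir Q f := by
  rw [energyCasimir_eq hQ (shift_mem_admissibleS hf z).1, energyCasimir_eq hQ hf.1,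
    freeEnergy_shift]
  congr 2
  have h : density (shift z f) = fun x => density f (x + axisPoint z) := rfl
  rw [h, coulomb, coulomb, ← integral_add_right_eq_self
    (μ := (volume : Measure Phase)) (fun z : Phase => density f z.1 * density f z.2 / ‖z.1 - z.2‖)
    (axisPoint z, axisPoint z)]
  congr 1 with p
  simp

lemma massIn_shift (z : ℝ) (f : Phase → ℝ) (R : ℝ) :
    massIn (shift z f) 0 R = massIn f (axisPoint z) R := by
  have h := (measurePreserving_translate z).setIntegral_preimage_emb
    (measurableEmbedding_translate z) f (Metric.closedBall (axisPoint z) R ×ˢ (univ : Set Space))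
  have : translate z ⁻¹' (Metric.closedBall (axisPoint z) R ×ˢ (univ : Set Space)) =
      Metric.closedBall 0 R ×ˢ (univ : Set Space) := by
    ext p
    simp [translate]
  rw [this] at h
  exact h

end Shift

end VlasovPoisson

namespace VlasovPoisson

/-! ### Young's inequality with a parameter. -/

section Young

/-- Compare b with δ a^(p-1): in either case one of the two summands alone dominates, since
(p-1)(q-1) = 1. -/
lemma mul_le_rpow_add_rpow {p q : ℝ} (hpq : p.HolderConjugate q) {δ : ℝ} (hδ : 0 < δ) {a b : ℝ}
    (ha : 0 ≤ a) (hb : 0 ≤ b) : a * b ≤ δ * a ^ p + δ ^ (-(q - 1)) * b ^ q := by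
  have hp1 := hpq.sub_one_pos
  have hq1 := hpq.symm.sub_one_pos
  have hpq1 : (p - 1) * (q - 1) = 1 := by linarith [hpq.mul_eq_add]
  rcases le_total b (δ * a ^ (p - 1)) with h | h
  · have h1 : a * b ≤ δ * a ^ p := by
      calc a * b ≤ a * (δ * a ^ (p - 1)) := by gcongr
        _ = δ * (a ^ (1 : ℝ) * a ^ (p - 1)) := by rw [Real.rpow_one]; ring
        _ = δ * a ^ p := by
          rw [← Real.rpow_add' ha (by linarith)]; ring_nf
    have : 0 ≤ δ ^ (-(q - 1)) * b ^ q := by positivity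
    linarith
  · have h2 : a ≤ δ ^ (-(q - 1)) * b ^ (q - 1) := by
      have : a ^ (p - 1) ≤ δ⁻¹ * b := by
        rw [inv_mul_eq_div, le_div_iff₀ hδ]; linarith
      calc a = (a ^ (p - 1)) ^ (q - 1) := by rw [← Real.rpow_mul ha, hpq1, Real.rpow_one]
        _ ≤ (δ⁻¹ * b) ^ (q - 1) := by gcongr
        _ = _ := by
          rw [Real.mul_rpow (by positivity) hb, Real.inv_rpow hδ.le, ← Real.rpow_neg hδ.le]
    have h1 : a * b ≤ δ ^ (-(q - 1)) * b ^ q := by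
      calc a * b ≤ (δ ^ (-(q - 1)) * b ^ (q - 1)) * b := by gcongr
        _ = δ ^ (-(q - 1)) * (b ^ (q - 1) * b ^ (1 : ℝ)) := by rw [Real.rpow_one]; ring
        _ = _ := by rw [← Real.rpow_add' hb (by linarith [hpq.symm.pos])]; ring_nf
    have : 0 ≤ δ * a ^ p := by positivity
    linarith

lemma lintegral_abs_mul_le {α : Type*} [MeasurableSpace α] {μ : Measure α} {p q : ℝ}
    (hpq : p.HolderConjugate q) {δ B E : ℝ} (hδ : 0 < δ) (hB : 0 ≤ B) (hE : 0 ≤ E) {f u : α → ℝ}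
    (hf : AEMeasurable f μ)
    (hfB : ∫⁻ x, ENNReal.ofReal (|f x| ^ p) ∂μ ≤ ENNReal.ofReal B)
    (huE : ∫⁻ x, ENNReal.ofReal (|u x| ^ q) ∂μ ≤ ENNReal.ofReal E) :
    ∫⁻ x, ENNReal.ofReal |f x * u x| ∂μ ≤ ENNReal.ofReal (δ * B + δ ^ (-(q - 1)) * E) := by
  calc ∫⁻ x, ENNReal.ofReal |f x * u x| ∂μ
      ≤ ∫⁻ x, (ENNReal.ofReal δ * ENNReal.ofReal (|f x| ^ p) +
          ENNReal.ofReal (δ ^ (-(q - 1))) * ENNReal.ofReal (|u x| ^ q)) ∂μ := by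
        refine lintegral_mono fun x => ?_
        rw [← ENNReal.ofReal_mul (by positivity), ← ENNReal.ofReal_mul (by positivity),
          ← ENNReal.ofReal_add (by positivity) (by positivity), abs_mul]
        exact ENNReal.ofReal_le_ofReal
          (mul_le_rpow_add_rpow hpq hδ (abs_nonneg _) (abs_nonneg _))
    _ ≤ _ := by
        rw [lintegral_add_left' (by fun_prop), lintegral_const_mul' _ _ ENNReal.ofReal_ne_top,
          lintegral_const_mul' _ _ ENNReal.ofReal_ne_top,
          ENNReal.ofReal_add (by positivity) (by positivity), ENNReal.ofReal_mul hδ.le,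
          ENNReal.ofReal_mul (by positivity)]
        gcongr

lemma lintegral_rpow_abs_eq {α : Type*} [MeasurableSpace α] {μ : Measure α} {u : α → ℝ} {q : ℝ}
    (hq : 0 < q) (hu : MemLp u (ENNReal.ofReal q) μ) :
    ∫⁻ x, ENNReal.ofReal (|u x| ^ q) ∂μ = ENNReal.ofReal (∫ x, ‖u x‖ ^ q ∂μ) := by
  have h := hu.integrable_norm_rpow (by simpa using hq) ENNReal.ofReal_ne_top
  rw [ENNReal.toReal_ofReal hq.le] at h
  rw [ofReal_integral_eq_lintegral_ofReal h (ae_of_all _ fun x => by positivity)]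
  rfl

lemma abs_integral_le_of_lintegral {α : Type*} [MeasurableSpace α] {μ : Measure α} {u : α → ℝ}
    {c : ℝ} (hc : 0 ≤ c) (h : ∫⁻ x, ENNReal.ofReal |u x| ∂μ ≤ ENNReal.ofReal c) :
    |∫ x, u x ∂μ| ≤ c := by
  have h1 := enorm_integral_le_lintegral_enorm (μ := μ) u
  simp only [Real.enorm_eq_ofReal_abs] at h1
  have h2 := h1.trans h
  rwa [ENNReal.ofReal_le_ofReal_iff hc] at h2

/-- The free parameter in Young's inequality makes both summands small. -/
lemma exists_young_small {q B ε : ℝ} (hB : 0 ≤ B) (hε : 0 < ε) :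
    ∃ δ E : ℝ, 0 < δ ∧ 0 < E ∧ δ * B + δ ^ (-(q - 1)) * E ≤ ε := by
  refine ⟨ε / 2 / (B + 1), ε / 2 / ((ε / 2 / (B + 1)) ^ (-(q - 1))), by positivity, by positivity, ?_⟩
  have h1 : ε / 2 / (B + 1) * B ≤ ε / 2 := by
    rw [div_mul_eq_mul_div, div_le_iff₀ (by positivity)]
    nlinarith
  have h2 : (ε / 2 / (B + 1)) ^ (-(q - 1)) * (ε / 2 / ((ε / 2 / (B + 1)) ^ (-(q - 1)))) = ε / 2 := by
    have : 0 < (ε / 2 / (B + 1)) ^ (-(q - 1)) := by positivity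
    field_simp
  linarith

end Young

/-! ### Weak sequential compactness of tight densities. -/

section Compactness

/-- The probability measure on phase space with density `f / M`. -/
noncomputable def phaseMeasure (M : ℝ) (f : Phase → ℝ) : Measure Phase :=
  (volume : Measure Phase).withDensity fun p => ENNReal.ofReal (f p / M)

variable {f : Phase → ℝ} {M : ℝ}

lemma isProbabilityMeasure_phaseMeasure (hM : 0 < M) (hf : Integrable f) (h0 : ∀ᵐ p, 0 ≤ f p)
    (hm : ∫ p, f p = M) : IsProbabilityMeasure (phaseMeasure M f) := by
  refine ⟨?_⟩
  rw [phaseMeasure, withDensity_apply _ MeasurableSet.univ, Measure.restrict_univ,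
    ← ofReal_integral_eq_lintegral_ofReal (hf.div_const M) (h0.mono fun p hp => div_nonneg hp hM.le),
    integral_div, hm, div_self hM.ne', ENNReal.ofReal_one]

lemma integral_phaseMeasure (hM : 0 < M) (hf : Integrable f) (h0 : ∀ᵐ p, 0 ≤ f p)
    (h : Phase → ℝ) : ∫ p, h p ∂phaseMeasure M f = M⁻¹ * ∫ p, f p * h p := by
  have hm := hf.aestronglyMeasurable.aemeasurable
  rw [phaseMeasure, integral_withDensity_eq_integral_toReal_smul₀ (by fun_prop)
    (ae_of_all _ fun _ => ENNReal.ofReal_lt_top), ← integral_const_mul]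
  refine integral_congr_ae (h0.mono fun p hp => ?_)
  simp only
  rw [ENNReal.toReal_ofReal (div_nonneg hp hM.le), smul_eq_mul]
  ring

lemma phaseMeasure_le (hM : 0 < M) (h0 : ∀ᵐ p, 0 ≤ f p) {s : Set Phase}
    (hs : MeasurableSet s) :
    phaseMeasure M f s = ENNReal.ofReal M⁻¹ * ∫⁻ p in s, ENNReal.ofReal |f p| := by
  rw [phaseMeasure, withDensity_apply _ hs, ← lintegral_const_mul' _ _ ENNReal.ofReal_ne_top]
  refine lintegral_congr_ae (ae_restrict_of_ae (h0.mono fun p hp => ?_))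
  simp only
  rw [← ENNReal.ofReal_mul (by positivity), abs_of_nonneg hp]
  congr 1
  ring

lemma holderConjugate_five_thirds : (5 / 3 : ℝ).HolderConjugate (5 / 2) := by
  rw [Real.holderConjugate_iff]; norm_num

/-- Young's inequality against an indicator function. It expresses uniform integrability: choosing δ
first and E second makes the mass on sets of measure at most E small. -/
lemma setLIntegral_le_young (hf : Integrable f) {B δ : ℝ} (hB : 0 ≤ B) (hδ : 0 < δ)
    (hfB : fiveThirds f ≤ ENNReal.ofReal B) {s : Set Phase} (hs : MeasurableSet s) {E : ℝ}
    (hE : 0 ≤ E) (hsE : volume s ≤ ENNReal.ofReal E) :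
    ∫⁻ p in s, ENNReal.ofReal |f p| ≤
      ENNReal.ofReal (δ * B + δ ^ (-(5 / 2 - 1) : ℝ) * E) := by
  have h := lintegral_abs_mul_le (u := s.indicator 1) holderConjugate_five_thirds hδ hB hE
    hf.aestronglyMeasurable.aemeasurable hfB (by
      refine le_trans (le_of_eq ?_) hsE
      rw [← lintegral_indicator_one hs]
      congr 1 with p
      by_cases hp : p ∈ s
      · simp [hp]
      · simp only [indicator_of_notMem hp, abs_zero]
        rw [Real.zero_rpow (by norm_num), ENNReal.ofReal_zero])
  refine le_trans (le_of_eq ?_) h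
  rw [← lintegral_indicator hs]
  congr 1 with p
  by_cases hp : p ∈ s <;> simp [hp]

/-- Weak sequential compactness: tight sequences of densities which are bounded in `L^{5/3}`
converge along a subsequence when tested with bounded functions. -/
theorem exists_weak_limit {f : ℕ → Phase → ℝ} {M B : ℝ} (hM : 0 < M) (hB : 0 ≤ B)
    (hf : ∀ n, Integrable (f n)) (h0 : ∀ n, ∀ᵐ p, 0 ≤ f n p) (hm : ∀ n, ∫ p, f n p = M)
    (hfB : ∀ n, fiveThirds (f n) ≤ ENNReal.ofReal B)
    (htight : ∀ ε : ℝ, 0 < ε → ∃ R : ℝ, ∀ n,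
      ∫⁻ p in (Metric.closedBall 0 R)ᶜ, ENNReal.ofReal |f n p| ≤ ENNReal.ofReal ε) :
    ∃ (φ : ℕ → ℕ) (f₀ : Phase → ℝ), StrictMono φ ∧ Measurable f₀ ∧ Integrable f₀ ∧
      (∀ p, 0 ≤ f₀ p) ∧ ∀ g : Phase → ℝ, Measurable g → (∃ G, ∀ p, |g p| ≤ G) →
        Tendsto (fun n => ∫ p, f (φ n) p * g p) atTop (𝓝 (∫ p, f₀ p * g p)) := by
  have hprob n := isProbabilityMeasure_phaseMeasure hM (hf n) (h0 n) (hm n)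
  let μ : ℕ → ProbabilityMeasure Phase := fun n => ⟨phaseMeasure M (f n), hprob n⟩
  -- Prokhorov's theorem supplies a weak limit ν of the normalized measures.
  have ht : IsTightMeasureSet {x | ∃ m ∈ range μ, ((m : ProbabilityMeasure Phase) : Measure Phase) = x} := by
    rw [isTightMeasureSet_iff_exists_isCompact_measure_compl_le]
    intro ε hε
    obtain ⟨ε', hε', hle⟩ : ∃ ε' : ℝ, 0 < ε' ∧ ENNReal.ofReal (M⁻¹ * ε') ≤ ε := by
      rcases eq_or_ne ε ⊤ with h | h
      · exact ⟨1, one_pos, by simp [h]⟩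
      · refine ⟨M * ε.toReal, mul_pos hM (ENNReal.toReal_pos hε.ne' h), ?_⟩
        rw [inv_mul_cancel_left₀ hM.ne', ENNReal.ofReal_toReal h]
    obtain ⟨R, hR⟩ := htight ε' hε'
    refine ⟨Metric.closedBall 0 R, isCompact_closedBall _ _, ?_⟩
    rintro _ ⟨_, ⟨n, rfl⟩, rfl⟩
    change phaseMeasure M (f n) _ ≤ ε
    rw [phaseMeasure_le hM (h0 n) measurableSet_closedBall.compl]
    refine (mul_le_mul_right (hR n) _).trans ?_
    rwa [← ENNReal.ofReal_mul (by positivity)]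
  obtain ⟨ν, -, φ, hφ, hlim⟩ := (isCompact_closure_of_isTightMeasureSet ht).tendsto_subseq
    (x := μ) (fun n => subset_closure (mem_range_self n))
  -- A null set lies in open sets of small volume; these have small mass uniformly along the
  -- sequence, hence small ν-mass by the portmanteau inequality for open sets.
  have hac : (ν : Measure Phase) ≪ volume := by
    refine Measure.AbsolutelyContinuous.mk fun s _ hs0 => ?_
    have key : ∀ ε : ℝ, 0 < ε → (ν : Measure Phase) s ≤ ENNReal.ofReal (M⁻¹ * ε) := by
      intro ε hε
      obtain ⟨δ, E, hδ, hE, hle⟩ := exists_young_small (q := 5 / 2) hB hε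
      obtain ⟨U, hsU, hU, hUE⟩ := Set.exists_isOpen_lt_of_lt s (ENNReal.ofReal E)
        (by rw [hs0]; simpa using hE)
      refine (measure_mono hsU).trans
        ((ProbabilityMeasure.le_liminf_measure_open_of_tendsto hlim hU).trans ?_)
      refine liminf_le_of_le (by isBoundedDefault) fun b hb => ?_
      obtain ⟨n, hn⟩ := hb.exists
      refine hn.trans ?_
      change phaseMeasure M (f (φ n)) U ≤ _
      rw [phaseMeasure_le hM (h0 _) hU.measurableSet, ENNReal.ofReal_mul (by positivity)]
      refine mul_le_mul_right ((setLIntegral_le_young (hf _) hB hδ (hfB _) hU.measurableSet hE.le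
        hUE.le).trans (ENNReal.ofReal_le_ofReal hle)) _
    refine le_antisymm (le_of_forall_pos_le_add ?_) zero_le
    intro ε hε
    rw [zero_add]
    rcases eq_or_ne ε ⊤ with h | h
    · simp [h]
    · have := key (M * ε.toReal) (mul_pos hM (ENNReal.toReal_pos hε.ne' h))
      rwa [inv_mul_cancel_left₀ hM.ne', ENNReal.ofReal_toReal h] at this
  set f₀ : Phase → ℝ := fun p => M * ((ν : Measure Phase).rnDeriv volume p).toReal with hf₀
  have hf₀int : ∀ g : Phase → ℝ, ∫ p, f₀ p * g p = M * ∫ p, g p ∂(ν : Measure Phase) := by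
    intro g
    rw [← integral_rnDeriv_smul hac, ← integral_const_mul]
    congr 1 with p
    simp only [hf₀, smul_eq_mul]
    ring
  refine ⟨φ, f₀, hφ, ((Measure.measurable_rnDeriv _ _).ennreal_toReal).const_mul M,
    Measure.integrable_toReal_rnDeriv.const_mul M, fun p => by positivity, ?_⟩
  intro g hg hgG
  have hcont : ∀ h : BoundedContinuousFunction Phase ℝ,
      Tendsto (fun n => ∫ p, f (φ n) p * h p) atTop (𝓝 (∫ p, f₀ p * h p)) := by
    intro h
    have h1 := (ProbabilityMeasure.tendsto_iff_forall_integral_tendsto.1 hlim h).const_mul M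
    rw [hf₀int]
    refine h1.congr fun n => ?_
    change M * ∫ p, h p ∂phaseMeasure M (f (φ n)) = _
    rw [integral_phaseMeasure hM (hf _) (h0 _), mul_inv_cancel_left₀ hM.ne']
  obtain ⟨G, hG⟩ := hgG
  have hG0 : 0 ≤ G := (abs_nonneg _).trans (hG 0)
  have happrox : ∀ ε : ℝ, 0 < ε → ∃ h : BoundedContinuousFunction Phase ℝ,
      (∀ n, |(∫ p, f n p * g p) - ∫ p, f n p * h p| ≤ ε) ∧
        |(∫ p, f₀ p * g p) - ∫ p, f₀ p * h p| ≤ ε := by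
    intro ε hε
    set ε₁ := ε / 2 / (G + 1) / (M + 1) with hε₁
    have hε₁0 : 0 < ε₁ := by positivity
    obtain ⟨R₁, hR₁⟩ := htight ε₁ hε₁0
    obtain ⟨R₂, hR₂⟩ : ∃ R₂ : ℝ, (ν : Measure Phase) (Metric.closedBall 0 R₂)ᶜ ≤ ENNReal.ofReal ε₁ := by
      have h1 := isTightMeasureSet_singleton (μ := (ν : Measure Phase))
      rw [isTightMeasureSet_iff_exists_isCompact_measure_compl_le] at h1
      obtain ⟨K, hK, hKle⟩ := h1 (ENNReal.ofReal ε₁) (by simpa using hε₁0)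
      obtain ⟨R, hR⟩ := hK.isBounded.subset_closedBall 0
      exact ⟨R, (measure_mono (compl_subset_compl.2 hR)).trans (hKle _ rfl)⟩
    set R := max R₁ R₂
    set D := Metric.closedBall (0 : Phase) R with hD
    have hDm : MeasurableSet D := measurableSet_closedBall
    have hD₁ : Dᶜ ⊆ (Metric.closedBall 0 R₁)ᶜ :=
      compl_subset_compl.2 (Metric.closedBall_subset_closedBall (le_max_left _ _))
    have hD₂ : Dᶜ ⊆ (Metric.closedBall 0 R₂)ᶜ :=
      compl_subset_compl.2 (Metric.closedBall_subset_closedBall (le_max_right _ _))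
    -- The constant B + 1 serves both applications: the 5/3-integral of f n is at most B, and that
    -- of the constant 1 with respect to ν equals 1.
    obtain ⟨δ, E, hδ, hE, hle⟩ := exists_young_small (q := 5 / 2) (B := B + 1) (by positivity)
      (by positivity : 0 < ε / 2 / (M + 1))
    -- Approximating in L^(5/2) of the sum of the two measures produces one continuous function that
    -- is close for every f n and for the limit. The test function is first cut off to a ball, since
    -- a bounded function need not be in L^(5/2); tightness controls the remainder.
    let lam : Measure Phase := volume + (ν : Measure Phase)
    have : IsFiniteMeasureOnCompacts lam := ⟨fun K hK => by
      rw [Measure.add_apply]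
      exact ENNReal.add_lt_top.2 ⟨hK.measure_lt_top, measure_lt_top _ _⟩⟩
    have : IsLocallyFiniteMeasure lam := isLocallyFiniteMeasure_of_isFiniteMeasureOnCompacts
    have hgD : MemLp (D.indicator g) (ENNReal.ofReal (5 / 2)) lam := by
      have h1 : MemLp (D.indicator fun _ => G) (ENNReal.ofReal (5 / 2)) lam :=
        memLp_indicator_const _ hDm _ (Or.inr (isCompact_closedBall _ _).measure_lt_top.ne)
      refine h1.mono' (hg.indicator hDm).aestronglyMeasurable (ae_of_all _ fun p => ?_)
      by_cases hp : p ∈ D <;> simp [hp, hG p]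
    obtain ⟨h, hh, hhm⟩ := hgD.exists_boundedContinuous_integral_rpow_sub_le (by norm_num) hE
    have hum : MemLp (fun p => D.indicator g p - h p) (ENNReal.ofReal (5 / 2)) lam := hgD.sub hhm
    have hu := lintegral_rpow_abs_eq (by norm_num) hum
    have huE := hu.le.trans (ENNReal.ofReal_le_ofReal hh)
    have huv : ∫⁻ p, ENNReal.ofReal (|D.indicator g p - h p| ^ (5 / 2 : ℝ)) ≤ ENNReal.ofReal E :=
      (lintegral_mono' (Measure.le_add_right le_rfl) le_rfl).trans huE
    have huν : ∫⁻ p, ENNReal.ofReal (|D.indicator g p - h p| ^ (5 / 2 : ℝ)) ∂(ν : Measure Phase) ≤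
        ENNReal.ofReal E :=
      (lintegral_mono' (Measure.le_add_left le_rfl) le_rfl).trans huE
    have hgh : ∀ p, |g p - h p| ≤ G * Dᶜ.indicator 1 p + |D.indicator g p - h p| := by
      intro p
      by_cases hp : p ∈ D
      · simp [hp]
      · have hp' : p ∈ Dᶜ := hp
        rw [indicator_of_mem hp', indicator_of_notMem hp, zero_sub, abs_neg, Pi.one_apply, mul_one]
        exact (abs_sub _ _).trans (add_le_add_left (hG p) _)
    have hhb : ∃ C, ∀ p, |h p| ≤ C := ⟨‖h‖, fun p => h.norm_coe_le_norm p⟩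
    refine ⟨h, fun n => ?_, ?_⟩
    · have hi : ∀ u : Phase → ℝ, Measurable u → (∃ C, ∀ p, |u p| ≤ C) →
          Integrable (fun p => f n p * u p) := fun u hu ⟨C, hC⟩ =>
        (hf n).mul_bdd hu.aestronglyMeasurable (ae_of_all _ hC)
      rw [← integral_sub (hi g hg ⟨G, hG⟩) (hi h h.continuous.measurable hhb)]
      refine abs_integral_le_of_lintegral hε.le ?_
      have hfm := (hf n).aestronglyMeasurable.aemeasurable
      calc ∫⁻ p, ENNReal.ofReal |f n p * g p - f n p * h p|
          ≤ ∫⁻ p, (ENNReal.ofReal G * Dᶜ.indicator (fun p => ENNReal.ofReal |f n p|) p +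
              ENNReal.ofReal |f n p * (D.indicator g p - h p)|) := by
            refine lintegral_mono fun p => ?_
            rw [← mul_sub, abs_mul, abs_mul]
            have : Dᶜ.indicator (fun p => ENNReal.ofReal |f n p|) p =
                ENNReal.ofReal (|f n p| * Dᶜ.indicator 1 p) := by
              by_cases hp : p ∈ Dᶜ
              · rw [indicator_of_mem hp, indicator_of_mem hp, Pi.one_apply, mul_one]
              · rw [indicator_of_notMem hp, indicator_of_notMem hp, mul_zero, ENNReal.ofReal_zero]
            have h1 : 0 ≤ Dᶜ.indicator (1 : Phase → ℝ) p := indicator_nonneg (by simp) _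
            rw [this, ← ENNReal.ofReal_mul hG0, ← ENNReal.ofReal_add (by positivity) (by positivity)]
            apply ENNReal.ofReal_le_ofReal
            have := mul_le_mul_of_nonneg_left (hgh p) (abs_nonneg (f n p))
            linarith
        _ ≤ ENNReal.ofReal G * ENNReal.ofReal ε₁ + ENNReal.ofReal (ε / 2 / (M + 1)) := by
            rw [lintegral_add_left' (AEMeasurable.const_mul
              (AEMeasurable.indicator (by fun_prop) hDm.compl) _),
              lintegral_const_mul' _ _ ENNReal.ofReal_ne_top, lintegral_indicator hDm.compl]
            refine add_le_add (mul_le_mul_right ((lintegral_mono_set hD₁).trans (hR₁ n)) _) ?_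
            refine (lintegral_abs_mul_le holderConjugate_five_thirds hδ (by positivity) hE.le hfm
              ((hfB n).trans (ENNReal.ofReal_le_ofReal (by linarith))) huv).trans
              (ENNReal.ofReal_le_ofReal hle)
        _ ≤ ENNReal.ofReal ε := by
            rw [← ENNReal.ofReal_mul hG0, ← ENNReal.ofReal_add (by positivity) (by positivity)]
            apply ENNReal.ofReal_le_ofReal
            have e1 : G * ε₁ ≤ ε / 2 := by
              rw [hε₁, div_div, ← mul_div_assoc, div_le_iff₀ (by positivity)]
              nlinarith [mul_pos hε hM, mul_nonneg hG0 hM.le, mul_nonneg hε.le (mul_nonneg hG0 hM.le)]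
            have e2 : ε / 2 / (M + 1) ≤ ε / 2 := div_le_self (by positivity) (by linarith)
            linarith
    · have hi : ∀ u : Phase → ℝ, Measurable u → (∃ C, ∀ p, |u p| ≤ C) →
          Integrable u (ν : Measure Phase) := fun u hu ⟨C, hC⟩ =>
        Integrable.of_bound hu.aestronglyMeasurable C (ae_of_all _ hC)
      rw [hf₀int, hf₀int, ← mul_sub,
        ← integral_sub (hi g hg ⟨G, hG⟩) (hi h h.continuous.measurable hhb), abs_mul,
        abs_of_pos hM]
      have hbound : |∫ p, g p - h p ∂(ν : Measure Phase)| ≤ G * ε₁ + ε / 2 / (M + 1) := by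
        refine abs_integral_le_of_lintegral (by positivity) ?_
        calc ∫⁻ p, ENNReal.ofReal |g p - h p| ∂(ν : Measure Phase)
            ≤ ∫⁻ p, (ENNReal.ofReal G * Dᶜ.indicator 1 p +
                ENNReal.ofReal |1 * (D.indicator g p - h p)|) ∂(ν : Measure Phase) := by
              refine lintegral_mono fun p => ?_
              have : Dᶜ.indicator (1 : Phase → ℝ≥0∞) p =
                  ENNReal.ofReal (Dᶜ.indicator 1 p) := by
                by_cases hp : p ∈ Dᶜ
                · rw [indicator_of_mem hp, indicator_of_mem hp]; simp
                · rw [indicator_of_notMem hp, indicator_of_notMem hp, ENNReal.ofReal_zero]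
              have h1 : 0 ≤ Dᶜ.indicator (1 : Phase → ℝ) p := indicator_nonneg (by simp) _
              rw [this, ← ENNReal.ofReal_mul hG0,
                ← ENNReal.ofReal_add (by positivity) (by positivity), one_mul]
              exact ENNReal.ofReal_le_ofReal (hgh p)
          _ ≤ _ := by
              rw [lintegral_add_left ((measurable_one.indicator hDm.compl).const_mul _),
                lintegral_const_mul' _ _ ENNReal.ofReal_ne_top, lintegral_indicator_one hDm.compl,
                ENNReal.ofReal_add (by positivity) (by positivity), ENNReal.ofReal_mul hG0]
              refine add_le_add (mul_le_mul_right ((measure_mono hD₂).trans hR₂) _) ?_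
              refine (lintegral_abs_mul_le (f := fun _ => (1 : ℝ)) holderConjugate_five_thirds hδ
                (by positivity) hE.le (by fun_prop) (by simp [hB]) huν).trans
                (ENNReal.ofReal_le_ofReal hle)
      have e1 : M * (G * ε₁) ≤ ε / 2 := by
        rw [hε₁, div_div, ← mul_div_assoc, ← mul_div_assoc, div_le_iff₀ (by positivity)]
        nlinarith [mul_pos hε hM, mul_nonneg hG0 hM.le, mul_nonneg hε.le (mul_nonneg hG0 hM.le),
          mul_nonneg hε.le hG0]
      have e2 : M * (ε / 2 / (M + 1)) ≤ ε / 2 := by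
        rw [← mul_div_assoc, div_le_iff₀ (by positivity)]
        nlinarith
      have := mul_le_mul_of_nonneg_left hbound hM.le
      linarith
  rw [Metric.tendsto_atTop]
  intro ε hε
  obtain ⟨h, hn, h0⟩ := happrox (ε / 4) (by positivity)
  obtain ⟨N, hN⟩ := Metric.tendsto_atTop.1 (hcont h) (ε / 4) (by positivity)
  refine ⟨N, fun n hnN => ?_⟩
  have h1 := hN n hnN
  have h2 := hn (φ n)
  rw [Real.dist_eq] at h1 ⊢
  rw [abs_lt] at h1 ⊢
  rw [abs_le] at h2 h0
  constructor <;> linarith [h1.1, h1.2, h2.1, h2.2, h0.1, h0.2]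

end Compactness

end VlasovPoisson

namespace VlasovPoisson

variable {Q : ℝ → ℝ → ℝ} {k : ℝ}

/-! ### Lower semicontinuity of the free energy and symmetry of the limit. -/

section LowerSemicontinuity

/-- The density of the free energy. -/
noncomputable def freeIntegrand (Q : ℝ → ℝ → ℝ) (s : ℝ) (p : Phase) : ℝ :=
  Q s (angMom p) + 1 / 2 * (‖p.2‖ ^ 2 * s)

lemma freeIntegrand_nonneg (hQ : CasimirAssumptions Q k) {s : ℝ} (hs : 0 ≤ s) (p : Phase) :
    0 ≤ freeIntegrand Q s p :=
  add_nonneg (hQ.nonneg _ _ hs) (by positivity)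

lemma freeEnergy_eq_lintegral (hQ : CasimirAssumptions Q k) {f : Phase → ℝ} (hf : AEMeasurable f)
    (h0 : ∀ᵐ p, 0 ≤ f p) :
    freeEnergy Q f = ∫⁻ p, ENNReal.ofReal (freeIntegrand Q (f p) p) := by
  have hm := hQ.aemeasurable hf h0
  rw [freeEnergy, casimir, kineticEnergy, ← lintegral_const_mul' _ _ (by simp),
    ← lintegral_add_left' hm.ennreal_ofReal]
  refine lintegral_congr_ae (h0.mono fun p hp => ?_)
  simp only [freeIntegrand]
  rw [ENNReal.ofReal_add (hQ.nonneg _ _ hp) (by positivity), ENNReal.ofReal_mul (p := 1 / 2) (by norm_num),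
    ENNReal.ofReal_div_of_pos two_pos]
  simp

lemma integrable_freeIntegrand (hQ : CasimirAssumptions Q k) {f : Phase → ℝ} {M : ℝ}
    (hf : f ∈ admissible Q M) : Integrable (fun p => freeIntegrand Q (f p) p) := by
  have hm := hf.1.aestronglyMeasurable.aemeasurable
  have hm' := hQ.aemeasurable hm hf.2.1
  have hv : AEMeasurable fun p : Phase => 1 / 2 * (‖p.2‖ ^ 2 * f p) := by fun_prop
  refine ⟨(hm'.add hv).aestronglyMeasurable, ?_⟩
  rw [hasFiniteIntegral_iff_ofReal (hf.2.1.mono fun p hp => freeIntegrand_nonneg hQ hp p),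
    ← freeEnergy_eq_lintegral hQ hm hf.2.1]
  exact hf.2.2.2

lemma integral_freeIntegrand (hQ : CasimirAssumptions Q k) {f : Phase → ℝ} {M : ℝ}
    (hf : f ∈ admissible Q M) :
    ∫ p, freeIntegrand Q (f p) p = (freeEnergy Q f).toReal := by
  rw [freeEnergy_eq_lintegral hQ hf.1.aestronglyMeasurable.aemeasurable hf.2.1,
    integral_eq_lintegral_of_nonneg_ae (hf.2.1.mono fun p hp => freeIntegrand_nonneg hQ hp p)
      (integrable_freeIntegrand hQ hf).aestronglyMeasurable]

lemma exists_bound_on_ball {F : ℝ × ℝ → ℝ} (hF : Continuous F) (N : ℝ) :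
    ∃ C : ℝ, ∀ s p, 0 ≤ s → s ≤ N → p ∈ Metric.closedBall (0 : Phase) N → |F (s, angMom p)| ≤ C := by
  have hK : IsCompact (Icc (0 : ℝ) N ×ˢ (angMom '' Metric.closedBall (0 : Phase) N)) :=
    isCompact_Icc.prod ((isCompact_closedBall _ _).image continuous_angMom)
  obtain ⟨C, hC⟩ := hK.exists_bound_of_continuousOn hF.continuousOn
  exact ⟨C, fun s p h0 h1 hp => hC _ (mk_mem_prod ⟨h0, h1⟩ (mem_image_of_mem _ hp))⟩

/-- Weak lower semicontinuity of the free energy. -/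
lemma freeEnergy_le_of_weak_limit (hQ : CasimirAssumptions Q k) {M : ℝ} {f : ℕ → Phase → ℝ}
    {f₀ : Phase → ℝ} (hf : ∀ n, f n ∈ admissible Q M) (hm : Measurable f₀) (hi : Integrable f₀)
    (h0 : ∀ p, 0 ≤ f₀ p)
    (hlim : ∀ g : Phase → ℝ, Measurable g → (∃ G, ∀ p, |g p| ≤ G) →
        Tendsto (fun n => ∫ p, f n p * g p) atTop (𝓝 (∫ p, f₀ p * g p)))
    {c : ℝ} (hc : ∃ᶠ n in atTop, (freeEnergy Q (f n)).toReal ≤ c) :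
    freeEnergy Q f₀ ≤ ENNReal.ofReal c := by
  rw [freeEnergy_eq_lintegral hQ hm.aemeasurable (ae_of_all _ h0)]
  -- On E N both the point and f₀ are bounded, so the slope w of the tangent to the integrand at f₀
  -- is a legitimate bounded test function. Monotone convergence over N then recovers the whole free
  -- energy.
  set E : ℕ → Set Phase := fun N => Metric.closedBall 0 (N : ℝ) ∩ {p | f₀ p ≤ N} with hE
  have hEm : ∀ N, MeasurableSet (E N) := fun N =>
    measurableSet_closedBall.inter (measurableSet_le hm measurable_const)
  have hmono : Monotone E := by
    intro a b hab p hp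
    have : (a : ℝ) ≤ b := by exact_mod_cast hab
    exact ⟨Metric.closedBall_subset_closedBall this hp.1, le_trans (show f₀ p ≤ a from hp.2) this⟩
  have hU : ⋃ N, E N = univ := by
    refine eq_univ_of_forall fun p => mem_iUnion.2 ?_
    obtain ⟨N, hN⟩ := exists_nat_ge (max ‖p‖ (f₀ p))
    exact ⟨N, mem_closedBall_zero_iff.2 ((le_max_left _ _).trans hN), (le_max_right _ _).trans hN⟩
  rw [← setLIntegral_univ, ← hU, setLIntegral_iUnion_of_directed _ hmono.directed_le]
  refine iSup_le fun N => ?_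
  obtain ⟨C₁, hC₁⟩ := exists_bound_on_ball hQ.continuous_partial_max N
  obtain ⟨C₂, hC₂⟩ := exists_bound_on_ball hQ.continuous_max N
  set w : Phase → ℝ := (E N).indicator
    (fun p => partialF Q (max (f₀ p) 0) (angMom p) + 1 / 2 * ‖p.2‖ ^ 2) with hw
  have hv : ∀ p ∈ E N, ‖p.2‖ ≤ N := fun p hp =>
    (norm_snd_le p).trans (mem_closedBall_zero_iff.1 hp.1)
  have hwm : Measurable w := by
    refine Measurable.indicator ?_ (hEm N)
    have h1 : Measurable (fun p : Phase => (f₀ p, angMom p)) :=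
      hm.prodMk continuous_angMom.measurable
    have h2 := hQ.continuous_partial_max.measurable.comp h1
    exact h2.add (by fun_prop)
  have hwb : ∀ p, |w p| ≤ |C₁| + 1 / 2 * (N : ℝ) ^ 2 := by
    intro p
    by_cases hp : p ∈ E N
    · rw [hw, indicator_of_mem hp]
      refine (abs_add_le _ _).trans (add_le_add ?_ ?_)
      · exact (hC₁ (f₀ p) p (h0 p) hp.2 hp.1).trans (le_abs_self _)
      · rw [abs_of_nonneg (by positivity)]
        have := hv p hp
        gcongr
    · rw [hw, indicator_of_notMem hp, abs_zero]
      positivity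
  have hΨ : Integrable ((E N).indicator fun p => freeIntegrand Q (f₀ p) p) := by
    have hfin : volume (E N) ≠ ⊤ :=
      ((measure_mono inter_subset_left).trans_lt measure_closedBall_lt_top).ne
    rw [integrable_indicator_iff (hEm N)]
    refine Measure.integrableOn_of_bounded (M := |C₂| + 1 / 2 * ((N : ℝ) ^ 2 * N)) hfin ?_ ?_
    · have := hQ.aemeasurable hm.aemeasurable (ae_of_all _ h0)
      have hv : AEMeasurable fun p : Phase => 1 / 2 * (‖p.2‖ ^ 2 * f₀ p) := by fun_prop
      exact (this.add hv).aestronglyMeasurable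
    · refine ae_restrict_of_forall_mem (hEm N) fun p hp => ?_
      rw [freeIntegrand, Real.norm_eq_abs]
      refine (abs_add_le _ _).trans (add_le_add ?_ ?_)
      · have := hC₂ (f₀ p) p (h0 p) hp.2 hp.1
        simp only [max_eq_left (h0 p)] at this
        exact this.trans (le_abs_self _)
      · have h1 := h0 p
        have h2 : f₀ p ≤ N := hp.2
        rw [abs_of_nonneg (by positivity)]
        have := hv p hp
        gcongr
  -- The tangent inequality inside E N and nonnegativity of the integrand outside; the bracket tends
  -- to zero by weak convergence.
  have hkey : ∀ n, (∫ p, (E N).indicator (fun p => freeIntegrand Q (f₀ p) p) p) +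
      ((∫ p, f n p * w p) - ∫ p, f₀ p * w p) ≤ (freeEnergy Q (f n)).toReal := by
    intro n
    have hi1 : Integrable (fun p => f n p * w p) :=
      (hf n).1.mul_bdd hwm.aestronglyMeasurable (ae_of_all _ hwb)
    have hi2 : Integrable (fun p => f₀ p * w p) :=
      hi.mul_bdd hwm.aestronglyMeasurable (ae_of_all _ hwb)
    have hi3 : Integrable (fun p => f n p * w p - f₀ p * w p) := hi1.sub hi2
    rw [← integral_sub hi1 hi2, ← integral_add hΨ hi3, ← integral_freeIntegrand hQ (hf n)]
    refine integral_mono_ae (hΨ.add hi3) (integrable_freeIntegrand hQ (hf n)) ?_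
    filter_upwards [(hf n).2.1] with p hp
    by_cases hpE : p ∈ E N
    · simp only [hw, indicator_of_mem hpE, freeIntegrand, max_eq_left (h0 p)]
      have := hQ.tangent_le hp (h0 p) (angMom p)
      linarith
    · simp only [hw, indicator_of_notMem hpE, mul_zero, sub_zero, add_zero]
      exact freeIntegrand_nonneg hQ hp p
  have hle : ∫ p, (E N).indicator (fun p => freeIntegrand Q (f₀ p) p) p ≤ c := by
    by_contra! hcon
    have ht : Tendsto (fun n => (∫ p, (E N).indicator (fun p => freeIntegrand Q (f₀ p) p) p) +
        ((∫ p, f n p * w p) - ∫ p, f₀ p * w p)) atTop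
        (𝓝 ((∫ p, (E N).indicator (fun p => freeIntegrand Q (f₀ p) p) p) + 0)) := by
      refine Tendsto.const_add _ ?_
      have := (hlim w hwm ⟨_, hwb⟩).sub_const (∫ p, f₀ p * w p)
      rwa [sub_self] at this
    rw [add_zero] at ht
    obtain ⟨n, hn1, hn2⟩ := (hc.and_eventually (ht.eventually_const_lt hcon)).exists
    linarith [hkey n]
  rw [← lintegral_indicator (hEm N)]
  have heq : ∫⁻ p, (E N).indicator (fun p => ENNReal.ofReal (freeIntegrand Q (f₀ p) p)) p =
      ENNReal.ofReal (∫ p, (E N).indicator (fun p => freeIntegrand Q (f₀ p) p) p) := by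
    rw [ofReal_integral_eq_lintegral_ofReal hΨ (ae_of_all _ fun p =>
      indicator_nonneg (fun p _ => freeIntegrand_nonneg hQ (h0 p) p) p)]
    congr 1 with p
    by_cases hp : p ∈ E N <;> simp [hp]
  rw [heq]
  exact ENNReal.ofReal_le_ofReal hle

/-- The weak limit inherits the axial symmetry. -/
lemma symmetric_of_weak_limit {M : ℝ} {f : ℕ → Phase → ℝ}
    {f₀ : Phase → ℝ} (hf : ∀ n, f n ∈ admissibleS Q M) (hi : Integrable f₀)
    (hlim : ∀ g : Phase → ℝ, Measurable g → (∃ G, ∀ p, |g p| ≤ G) →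
        Tendsto (fun n => ∫ p, f n p * g p) atTop (𝓝 (∫ p, f₀ p * g p))) (θ : ℝ) :
    ∀ᵐ p : Phase, f₀ (rot θ p.1, rot θ p.2) = f₀ p := by
  have hset : ∀ s : Set Phase, MeasurableSet s →
      Tendsto (fun n => ∫ p in s, f n p) atTop (𝓝 (∫ p in s, f₀ p)) := by
    intro s hs
    have h1 := hlim (s.indicator 1) (measurable_one.indicator hs) ⟨1, fun p => by
      by_cases hp : p ∈ s <;> simp [hp]⟩
    have h2 : ∀ u : Phase → ℝ, ∫ p, u p * s.indicator 1 p = ∫ p in s, u p := by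
      intro u
      rw [← integral_indicator hs]
      congr 1 with p
      by_cases hp : p ∈ s <;> simp [hp]
    simpa only [h2] using h1
  have hmp := measurePreserving_rotPhase θ
  have hemb := measurableEmbedding_rotPhase θ
  have hcomp : Integrable (fun p => f₀ (rotPhase θ p)) := hmp.integrable_comp_of_integrable hi
  -- For each f n the integrals over s and over its rotated image E agree, and both pass to the
  -- limit.
  refine Integrable.ae_eq_of_forall_setIntegral_eq _ _ hcomp hi fun s hs _ => ?_
  set E := rotPhase (-θ) ⁻¹' s with hE
  have hEm : MeasurableSet E := (measurePreserving_rotPhase (-θ)).measurable hs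
  have hsE : rotPhase θ ⁻¹' E = s := by
    ext p
    have : rotPhase (-θ) (rotPhase θ p) = p :=
      Prod.ext ((rotEquiv θ).left_inv p.1) ((rotEquiv θ).left_inv p.2)
    rw [hE, mem_preimage, mem_preimage, this]
  have h1 : ∀ u : Phase → ℝ, ∫ p in s, u (rotPhase θ p) = ∫ p in E, u p := by
    intro u
    rw [← hmp.setIntegral_preimage_emb hemb u E, hsE]
  change ∫ p in s, f₀ (rotPhase θ p) = _
  rw [h1]
  refine tendsto_nhds_unique (hset E hEm) ((hset s hs).congr fun n => ?_)
  rw [← h1]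
  exact (integral_congr_ae (ae_restrict_of_ae ((hf n).2 θ))).symm

end LowerSemicontinuity

/-! ### Uniform integral bounds, weak convergence in L^(1+1/k), and tightness. -/

section Bounds

lemma exists_fiveThirds_le (hQ : CasimirAssumptions Q k) (M S : ℝ) :
    ∃ B : ℝ, 0 ≤ B ∧ ∀ f ∈ admissible Q M, (freeEnergy Q f).toReal ≤ S →
      fiveThirds f ≤ ENNReal.ofReal B := by
  obtain ⟨L, hL, h⟩ := hQ.five_thirds_le one_pos
  refine ⟨|L * M + S|, abs_nonneg _, fun f hf hS => ?_⟩
  refine (lintegral_le_of_pointwise hQ hf.1 hf.2.1 hL.le zero_le_one h).trans ?_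
  have hM : 0 ≤ M := hf.2.2.1 ▸ integral_nonneg_of_ae hf.2.1
  have hC := (ENNReal.add_lt_top.1 hf.2.2.2).1.ne
  rw [hf.2.2.1, ENNReal.ofReal_one, one_mul, ← ENNReal.ofReal_toReal hC,
    ← ENNReal.ofReal_add (by positivity) ENNReal.toReal_nonneg]
  apply ENNReal.ofReal_le_ofReal
  rw [toReal_freeEnergy hf] at hS
  have : 0 ≤ (kineticEnergy f).toReal := ENNReal.toReal_nonneg
  exact (by linarith : _ ≤ L * M + S).trans (le_abs_self _)

lemma exists_rpow_le (hQ : CasimirAssumptions Q k) (M S : ℝ) :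
    ∃ B : ℝ, 0 ≤ B ∧ ∀ f ∈ admissible Q M, (freeEnergy Q f).toReal ≤ S →
      ∫⁻ p, ENNReal.ofReal (|f p| ^ (1 + 1 / k)) ≤ ENNReal.ofReal B := by
  obtain ⟨a, b, ha, hb, h⟩ := hQ.rpow_le
  refine ⟨|a * M + b * S|, abs_nonneg _, fun f hf hS => ?_⟩
  refine (lintegral_le_of_pointwise hQ hf.1 hf.2.1 (Φ := fun s => s ^ (1 + 1 / k)) ha.le hb.le h).trans ?_
  have hM : 0 ≤ M := hf.2.2.1 ▸ integral_nonneg_of_ae hf.2.1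
  have hC := (ENNReal.add_lt_top.1 hf.2.2.2).1.ne
  rw [hf.2.2.1, ← ENNReal.ofReal_toReal hC, ← ENNReal.ofReal_mul hb.le,
    ← ENNReal.ofReal_add (by positivity) (by positivity)]
  apply ENNReal.ofReal_le_ofReal
  rw [toReal_freeEnergy hf] at hS
  have h1 : 0 ≤ (kineticEnergy f).toReal := ENNReal.toReal_nonneg
  have h2 : b * (casimir Q f).toReal ≤ b * S := by gcongr; linarith
  exact (by linarith : _ ≤ a * M + b * S).trans (le_abs_self _)

lemma memLp_of_lintegral_rpow {f : Phase → ℝ} (hf : AEStronglyMeasurable f) {p : ℝ} (hp : 0 < p)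
    (h : ∫⁻ x, ENNReal.ofReal (|f x| ^ p) < ⊤) : MemLp f (ENNReal.ofReal p) := by
  refine ⟨hf, ?_⟩
  rw [eLpNorm_lt_top_iff_lintegral_rpow_enorm_lt_top (by simpa using hp) ENNReal.ofReal_ne_top,
    ENNReal.toReal_ofReal hp.le]
  convert h using 3 with x
  rw [Real.enorm_eq_ofReal_abs, ENNReal.ofReal_rpow_of_nonneg (abs_nonneg _) hp.le]

lemma memLp_admissible (hQ : CasimirAssumptions Q k) {M : ℝ} {f : Phase → ℝ}
    (hf : f ∈ admissible Q M) : MemLp f (ENNReal.ofReal (1 + 1 / k)) := by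
  obtain ⟨B, -, hB⟩ := exists_rpow_le hQ M (freeEnergy Q f).toReal
  have := hQ.k_pos
  exact memLp_of_lintegral_rpow hf.1.aestronglyMeasurable (by positivity)
    ((hB f hf le_rfl).trans_lt ENNReal.ofReal_lt_top)

/-- Weak convergence in `L^{1 + 1/k}` follows from convergence tested with bounded functions. -/
lemma weakTendstoLp_of_bounded (hQ : CasimirAssumptions Q k) {M S : ℝ} {f : ℕ → Phase → ℝ}
    {f₀ : Phase → ℝ} (hf : ∀ n, f n ∈ admissible Q M) (hS : ∀ n, (freeEnergy Q (f n)).toReal ≤ S)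
    (hf₀ : f₀ ∈ admissible Q M) (hS₀ : (freeEnergy Q f₀).toReal ≤ S)
    (hlim : ∀ g : Phase → ℝ, Measurable g → (∃ G, ∀ p, |g p| ≤ G) →
        Tendsto (fun n => ∫ p, f n p * g p) atTop (𝓝 (∫ p, f₀ p * g p))) :
    WeakTendstoLp (1 + 1 / k) f f₀ := by
  refine ⟨fun n => memLp_admissible hQ (hf n), memLp_admissible hQ hf₀, fun g hg => ?_⟩
  have hk := hQ.k_pos
  have hpq : (1 + 1 / k).HolderConjugate (Real.conjExponent (1 + 1 / k)) :=
    Real.HolderConjugate.conjExponent (by simpa using hk)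
  set q := Real.conjExponent (1 + 1 / k) with hq
  have hpq' : ENNReal.HolderConjugate (ENNReal.ofReal (1 + 1 / k)) (ENNReal.ofReal q) :=
    ⟨by rw [hpq.inv_add_inv_ennreal, inv_one]⟩
  obtain ⟨B, hB, hBf⟩ := exists_rpow_le hQ M S
  -- Bounded continuous functions are dense in the dual space, and the error is uniform over all
  -- densities with the same mass and free energy bound.
  have happrox : ∀ ε : ℝ, 0 < ε → ∃ h : BoundedContinuousFunction Phase ℝ,
      ∀ u ∈ admissible Q M, (freeEnergy Q u).toReal ≤ S →
        |(∫ p, u p * g p) - ∫ p, u p * h p| ≤ ε := by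
    intro ε hε
    obtain ⟨δ, E, hδ, hE, hle⟩ := exists_young_small (q := q) hB hε
    obtain ⟨h, hh, hhm⟩ := hg.exists_boundedContinuous_integral_rpow_sub_le hpq.symm.pos hE
    refine ⟨h, fun u hu huS => ?_⟩
    have hi : ∀ w : Phase → ℝ, MemLp w (ENNReal.ofReal q) → Integrable (fun p => u p * w p) :=
      fun w hw => MemLp.integrable_mul (memLp_admissible hQ hu) hw
    rw [← integral_sub (hi g hg) (hi h hhm)]
    refine abs_integral_le_of_lintegral hε.le ?_
    simp only [← mul_sub]
    refine (lintegral_abs_mul_le hpq hδ hB hE.le hu.1.aestronglyMeasurable.aemeasurable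
      (hBf u hu huS) ?_).trans (ENNReal.ofReal_le_ofReal hle)
    have hum : MemLp (fun p => g p - h p) (ENNReal.ofReal q) := hg.sub hhm
    exact (lintegral_rpow_abs_eq hpq.symm.pos hum).le.trans (ENNReal.ofReal_le_ofReal hh)
  rw [Metric.tendsto_atTop]
  intro ε hε
  obtain ⟨h, hn⟩ := happrox (ε / 4) (by positivity)
  obtain ⟨N, hN⟩ := Metric.tendsto_atTop.1 (hlim h h.continuous.measurable
    ⟨‖h‖, fun p => h.norm_coe_le_norm p⟩) (ε / 4) (by positivity)
  refine ⟨N, fun n hnN => ?_⟩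
  have h1 := hN n hnN
  have h2 := hn (f n) (hf n) (hS n)
  have h3 := hn f₀ hf₀ hS₀
  rw [Real.dist_eq] at h1 ⊢
  rw [abs_lt] at h1 ⊢
  rw [abs_le] at h2 h3
  constructor <;> linarith [h1.1, h1.2, h2.1, h2.2, h3.1, h3.2]

/-- Concentration in space and bounded kinetic energy imply tightness in phase space. -/
lemma exists_tight {M S : ℝ} {f : ℕ → Phase → ℝ}
    (hf : ∀ n, f n ∈ admissible Q M) (hS : ∀ n, (freeEnergy Q (f n)).toReal ≤ S)
    (hconc : ∀ ε : ℝ, 0 < ε → ∃ R : ℝ, 0 < R ∧ ∀ n, M - ε ≤ massIn (f n) 0 R) {ε : ℝ}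
    (hε : 0 < ε) :
    ∃ R : ℝ, ∀ n, ∫⁻ p in (Metric.closedBall 0 R)ᶜ, ENNReal.ofReal |f n p| ≤ ENNReal.ofReal ε := by
  obtain ⟨R₁, hR₁, h1⟩ := hconc (ε / 2) (by positivity)
  -- Chebyshev's inequality: the mass at speeds above R₂ is at most twice the kinetic energy divided
  -- by R₂². The summand 1 keeps R₂ positive when S = 0.
  set R₂ := √(2 * |S| / (ε / 2)) + 1 with hR₂
  have hR₂0 : 0 < R₂ := by positivity
  have hR₂S : 2 * |S| ≤ ε / 2 * R₂ ^ 2 := by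
    have h3 : √(2 * |S| / (ε / 2)) ^ 2 = 2 * |S| / (ε / 2) := Real.sq_sqrt (by positivity)
    have h4 : 2 * |S| / (ε / 2) ≤ R₂ ^ 2 := by
      rw [← h3, hR₂]
      gcongr
      linarith
    rw [div_le_iff₀ (by positivity)] at h4
    linarith
  refine ⟨max R₁ R₂, fun n => ?_⟩
  have hm := (hf n).1.aestronglyMeasurable.aemeasurable
  have hB : MeasurableSet (Metric.closedBall (0 : Space) R₁ ×ˢ (univ : Set Space)) :=
    measurableSet_closedBall.prod MeasurableSet.univ
  have hV : MeasurableSet {p : Phase | R₂ < ‖p.2‖} := measurableSet_lt measurable_const (by fun_prop)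
  have hsub : (Metric.closedBall (0 : Phase) (max R₁ R₂))ᶜ ⊆
      (Metric.closedBall (0 : Space) R₁ ×ˢ (univ : Set Space))ᶜ ∪ {p : Phase | R₂ < ‖p.2‖} := by
    intro p hp
    rw [mem_compl_iff, mem_closedBall_zero_iff, not_le, Prod.norm_def] at hp
    by_contra hcon
    rw [mem_union, not_or] at hcon
    have h3 : ‖p.1‖ ≤ R₁ := by
      by_contra h
      exact hcon.1 (fun h' => h (mem_closedBall_zero_iff.1 h'.1))
    have h4 : ‖p.2‖ ≤ R₂ := not_lt.1 hcon.2
    exact (max_le_max h3 h4).not_gt hp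
  refine (lintegral_mono_set hsub).trans ((lintegral_union_le _ _ _).trans ?_)
  have e1 : ∫⁻ p in (Metric.closedBall (0 : Space) R₁ ×ˢ (univ : Set Space))ᶜ,
      ENNReal.ofReal |f n p| ≤ ENNReal.ofReal (ε / 2) := by
    have h3 := massIn_add_compl (hf n).1 0 R₁
    rw [(hf n).2.2.1, ← compl_prod_univ] at h3
    have h4 : ∫⁻ p in (Metric.closedBall (0 : Space) R₁ ×ˢ (univ : Set Space))ᶜ,
        ENNReal.ofReal |f n p| = ENNReal.ofReal
          (∫ p in (Metric.closedBall (0 : Space) R₁ ×ˢ (univ : Set Space))ᶜ, f n p) := by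
      rw [ofReal_integral_eq_lintegral_ofReal (hf n).1.integrableOn (ae_restrict_of_ae (hf n).2.1)]
      refine lintegral_congr_ae (ae_restrict_of_ae ((hf n).2.1.mono fun p hp => ?_))
      simp only [abs_of_nonneg hp]
    rw [h4]
    apply ENNReal.ofReal_le_ofReal
    linarith [h1 n]
  have e2 : ∫⁻ p in {p : Phase | R₂ < ‖p.2‖}, ENNReal.ofReal |f n p| ≤ ENNReal.ofReal (ε / 2) := by
    calc ∫⁻ p in {p : Phase | R₂ < ‖p.2‖}, ENNReal.ofReal |f n p|
        ≤ ∫⁻ p, ENNReal.ofReal (R₂ ^ 2)⁻¹ * ENNReal.ofReal (‖p.2‖ ^ 2 * |f n p|) := by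
          rw [← lintegral_indicator hV]
          refine lintegral_mono fun p => ?_
          by_cases hp : p ∈ {p : Phase | R₂ < ‖p.2‖}
          · have hp' : R₂ < ‖p.2‖ := hp
            rw [indicator_of_mem hp, ← ENNReal.ofReal_mul (by positivity)]
            apply ENNReal.ofReal_le_ofReal
            rw [inv_mul_eq_div, le_div_iff₀ (by positivity), mul_comm]
            gcongr
          · simp [indicator_of_notMem hp]
      _ = ENNReal.ofReal (R₂ ^ 2)⁻¹ * (2 * kineticEnergy (f n)) := by
          rw [lintegral_const_mul' _ _ ENNReal.ofReal_ne_top, ← two_mul_kineticEnergy (hf n).2.1]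
          rfl
      _ ≤ ENNReal.ofReal (ε / 2) := by
          have hK := (ENNReal.add_lt_top.1 (hf n).2.2.2).2.ne
          rw [← ENNReal.ofReal_toReal hK, show (2 : ℝ≥0∞) = ENNReal.ofReal 2 by simp,
            ← ENNReal.ofReal_mul (by positivity), ← ENNReal.ofReal_mul (by positivity)]
          apply ENNReal.ofReal_le_ofReal
          rw [inv_mul_le_iff₀ (by positivity)]
          have h3 := hS n
          rw [toReal_freeEnergy (hf n)] at h3
          have h4 : 0 ≤ (casimir Q (f n)).toReal := ENNReal.toReal_nonneg
          linarith [le_abs_self S]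
  refine (add_le_add e1 e2).trans (le_of_eq ?_)
  rw [← ENNReal.ofReal_add (by positivity) (by positivity), add_halves]

end Bounds

end VlasovPoisson

namespace VlasovPoisson

/-! ### Bilinear forms with kernels of Coulomb size. -/

section Bilinear

lemma holderConjugate_four_thirds : (4 / 3 : ℝ).HolderConjugate 4 := by
  rw [Real.holderConjugate_iff]; norm_num

/-- Tight densities paired with functions which are bounded and converge pointwise to zero. -/
lemma tendsto_integral_mul_zero {β g : ℕ → Space → ℝ} {m A G : ℝ} (hA : 0 ≤ A) (hG : 0 ≤ G)
    (hβ : ∀ n, DensityBound (β n) m A)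
    (htight : ∀ ε : ℝ, 0 < ε → ∃ R : ℝ, ∀ n,
      ∫⁻ y in (Metric.closedBall 0 R)ᶜ, ENNReal.ofReal |β n y| ≤ ENNReal.ofReal ε)
    (hgm : ∀ n, AEStronglyMeasurable (g n)) (hgG : ∀ n y, |g n y| ≤ G)
    (hg : ∀ y, Tendsto (fun n => g n y) atTop (𝓝 0)) :
    Tendsto (fun n => ∫ y, β n y * g n y) atTop (𝓝 0) := by
  rw [Metric.tendsto_nhds]
  intro ε hε
  obtain ⟨R, hR⟩ := htight (ε / 4 / (G + 1)) (by positivity)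
  obtain ⟨δ, E, hδ, hE, hle⟩ := exists_young_small (q := 4) hA (by positivity : 0 < ε / 4)
  set B := Metric.closedBall (0 : Space) R with hB
  have hfin : volume B ≠ ⊤ := measure_closedBall_lt_top.ne
  -- Inside the ball, dominated convergence gives smallness in L⁴, dual to the 4/3 bound on the
  -- densities; outside, tightness is used.
  have hdom : Tendsto (fun n => ∫⁻ y in B, ENNReal.ofReal (|g n y| ^ (4 : ℝ))) atTop
      (𝓝 (∫⁻ _ in B, 0)) := by
    refine tendsto_lintegral_of_dominated_convergence' (fun _ => ENNReal.ofReal (G ^ (4 : ℝ)))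
      (fun n => ?_) (fun n => ae_of_all _ fun y => ?_) ?_ (ae_of_all _ fun y => ?_)
    · have := (hgm n).aemeasurable.restrict (s := B)
      fun_prop
    · exact ENNReal.ofReal_le_ofReal (Real.rpow_le_rpow (abs_nonneg _) (hgG n y) (by norm_num))
    · rw [lintegral_const]
      exact ENNReal.mul_ne_top ENNReal.ofReal_ne_top (by rwa [Measure.restrict_apply_univ])
    · have h1 : Tendsto (fun n => |g n y| ^ (4 : ℝ)) atTop (𝓝 (|0| ^ (4 : ℝ))) :=
        ((hg y).abs).rpow_const (Or.inr (by norm_num))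
      have := ENNReal.tendsto_ofReal h1
      simpa using this
  rw [lintegral_zero] at hdom
  filter_upwards [hdom.eventually_le_const (ENNReal.ofReal_pos.2 hE)] with n hn
  rw [dist_zero_right, Real.norm_eq_abs]
  refine lt_of_le_of_lt (abs_integral_le_of_lintegral (c := ε / 2) (by positivity) ?_) (by linarith)
  rw [← lintegral_add_compl _ (measurableSet_closedBall : MeasurableSet B)]
  have e1 : ∫⁻ y in B, ENNReal.ofReal |β n y * g n y| ≤ ENNReal.ofReal (ε / 4) := by
    refine (lintegral_abs_mul_le holderConjugate_four_thirds hδ hA hE.le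
      (hβ n).aemeasurable.restrict ((setLIntegral_le_lintegral _ _).trans (hβ n).power) hn).trans ?_
    exact ENNReal.ofReal_le_ofReal hle
  have e2 : ∫⁻ y in Bᶜ, ENNReal.ofReal |β n y * g n y| ≤ ENNReal.ofReal (ε / 4) := by
    calc ∫⁻ y in Bᶜ, ENNReal.ofReal |β n y * g n y|
        ≤ ∫⁻ y in Bᶜ, ENNReal.ofReal G * ENNReal.ofReal |β n y| := by
          refine lintegral_mono fun y => ?_
          rw [← ENNReal.ofReal_mul hG, abs_mul, mul_comm]
          exact ENNReal.ofReal_le_ofReal (mul_le_mul_of_nonneg_right (hgG n y) (abs_nonneg _))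
      _ ≤ ENNReal.ofReal G * ENNReal.ofReal (ε / 4 / (G + 1)) := by
          rw [lintegral_const_mul' _ _ ENNReal.ofReal_ne_top]
          gcongr
          exact hR n
      _ ≤ ENNReal.ofReal (ε / 4) := by
          rw [← ENNReal.ofReal_mul hG]
          apply ENNReal.ofReal_le_ofReal
          rw [mul_div_assoc', div_le_iff₀ (by positivity)]
          nlinarith
  refine (add_le_add e1 e2).trans (le_of_eq ?_)
  rw [← ENNReal.ofReal_add (by positivity) (by positivity)]
  ring_nf

lemma DensityBound.integrable_mul_kernel {α β : Space → ℝ} {m A c : ℝ} (hα : DensityBound α m A)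
    (hβ : DensityBound β m A) {K : Space × Space → ℝ} (hKm : Measurable K)
    (hK : ∀ z, |K z| ≤ c / ‖z.1 - z.2‖) :
    Integrable fun z : Space × Space => α z.1 * β z.2 * K z := by
  have h := (hα.integrable_coulomb hβ).const_mul c
  have h1 : AEMeasurable fun z : Space × Space => α z.1 :=
    hα.aemeasurable.comp_quasiMeasurePreserving Measure.quasiMeasurePreserving_fst
  have h2 : AEMeasurable fun z : Space × Space => β z.2 :=
    hβ.aemeasurable.comp_quasiMeasurePreserving Measure.quasiMeasurePreserving_snd
  refine h.mono (((h1.mul h2).mul hKm.aemeasurable).aestronglyMeasurable) (ae_of_all _ fun z => ?_)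
  rw [Real.norm_eq_abs, Real.norm_eq_abs, abs_mul, abs_mul c, abs_div, abs_norm, mul_div_assoc',
    mul_comm |c|, ← mul_div_assoc']
  gcongr
  refine (hK z).trans ?_
  gcongr
  exact le_abs_self c

/-- Weak convergence to zero of one factor makes bilinear expressions with a kernel dominated by
the Coulomb kernel tend to zero. -/
lemma tendsto_bilinear {α β : ℕ → Space → ℝ} {m A c : ℝ} (hm : 0 ≤ m) (hA : 0 ≤ A) (hc : 0 ≤ c)
    (hα : ∀ n, DensityBound (α n) m A) (hβ : ∀ n, DensityBound (β n) m A)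
    (hlim : ∀ g : Space → ℝ, Measurable g → (∃ G, ∀ x, |g x| ≤ G) →
      Tendsto (fun n => ∫ x, α n x * g x) atTop (𝓝 0))
    (htight : ∀ ε : ℝ, 0 < ε → ∃ R : ℝ, ∀ n,
      ∫⁻ y in (Metric.closedBall 0 R)ᶜ, ENNReal.ofReal |β n y| ≤ ENNReal.ofReal ε)
    {K : Space × Space → ℝ} (hKm : Measurable K) (hK : ∀ z, |K z| ≤ c / ‖z.1 - z.2‖) :
    Tendsto (fun n => ∫ z : Space × Space, α n z.1 * β n z.2 * K z) atTop (𝓝 0) := by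
  have hκ := sphereArea_pos
  rw [Metric.tendsto_nhds]
  intro ε hε
  have ht : Tendsto (fun t : ℝ => c * (t * A ^ 2 + 2 * sphereArea * A * t)) (𝓝[>] 0) (𝓝 0) := by
    have : Continuous (fun t : ℝ => c * (t * A ^ 2 + 2 * sphereArea * A * t)) := by fun_prop
    simpa using (this.tendsto 0).mono_left nhdsWithin_le_nhds
  obtain ⟨t, ht1, ht0⟩ := ((ht.eventually_lt_const (by positivity : 0 < ε / 2)).and
    self_mem_nhdsWithin).exists
  replace ht0 : 0 < t := ht0
  set r := t ^ 2 with hr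
  have hr0 : 0 < r := by positivity
  have hNm := measurableSet_nearSet r
  -- Off the diagonal strip the kernel is bounded by c/r. Hence, for fixed y, its slice is a bounded
  -- test function for α n, and the inner integrals tend to zero pointwise while staying bounded.
  -- The strip contributes less than ε/2 uniformly in n.
  set K₂ : Space × Space → ℝ := (nearSet r)ᶜ.indicator K with hK₂
  have hK₂m : Measurable K₂ := hKm.indicator hNm.compl
  have hK₂c : ∀ z, |K₂ z| ≤ c / ‖z.1 - z.2‖ := by
    intro z
    by_cases hz : z ∈ (nearSet r)ᶜ
    · rw [hK₂, indicator_of_mem hz]; exact hK z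
    · rw [hK₂, indicator_of_notMem hz, abs_zero]; positivity
  have hK₂b : ∀ z, |K₂ z| ≤ c / r := by
    intro z
    by_cases hz : z ∈ (nearSet r)ᶜ
    · refine (hK₂c z).trans ?_
      have : r ≤ ‖z.1 - z.2‖ := not_lt.1 hz
      gcongr
    · rw [hK₂, indicator_of_notMem hz, abs_zero]; positivity
  have hfar : Tendsto (fun n => ∫ z : Space × Space, α n z.1 * β n z.2 * K₂ z) atTop (𝓝 0) := by
    have hslice : ∀ y : Space, Measurable fun x => K₂ (x, y) := fun y => hK₂m.comp (by fun_prop)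
    have := tendsto_integral_mul_zero (g := fun n y => ∫ x, α n x * K₂ (x, y)) (G := m * (c / r))
      hA (by positivity) hβ htight (fun n => ?_) (fun n y => ?_)
      (fun y => hlim _ (hslice y) ⟨_, fun x => hK₂b _⟩)
    · refine this.congr fun n => ?_
      rw [Measure.volume_eq_prod, integral_prod_symm _ ((hα n).integrable_mul_kernel (hβ n) hK₂m hK₂c)]
      congr 1 with y
      rw [← integral_const_mul]
      congr 1 with x
      ring
    · have h1 : AEMeasurable fun z : Space × Space => α n z.2 :=
        (hα n).aemeasurable.comp_quasiMeasurePreserving Measure.quasiMeasurePreserving_snd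
      have h2 : Measurable fun z : Space × Space => K₂ (z.2, z.1) := hK₂m.comp measurable_swap
      have h3 : AEStronglyMeasurable (fun z : Space × Space => α n z.2 * K₂ (z.2, z.1))
          (volume.prod volume) := (h1.mul h2.aemeasurable).aestronglyMeasurable
      exact h3.integral_prod_right'
    · refine abs_integral_le_of_lintegral (by positivity) ?_
      calc ∫⁻ x, ENNReal.ofReal |α n x * K₂ (x, y)|
          ≤ ∫⁻ x, ENNReal.ofReal |α n x| * ENNReal.ofReal (c / r) := by
            refine lintegral_mono fun x => ?_
            rw [← ENNReal.ofReal_mul (abs_nonneg _), abs_mul]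
            exact ENNReal.ofReal_le_ofReal (mul_le_mul_of_nonneg_left (hK₂b _) (abs_nonneg _))
        _ ≤ _ := by
            rw [lintegral_mul_const' _ _ ENNReal.ofReal_ne_top, ENNReal.ofReal_mul hm]
            gcongr
            exact (hα n).mass
  filter_upwards [(Metric.tendsto_nhds.1 hfar) (ε / 2) (by positivity)] with n hn
  rw [dist_zero_right, Real.norm_eq_abs] at hn ⊢
  have hi := (hα n).integrable_mul_kernel (hβ n) hKm hK
  have hi₂ := (hα n).integrable_mul_kernel (hβ n) hK₂m hK₂c
  have hnear : |∫ z : Space × Space, (α n z.1 * β n z.2 * K z - α n z.1 * β n z.2 * K₂ z)| ≤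
      c * (t * A ^ 2 + 2 * sphereArea * A * t) := by
    refine abs_integral_le_of_lintegral (by positivity) ?_
    have h1 := lintegral_near_le (hα n) (hβ n) hA ht0 hr0
    rw [show 2 * sphereArea * A * r / t = 2 * sphereArea * A * t by rw [hr]; field_simp] at h1
    rw [ENNReal.ofReal_mul hc]
    refine le_trans ?_ (mul_le_mul_right h1 _)
    rw [← lintegral_indicator hNm, ← lintegral_const_mul' _ _ ENNReal.ofReal_ne_top]
    refine lintegral_mono fun z => ?_
    by_cases hz : z ∈ nearSet r
    · have : K₂ z = 0 := indicator_of_notMem (not_not.2 hz) _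
      rw [indicator_of_mem hz, coulombDensity, ← ENNReal.ofReal_mul hc, this, mul_zero, sub_zero,
        abs_mul, abs_mul]
      apply ENNReal.ofReal_le_ofReal
      calc |α n z.1| * |β n z.2| * |K z| ≤ |α n z.1| * |β n z.2| * (c / ‖z.1 - z.2‖) := by
            gcongr
            exact hK z
        _ = _ := by ring
    · have : K₂ z = K z := indicator_of_mem hz _
      rw [this, sub_self, abs_zero, ENNReal.ofReal_zero]
      exact zero_le
  rw [integral_sub hi hi₂] at hnear
  calc |∫ z : Space × Space, α n z.1 * β n z.2 * K z|
      ≤ |(∫ z : Space × Space, α n z.1 * β n z.2 * K z) -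
          ∫ z : Space × Space, α n z.1 * β n z.2 * K₂ z| +
        |∫ z : Space × Space, α n z.1 * β n z.2 * K₂ z| := by
        have := abs_add_le ((∫ z : Space × Space, α n z.1 * β n z.2 * K z) -
          ∫ z : Space × Space, α n z.1 * β n z.2 * K₂ z)
          (∫ z : Space × Space, α n z.1 * β n z.2 * K₂ z)
        rwa [sub_add_cancel] at this
    _ < ε := by linarith

end Bilinear

end VlasovPoisson

namespace VlasovPoisson

/-! ### Convergence of the spatial densities and of the Coulomb energy. -/

section DensityConvergence

lemma DensityBound.neg {ρ : Space → ℝ} {m A : ℝ} (h : DensityBound ρ m A) :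
    DensityBound (-ρ) m A :=
  ⟨h.integrable.neg, by simpa using h.mass, by simpa using h.power⟩

lemma DensityBound.mono {ρ : Space → ℝ} {m m' A A' : ℝ} (h : DensityBound ρ m A) (hm : m ≤ m')
    (hA : A ≤ A') : DensityBound ρ m' A' :=
  ⟨h.integrable, h.mass.trans (ENNReal.ofReal_le_ofReal hm),
    h.power.trans (ENNReal.ofReal_le_ofReal hA)⟩

/-- Tight densities with uniform bounds which converge when tested with bounded functions. -/
structure DensityConvergence (ρ : ℕ → Space → ℝ) (ρ₀ : Space → ℝ) (m A : ℝ) : Prop where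
  nonneg_m : 0 ≤ m
  nonneg_A : 0 ≤ A
  bound : ∀ n, DensityBound (ρ n) m A
  bound_limit : DensityBound ρ₀ m A
  tight : ∀ ε : ℝ, 0 < ε → ∃ R : ℝ, ∀ n,
    ∫⁻ y in (Metric.closedBall 0 R)ᶜ, ENNReal.ofReal |ρ n y| ≤ ENNReal.ofReal ε
  tight_limit : ∀ ε : ℝ, 0 < ε → ∃ R : ℝ,
    ∫⁻ y in (Metric.closedBall 0 R)ᶜ, ENNReal.ofReal |ρ₀ y| ≤ ENNReal.ofReal ε
  tendsto : ∀ g : Space → ℝ, Measurable g → (∃ G, ∀ x, |g x| ≤ G) →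
    Tendsto (fun n => ∫ x, ρ n x * g x) atTop (𝓝 (∫ x, ρ₀ x * g x))

variable {ρ : ℕ → Space → ℝ} {ρ₀ : Space → ℝ} {m A : ℝ}

lemma DensityConvergence.sub_bound (h : DensityConvergence ρ ρ₀ m A) (n : ℕ) :
    DensityBound (ρ n - ρ₀) (2 * m) (2 ^ (4 / 3 : ℝ) * (2 * A)) := by
  have := (h.bound n).add h.bound_limit.neg
  rwa [abs_of_nonneg h.nonneg_m, abs_of_nonneg h.nonneg_A, ← two_mul, ← two_mul,
    ← sub_eq_add_neg] at this

lemma DensityConvergence.tendsto_sub (h : DensityConvergence ρ ρ₀ m A) (g : Space → ℝ)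
    (hg : Measurable g) (hb : ∃ G, ∀ x, |g x| ≤ G) :
    Tendsto (fun n => ∫ x, (ρ n - ρ₀) x * g x) atTop (𝓝 0) := by
  have h1 := (h.tendsto g hg hb).sub_const (∫ x, ρ₀ x * g x)
  rw [sub_self] at h1
  obtain ⟨G, hG⟩ := hb
  refine h1.congr fun n => ?_
  rw [← integral_sub ((h.bound n).integrable.mul_bdd hg.aestronglyMeasurable (ae_of_all _ hG))
    (h.bound_limit.integrable.mul_bdd hg.aestronglyMeasurable (ae_of_all _ hG))]
  simp only [Pi.sub_apply, sub_mul]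

lemma DensityConvergence.tight_sub (h : DensityConvergence ρ ρ₀ m A) (ε : ℝ) (hε : 0 < ε) :
    ∃ R : ℝ, ∀ n,
      ∫⁻ y in (Metric.closedBall 0 R)ᶜ, ENNReal.ofReal |(ρ n - ρ₀) y| ≤ ENNReal.ofReal ε := by
  obtain ⟨R₁, h1⟩ := h.tight (ε / 2) (by positivity)
  obtain ⟨R₂, h2⟩ := h.tight_limit (ε / 2) (by positivity)
  refine ⟨max R₁ R₂, fun n => ?_⟩
  have hm := (h.bound n).aemeasurable.restrict (s := (Metric.closedBall 0 (max R₁ R₂))ᶜ)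
  calc ∫⁻ y in (Metric.closedBall 0 (max R₁ R₂))ᶜ, ENNReal.ofReal |(ρ n - ρ₀) y|
      ≤ ∫⁻ y in (Metric.closedBall 0 (max R₁ R₂))ᶜ,
          (ENNReal.ofReal |ρ n y| + ENNReal.ofReal |ρ₀ y|) := by
        refine lintegral_mono fun y => ?_
        rw [← ENNReal.ofReal_add (abs_nonneg _) (abs_nonneg _)]
        exact ENNReal.ofReal_le_ofReal (abs_sub _ _)
    _ = (∫⁻ y in (Metric.closedBall 0 (max R₁ R₂))ᶜ, ENNReal.ofReal |ρ n y|) +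
          ∫⁻ y in (Metric.closedBall 0 (max R₁ R₂))ᶜ, ENNReal.ofReal |ρ₀ y| :=
        lintegral_add_left' (by fun_prop) _
    _ ≤ ENNReal.ofReal (ε / 2) + ENNReal.ofReal (ε / 2) := by
        refine add_le_add ((lintegral_mono_set ?_).trans (h1 n)) ((lintegral_mono_set ?_).trans h2)
        · exact compl_subset_compl.2 (Metric.closedBall_subset_closedBall (le_max_left _ _))
        · exact compl_subset_compl.2 (Metric.closedBall_subset_closedBall (le_max_right _ _))
    _ = ENNReal.ofReal ε := by
        rw [← ENNReal.ofReal_add (by positivity) (by positivity), add_halves]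

lemma DensityConvergence.tendsto_bilinear_sub (h : DensityConvergence ρ ρ₀ m A) {c : ℝ}
    (hc : 0 ≤ c) {K : Space × Space → ℝ} (hKm : Measurable K)
    (hK : ∀ z, |K z| ≤ c / ‖z.1 - z.2‖) :
    Tendsto (fun n => ∫ z : Space × Space, (ρ n - ρ₀) z.1 * (ρ n - ρ₀) z.2 * K z) atTop (𝓝 0) := by
  have := h.nonneg_m
  have := h.nonneg_A
  exact tendsto_bilinear (by positivity) (by positivity) hc h.sub_bound h.sub_bound h.tendsto_sub
    h.tight_sub hKm hK

/-- By symmetry D(ρ_n, ρ_n) - D(ρ₀, ρ₀) = D(ρ_n - ρ₀, ρ_n) + D(ρ_n - ρ₀, ρ₀). In both terms one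
factor tends weakly to zero and the other is tight. -/
lemma DensityConvergence.tendsto_coulomb (h : DensityConvergence ρ ρ₀ m A) :
    Tendsto (fun n => coulomb (ρ n) (ρ n)) atTop (𝓝 (coulomb ρ₀ ρ₀)) := by
  have hm := h.nonneg_m
  have hA := h.nonneg_A
  have h2 : (1 : ℝ) ≤ 2 ^ (4 / 3 : ℝ) := Real.one_le_rpow (by norm_num) (by norm_num)
  have hA' : A ≤ 2 ^ (4 / 3 : ℝ) * (2 * A) := by nlinarith
  have key : ∀ β : ℕ → Space → ℝ, (∀ n, DensityBound (β n) m A) →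
      (∀ ε : ℝ, 0 < ε → ∃ R : ℝ, ∀ n,
        ∫⁻ y in (Metric.closedBall 0 R)ᶜ, ENNReal.ofReal |β n y| ≤ ENNReal.ofReal ε) →
      Tendsto (fun n => coulomb (ρ n - ρ₀) (β n)) atTop (𝓝 0) := by
    intro β hβ htight
    refine tendsto_bilinear (K := fun z => ‖z.1 - z.2‖⁻¹) (m := 2 * m)
      (A := 2 ^ (4 / 3 : ℝ) * (2 * A)) (by positivity) (by positivity) zero_le_one
      h.sub_bound (fun n => (hβ n).mono (by linarith) hA') h.tendsto_sub htight (by fun_prop) ?_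
    intro z
    rw [abs_inv, abs_norm, one_div]
  have h1 := key ρ h.bound h.tight
  have h3 := key (fun _ => ρ₀) (fun _ => h.bound_limit)
    (fun ε hε => let ⟨R, hR⟩ := h.tight_limit ε hε; ⟨R, fun _ => hR⟩)
  have h4 := (h1.add h3).add_const (coulomb ρ₀ ρ₀)
  rw [add_zero, zero_add] at h4
  refine h4.congr fun n => ?_
  have hs := h.sub_bound n
  have e : (ρ n - ρ₀) + ρ₀ = ρ n := sub_add_cancel _ _
  have e1 := coulomb_add_left (hs.integrable_coulomb (h.bound n))
    (h.bound_limit.integrable_coulomb (h.bound n))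
  have e2 := coulomb_add_left (hs.integrable_coulomb h.bound_limit)
    (h.bound_limit.integrable_coulomb h.bound_limit)
  rw [e] at e1 e2
  rw [e1, coulomb_comm ρ₀ (ρ n), e2]
  ring

lemma integral_density_mul {f : Phase → ℝ} (hf : Integrable f) {g : Space → ℝ} (hg : Measurable g)
    (hb : ∃ G, ∀ x, |g x| ≤ G) : ∫ x, density f x * g x = ∫ p : Phase, f p * g p.1 := by
  obtain ⟨G, hG⟩ := hb
  have hi : Integrable (fun p : Phase => f p * g p.1) :=
    hf.mul_bdd (hg.comp measurable_fst).aestronglyMeasurable (ae_of_all _ fun p => hG p.1)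
  rw [Measure.volume_eq_prod, integral_prod _ hi]
  simp only [density, integral_mul_const]

/-- Phase space carries the maximum norm, so a position outside the ball puts the whole phase point
outside the ball. -/
lemma lintegral_compl_ball_density_le {f : Phase → ℝ} (hf : Integrable f) (R : ℝ) :
    ∫⁻ y in (Metric.closedBall 0 R)ᶜ, ENNReal.ofReal |density f y| ≤
      ∫⁻ p in (Metric.closedBall 0 R)ᶜ, ENNReal.ofReal |f p| := by
  have hB : MeasurableSet ((Metric.closedBall (0 : Space) R)ᶜ) := measurableSet_closedBall.compl
  have hm : MeasurableSet ((Metric.closedBall (0 : Space) R)ᶜ ×ˢ (univ : Set Space)) :=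
    hB.prod MeasurableSet.univ
  have h := lintegral_abs_density_le (hf.indicator hm)
  have e := density_restrictTo (Metric.closedBall (0 : Space) R)ᶜ f
  unfold restrictTo at e
  rw [e, lintegral_indicator_abs _ hB] at h
  refine h.trans ?_
  rw [← lintegral_indicator measurableSet_closedBall.compl]
  refine lintegral_mono fun p => ?_
  by_cases hp : p ∈ (Metric.closedBall (0 : Space) R)ᶜ ×ˢ (univ : Set Space)
  · rw [indicator_of_mem hp, indicator_of_mem]
    intro h'
    rw [mem_closedBall_zero_iff] at h'
    exact hp.1 (mem_closedBall_zero_iff.2 ((norm_fst_le p).trans h'))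
  · rw [indicator_of_notMem hp, abs_zero, ENNReal.ofReal_zero]
    exact zero_le

lemma exists_tight_of_integrable {ρ : Space → ℝ} (hρ : Integrable ρ) {ε : ℝ} (hε : 0 < ε) :
    ∃ R : ℝ, ∫⁻ y in (Metric.closedBall 0 R)ᶜ, ENNReal.ofReal |ρ y| ≤ ENNReal.ofReal ε := by
  have hfin : ∫⁻ y, ENNReal.ofReal |ρ y| ≠ ⊤ := by
    have := hρ.hasFiniteIntegral
    simpa [HasFiniteIntegral, Real.enorm_eq_ofReal_abs] using this.ne
  have hanti : Antitone fun n : ℕ => (Metric.closedBall (0 : Space) (n : ℝ))ᶜ := by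
    intro a b hab
    exact compl_subset_compl.2 (Metric.closedBall_subset_closedBall (by exact_mod_cast hab))
  have hempty : ⋂ n : ℕ, (Metric.closedBall (0 : Space) (n : ℝ))ᶜ = ∅ := by
    rw [← compl_iUnion, Metric.iUnion_closedBall_nat, compl_univ]
  have hB : ∀ n : ℕ, MeasurableSet ((Metric.closedBall (0 : Space) (n : ℝ))ᶜ) := fun n =>
    measurableSet_closedBall.compl
  have ht := tendsto_measure_iInter_atTop
    (μ := (volume : Measure Space).withDensity fun y => ENNReal.ofReal |ρ y|)
    (fun n => (hB n).nullMeasurableSet) hanti ⟨0, by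
      rw [withDensity_apply _ (hB 0)]
      exact ((setLIntegral_le_lintegral _ _).trans_lt hfin.lt_top).ne⟩
  rw [hempty, measure_empty] at ht
  simp only [Function.comp_def, withDensity_apply _ (hB _)] at ht
  obtain ⟨n, hn⟩ := (ht.eventually_le_const (ENNReal.ofReal_pos.2 hε)).exists
  exact ⟨n, hn⟩

end DensityConvergence

end VlasovPoisson

namespace VlasovPoisson

/-! ### The force kernel and its composition with itself. -/

section Force

/-- The kernel `x / |x|³` of the gravitational force. -/
noncomputable def force (x : Space) : Space := (‖x‖ ^ 3)⁻¹ • x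

lemma norm_force (x : Space) : ‖force x‖ = (‖x‖ ^ 2)⁻¹ := by
  rcases eq_or_ne x 0 with rfl | hx
  · simp [force]
  · have : 0 < ‖x‖ := norm_pos_iff.2 hx
    rw [force, norm_smul, norm_inv, norm_pow, norm_norm]
    field_simp

lemma measurable_force : Measurable force := by
  unfold force
  fun_prop

/-- The gradient of the potential of the density `ρ`. -/
noncomputable def field (ρ : Space → ℝ) (x : Space) : Space := ∫ y, ρ y • force (x - y)

/-- At least one of a, b is at least d/2. If the other is smaller, the larger one contributes at
most 4/d²; if both are large, the arithmetic-geometric inequality separates them into fourth powers.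
Each summand then depends on one distance only and can be integrated by translation invariance. -/
lemma inv_sq_mul_inv_sq_le {a b d : ℝ} (hd : 0 < d) (h : d ≤ a + b) :
    (a ^ 2)⁻¹ * (b ^ 2)⁻¹ ≤
      ((if a < d / 2 then 4 / d ^ 2 * (a ^ 2)⁻¹ else (a ^ 4)⁻¹) +
        (if b < d / 2 then 4 / d ^ 2 * (b ^ 2)⁻¹ else (b ^ 4)⁻¹)) := by
  have key : ∀ c : ℝ, d / 2 ≤ c → (c ^ 2)⁻¹ ≤ 4 / d ^ 2 := by
    intro c hc
    rw [inv_le_comm₀ (by nlinarith) (by positivity), inv_div]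
    nlinarith
  by_cases h1 : a < d / 2
  · rw [if_pos h1, mul_comm]
    have : (0 : ℝ) ≤ if b < d / 2 then 4 / d ^ 2 * (b ^ 2)⁻¹ else (b ^ 4)⁻¹ := by
      split_ifs <;> positivity
    have h2 : (b ^ 2)⁻¹ * (a ^ 2)⁻¹ ≤ 4 / d ^ 2 * (a ^ 2)⁻¹ := by
      gcongr
      exact key b (by linarith)
    linarith
  · rw [if_neg h1]
    by_cases h2 : b < d / 2
    · rw [if_pos h2]
      have h3 : (a ^ 2)⁻¹ * (b ^ 2)⁻¹ ≤ 4 / d ^ 2 * (b ^ 2)⁻¹ := by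
        gcongr
        exact key a (by linarith)
      have : 0 ≤ (a ^ 4)⁻¹ := by positivity
      linarith
    · rw [if_neg h2]
      have e : ∀ c : ℝ, (c ^ 4)⁻¹ = ((c ^ 2)⁻¹) ^ 2 := fun c => by rw [inv_pow, ← pow_mul]
      rw [e, e]
      nlinarith [sq_nonneg ((a ^ 2)⁻¹ - (b ^ 2)⁻¹), sq_nonneg ((a ^ 2)⁻¹), sq_nonneg ((b ^ 2)⁻¹)]

lemma lintegral_cutoff_kernel {d : ℝ} (hd : 0 < d) :
    ∫⁻ x : Space, ENNReal.ofReal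
      (if ‖x‖ < d / 2 then 4 / d ^ 2 * (‖x‖ ^ 2)⁻¹ else (‖x‖ ^ 4)⁻¹) =
      ENNReal.ofReal (4 * sphereArea / d) := by
  have hκ := sphereArea_pos
  rw [← lintegral_add_compl _ (measurableSet_ball : MeasurableSet (Metric.ball (0 : Space) (d / 2)))]
  have e1 : ∫⁻ x in Metric.ball (0 : Space) (d / 2), ENNReal.ofReal
      (if ‖x‖ < d / 2 then 4 / d ^ 2 * (‖x‖ ^ 2)⁻¹ else (‖x‖ ^ 4)⁻¹) =
      ENNReal.ofReal (4 / d ^ 2) * ENNReal.ofReal (sphereArea * (d / 2)) := by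
    rw [← lintegral_ball_inv_sq (by positivity), ← lintegral_const_mul' _ _ ENNReal.ofReal_ne_top]
    refine setLIntegral_congr_fun measurableSet_ball fun x hx => ?_
    rw [if_pos (mem_ball_zero_iff.1 hx), ENNReal.ofReal_mul (by positivity)]
  have e2 : ∫⁻ x in (Metric.ball (0 : Space) (d / 2))ᶜ, ENNReal.ofReal
      (if ‖x‖ < d / 2 then 4 / d ^ 2 * (‖x‖ ^ 2)⁻¹ else (‖x‖ ^ 4)⁻¹) =
      ENNReal.ofReal (sphereArea / (d / 2)) := by
    rw [← lintegral_compl_ball_inv_pow_four (by positivity)]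
    refine setLIntegral_congr_fun measurableSet_ball.compl fun x hx => ?_
    rw [if_neg fun h => hx (mem_ball_zero_iff.2 h)]
  rw [e1, e2, ← ENNReal.ofReal_mul (by positivity), ← ENNReal.ofReal_add (by positivity) (by positivity)]
  congr 1
  field_simp
  ring

/-- Composition of two inverse square kernels is dominated by the Coulomb kernel. -/
lemma lintegral_inv_sq_mul_inv_sq_le {y z : Space} (h : y ≠ z) :
    ∫⁻ x : Space, ENNReal.ofReal ((‖x - y‖ ^ 2)⁻¹ * (‖x - z‖ ^ 2)⁻¹) ≤
      ENNReal.ofReal (8 * sphereArea / ‖y - z‖) := by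
  have hκ := sphereArea_pos
  have hd : 0 < ‖y - z‖ := norm_pos_iff.2 (sub_ne_zero.2 h)
  set d := ‖y - z‖
  set F : Space → ℝ≥0∞ := fun x => ENNReal.ofReal
    (if ‖x‖ < d / 2 then 4 / d ^ 2 * (‖x‖ ^ 2)⁻¹ else (‖x‖ ^ 4)⁻¹) with hF
  have hFm : Measurable F := by
    refine ENNReal.measurable_ofReal.comp (Measurable.ite ?_ (by fun_prop) (by fun_prop))
    exact measurableSet_lt measurable_norm measurable_const
  calc ∫⁻ x : Space, ENNReal.ofReal ((‖x - y‖ ^ 2)⁻¹ * (‖x - z‖ ^ 2)⁻¹)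
      ≤ ∫⁻ x : Space, (F (x - y) + F (x - z)) := by
        refine lintegral_mono fun x => ?_
        have h0 : ∀ c : ℝ, 0 ≤ c → 0 ≤ if c < d / 2 then 4 / d ^ 2 * (c ^ 2)⁻¹ else (c ^ 4)⁻¹ := by
          intro c hc
          split_ifs <;> positivity
        rw [hF, ← ENNReal.ofReal_add (h0 _ (norm_nonneg _)) (h0 _ (norm_nonneg _))]
        refine ENNReal.ofReal_le_ofReal (inv_sq_mul_inv_sq_le hd ?_)
        rw [norm_sub_rev x y]
        simpa using norm_add_le (y - x) (x - z)
    _ = ENNReal.ofReal (8 * sphereArea / d) := by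
        have hFy : Measurable fun x => F (x - y) := hFm.comp (by fun_prop)
        rw [lintegral_add_left hFy, lintegral_sub_right_eq_self F y,
          lintegral_sub_right_eq_self F z, hF, lintegral_cutoff_kernel hd,
          ← ENNReal.ofReal_add (by positivity) (by positivity)]
        congr 1
        ring

/-- The kernel of the quadratic form `∫ |field ρ|²`. -/
noncomputable def fieldKernel : Space × Space → ℝ :=
  {z : Space × Space | z.1 = z.2}ᶜ.indicator
    fun z => ∫ x, inner ℝ (force (x - z.1)) (force (x - z.2))

lemma measurable_fieldKernel : Measurable fieldKernel := by
  have h1 : Measurable fun w : (Space × Space) × Space =>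
      inner ℝ (force (w.2 - w.1.1)) (force (w.2 - w.1.2)) :=
    (measurable_force.comp (by fun_prop)).inner (measurable_force.comp (by fun_prop))
  exact h1.stronglyMeasurable.integral_prod_right'.measurable.indicator
    (measurableSet_eq_fun measurable_fst measurable_snd).compl

lemma abs_inner_force_le (x y z : Space) :
    |inner ℝ (force (x - y)) (force (x - z))| ≤ (‖x - y‖ ^ 2)⁻¹ * (‖x - z‖ ^ 2)⁻¹ := by
  rw [← norm_force, ← norm_force]
  exact abs_real_inner_le_norm _ _

/-- Only the size of the kernel matters, so its exact value is not computed. On the diagonal the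
kernel is zero by definition, matching the convention for division by zero on the right. -/
lemma abs_fieldKernel_le (z : Space × Space) :
    |fieldKernel z| ≤ 8 * sphereArea / ‖z.1 - z.2‖ := by
  have hκ := sphereArea_pos
  by_cases h : z.1 = z.2
  · rw [fieldKernel, indicator_of_notMem (not_not.2 h), abs_zero]
    positivity
  · rw [fieldKernel, indicator_of_mem (show z ∈ {z : Space × Space | z.1 = z.2}ᶜ from h)]
    refine abs_integral_le_of_lintegral (by positivity)
      (le_trans (lintegral_mono fun x => ?_) (lintegral_inv_sq_mul_inv_sq_le h))
    exact ENNReal.ofReal_le_ofReal (abs_inner_force_le _ _ _)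

end Force

/-! ### Convolutions with locally integrable kernels. -/

section LocalIntegrability

/-- The bound is uniform in y, as Fubini with an integrable density requires. The hypothesis on k
covers the kernels of both the force and the potential. -/
lemma lintegral_ball_kernel_le {E : Type*} [NormedAddCommGroup E] {k : Space → E} (hk : ∀ x, ‖k x‖ ≤ (‖x‖ ^ 2)⁻¹ + 1) (S : ℝ)
    (y : Space) :
    ∫⁻ x in Metric.ball 0 S, ‖k (x - y)‖ₑ ≤
      ENNReal.ofReal sphereArea + 2 * volume (Metric.ball (0 : Space) S) := by
  have hpt : ∀ x, ‖k x‖ₑ ≤ (Metric.ball (0 : Space) 1).indicator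
      (fun x => ENNReal.ofReal ((‖x‖ ^ 2)⁻¹)) x + 2 := by
    intro x
    rw [← ofReal_norm]
    by_cases hx : x ∈ Metric.ball (0 : Space) 1
    · rw [indicator_of_mem hx]
      refine (ENNReal.ofReal_le_ofReal (hk x)).trans ?_
      rw [ENNReal.ofReal_add (by positivity) zero_le_one, ENNReal.ofReal_one]
      gcongr
      exact one_le_two
    · rw [indicator_of_notMem hx, zero_add]
      have h1 : 1 ≤ ‖x‖ := by rwa [mem_ball_zero_iff, not_lt] at hx
      have h2 : (‖x‖ ^ 2)⁻¹ ≤ 1 := inv_le_one_of_one_le₀ (one_le_pow₀ h1)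
      refine (ENNReal.ofReal_le_ofReal ((hk x).trans (by linarith : _ ≤ (2 : ℝ)))).trans ?_
      simp
  have hm : Measurable ((Metric.ball (0 : Space) 1).indicator
      fun x => ENNReal.ofReal ((‖x‖ ^ 2)⁻¹)) :=
    (by fun_prop : Measurable fun x : Space => ENNReal.ofReal ((‖x‖ ^ 2)⁻¹)).indicator
      measurableSet_ball
  refine (lintegral_mono fun x => hpt (x - y)).trans ?_
  rw [lintegral_add_right _ measurable_const, setLIntegral_const]
  refine add_le_add_left ((setLIntegral_le_lintegral _ _).trans ?_) _
  rw [lintegral_sub_right_eq_self ((Metric.ball (0 : Space) 1).indicator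
      fun x => ENNReal.ofReal ((‖x‖ ^ 2)⁻¹)) y, lintegral_indicator measurableSet_ball,
    lintegral_ball_inv_sq one_pos, mul_one]

variable {E : Type*} [NormedAddCommGroup E] [NormedSpace ℝ E] [MeasurableSpace E] [BorelSpace E]
  [SecondCountableTopology E]

lemma integrable_prod_kernel {ρ : Space → ℝ} (hρ : Integrable ρ) {k : Space → E}
    (hkm : Measurable k) (hk : ∀ x, ‖k x‖ ≤ (‖x‖ ^ 2)⁻¹ + 1) (S : ℝ) :
    Integrable (fun w : Space × Space => ρ w.2 • k (w.1 - w.2))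
      ((volume.restrict (Metric.ball 0 S)).prod volume) := by
  have h1 : AEStronglyMeasurable (fun w : Space × Space => ρ w.2)
      ((volume.restrict (Metric.ball (0 : Space) S)).prod volume) :=
    hρ.aestronglyMeasurable.comp_snd
  have h2 : Measurable fun w : Space × Space => k (w.1 - w.2) := hkm.comp (by fun_prop)
  have h3 := h1.smul h2.aestronglyMeasurable
  refine ⟨h3, ?_⟩
  have h4 : AEMeasurable (fun w : Space × Space => ‖ρ w.2 • k (w.1 - w.2)‖ₑ)
      ((volume.restrict (Metric.ball (0 : Space) S)).prod volume) := h3.enorm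
  rw [HasFiniteIntegral, lintegral_prod_symm _ h4]
  calc ∫⁻ y, ∫⁻ x in Metric.ball 0 S, ‖ρ y • k (x - y)‖ₑ
      ≤ ∫⁻ y, ‖ρ y‖ₑ * (ENNReal.ofReal sphereArea + 2 * volume (Metric.ball (0 : Space) S)) := by
        refine lintegral_mono fun y => ?_
        simp only [enorm_smul]
        rw [lintegral_const_mul' _ _ enorm_ne_top]
        gcongr
        exact lintegral_ball_kernel_le hk S y
    _ < ⊤ := by
        have hfin : ENNReal.ofReal sphereArea + 2 * volume (Metric.ball (0 : Space) S) ≠ ⊤ :=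
          ENNReal.add_ne_top.2 ⟨ENNReal.ofReal_ne_top,
            ENNReal.mul_ne_top ENNReal.ofNat_ne_top measure_ball_lt_top.ne⟩
        rw [lintegral_mul_const' _ _ hfin]
        exact ENNReal.mul_lt_top hρ.hasFiniteIntegral hfin.lt_top

lemma ae_integrable_kernel {ρ : Space → ℝ} (hρ : Integrable ρ) {k : Space → E}
    (hkm : Measurable k) (hk : ∀ x, ‖k x‖ ≤ (‖x‖ ^ 2)⁻¹ + 1) :
    ∀ᵐ x, Integrable fun y => ρ y • k (x - y) := by
  have h : ∀ n : ℕ, ∀ᵐ x, x ∈ Metric.ball (0 : Space) n → Integrable fun y => ρ y • k (x - y) :=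
    fun n => (ae_restrict_iff' measurableSet_ball).1 (integrable_prod_kernel hρ hkm hk n).prod_right_ae
  filter_upwards [ae_all_iff.2 h] with x hx
  obtain ⟨n, hn⟩ := exists_nat_gt ‖x‖
  exact hx n (mem_ball_zero_iff.2 hn)

lemma locallyIntegrable_kernel [CompleteSpace E] {ρ : Space → ℝ} (hρ : Integrable ρ) {k : Space → E}
    (hkm : Measurable k) (hk : ∀ x, ‖k x‖ ≤ (‖x‖ ^ 2)⁻¹ + 1) :
    LocallyIntegrable fun x => ∫ y, ρ y • k (x - y) := by
  rw [locallyIntegrable_iff]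
  intro K hK
  obtain ⟨S, hS⟩ := hK.isBounded.subset_ball 0
  have : IntegrableOn (fun x => ∫ y, ρ y • k (x - y)) (Metric.ball 0 S) :=
    (integrable_prod_kernel hρ hkm hk S).integral_prod_left
  exact this.mono_set hS

lemma norm_force_le (x : Space) : ‖force x‖ ≤ (‖x‖ ^ 2)⁻¹ + 1 := by
  rw [norm_force]
  linarith

lemma inv_norm_le (x : Space) : ‖‖x‖⁻¹‖ ≤ (‖x‖ ^ 2)⁻¹ + 1 := by
  rw [norm_inv, norm_norm, ← inv_pow]
  nlinarith [sq_nonneg (‖x‖⁻¹ - 1), sq_nonneg ‖x‖⁻¹]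

end LocalIntegrability

/-! ### The L² norm of the field as a quadratic form in the density. -/

section SquareIntegrability

variable {σ : Space → ℝ} {m A : ℝ}

/-- Integrating out x first leaves at most a Coulomb kernel, whose double integral is finite. This
justifies the interchange of integrals in the formula for the squared norm. -/
lemma DensityBound.integrable_triple (h : DensityBound σ m A) :
    Integrable fun w : Space × (Space × Space) =>
      σ w.2.1 * σ w.2.2 * inner ℝ (force (w.1 - w.2.1)) (force (w.1 - w.2.2)) := by
  have hs1 : AEMeasurable fun z : Space × Space => σ z.1 :=
    h.aemeasurable.comp_quasiMeasurePreserving Measure.quasiMeasurePreserving_fst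
  have hs2 : AEMeasurable fun z : Space × Space => σ z.2 :=
    h.aemeasurable.comp_quasiMeasurePreserving Measure.quasiMeasurePreserving_snd
  have hs : AEMeasurable (fun z : Space × Space => σ z.1 * σ z.2) := hs1.mul hs2
  have hs' : AEMeasurable (fun w : Space × (Space × Space) => σ w.2.1 * σ w.2.2) :=
    hs.comp_quasiMeasurePreserving Measure.quasiMeasurePreserving_snd
  have hk : Measurable fun w : Space × (Space × Space) =>
      inner ℝ (force (w.1 - w.2.1)) (force (w.1 - w.2.2)) :=
    (measurable_force.comp (by fun_prop)).inner (measurable_force.comp (by fun_prop))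
  have hm : AEMeasurable (fun w : Space × (Space × Space) =>
      σ w.2.1 * σ w.2.2 * inner ℝ (force (w.1 - w.2.1)) (force (w.1 - w.2.2))) :=
    hs'.mul hk.aemeasurable
  refine ⟨hm.aestronglyMeasurable, ?_⟩
  rw [HasFiniteIntegral, Measure.volume_eq_prod, lintegral_prod_symm _ hm.enorm]
  refine lt_of_le_of_lt (lintegral_mono_ae (g := fun z =>
    ENNReal.ofReal (8 * sphereArea) * coulombDensity σ σ z) ?_) ?_
  · filter_upwards [ae_ne_diagonal] with z hz
    have hκ := sphereArea_pos
    simp only [enorm_mul]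
    rw [lintegral_const_mul' _ _ (ENNReal.mul_ne_top enorm_ne_top enorm_ne_top)]
    calc ‖σ z.1‖ₑ * ‖σ z.2‖ₑ * ∫⁻ x, ‖inner ℝ (force (x - z.1)) (force (x - z.2))‖ₑ
        ≤ ‖σ z.1‖ₑ * ‖σ z.2‖ₑ * ENNReal.ofReal (8 * sphereArea / ‖z.1 - z.2‖) := by
          gcongr
          refine le_trans (lintegral_mono fun x => ?_) (lintegral_inv_sq_mul_inv_sq_le hz)
          rw [Real.enorm_eq_ofReal_abs]
          exact ENNReal.ofReal_le_ofReal (abs_inner_force_le _ _ _)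
      _ = _ := by
          rw [coulombDensity, Real.enorm_eq_ofReal_abs, Real.enorm_eq_ofReal_abs,
            ← ENNReal.ofReal_mul (abs_nonneg _), ← ENNReal.ofReal_mul (by positivity),
            ← ENNReal.ofReal_mul (by positivity)]
          congr 1
          ring
  · rw [lintegral_const_mul' _ _ ENNReal.ofReal_ne_top]
    exact ENNReal.mul_lt_top ENNReal.ofReal_lt_top (h.coulomb_lt_top h)

lemma ae_integrable_force {ρ : Space → ℝ} (hρ : Integrable ρ) :
    ∀ᵐ x, Integrable fun y => ρ y • force (x - y) :=
  ae_integrable_kernel hρ measurable_force norm_force_le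

lemma locallyIntegrable_field {ρ : Space → ℝ} (hρ : Integrable ρ) :
    LocallyIntegrable (field ρ) :=
  locallyIntegrable_kernel hρ measurable_force norm_force_le

lemma DensityBound.norm_field_sq (h : DensityBound σ m A) :
    ∀ᵐ x, ∫ z : Space × Space,
      σ z.1 * σ z.2 * inner ℝ (force (x - z.1)) (force (x - z.2)) = ‖field σ x‖ ^ 2 := by
  have h1 : ∀ᵐ x, Integrable fun z : Space × Space =>
      σ z.1 * σ z.2 * inner ℝ (force (x - z.1)) (force (x - z.2)) := h.integrable_triple.prod_right_ae
  filter_upwards [h1, ae_integrable_force h.integrable] with x hx1 hx2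
  rw [Measure.volume_eq_prod, integral_prod _ hx1]
  have e : ∀ y z, σ y * σ z * inner ℝ (force (x - y)) (force (x - z)) =
      inner ℝ (σ y • force (x - y)) (σ z • force (x - z)) := by
    intro y z
    rw [real_inner_smul_left, real_inner_smul_right]
    ring
  simp only [e]
  simp only [integral_inner hx2]
  have e2 : ∀ y, inner ℝ (σ y • force (x - y)) (∫ z, σ z • force (x - z)) =
      inner ℝ (field σ x) (σ y • force (x - y)) := fun y => real_inner_comm _ _
  simp only [e2]
  rw [integral_inner hx2]
  exact real_inner_self_eq_norm_sq _

lemma DensityBound.integrable_norm_field_sq (h : DensityBound σ m A) :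
    Integrable fun x => ‖field σ x‖ ^ 2 :=
  h.integrable_triple.integral_prod_left.congr h.norm_field_sq

lemma DensityBound.integral_norm_field_sq (h : DensityBound σ m A) :
    ∫ x, ‖field σ x‖ ^ 2 = ∫ z : Space × Space, σ z.1 * σ z.2 * fieldKernel z := by
  rw [← integral_congr_ae h.norm_field_sq]
  rw [integral_integral_swap h.integrable_triple]
  refine integral_congr_ae ?_
  filter_upwards [ae_ne_diagonal] with z hz
  rw [integral_const_mul, fieldKernel,
    indicator_of_mem (show z ∈ {z : Space × Space | z.1 = z.2}ᶜ from hz)]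

lemma DensityBound.memLp_field (h : DensityBound σ m A) : MemLp (field σ) 2 := by
  rw [memLp_two_iff_integrable_sq_norm (locallyIntegrable_field h.integrable).aestronglyMeasurable]
  exact h.integrable_norm_field_sq

lemma DensityBound.eLpNorm_field (h : DensityBound σ m A) :
    eLpNorm (field σ) 2 = ENNReal.ofReal ((∫ x, ‖field σ x‖ ^ 2) ^ (2⁻¹ : ℝ)) := by
  rw [h.memLp_field.eLpNorm_eq_integral_rpow_norm two_ne_zero ENNReal.ofNat_ne_top]
  simp

/-- By linearity the difference of the fields is almost everywhere the field of ρ_n - ρ₀, whose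
squared norm is a bilinear form with a kernel of Coulomb size. -/
lemma DensityConvergence.tendsto_field {ρ : ℕ → Space → ℝ} {ρ₀ : Space → ℝ}
    (h : DensityConvergence ρ ρ₀ m A) :
    Tendsto (fun n => eLpNorm (field (ρ n) - field ρ₀) 2 volume) atTop (𝓝 0) := by
  have hκ := sphereArea_pos
  have h1 := h.tendsto_bilinear_sub (c := 8 * sphereArea) (by positivity) measurable_fieldKernel
    abs_fieldKernel_le
  have h2 := ENNReal.tendsto_ofReal (h1.rpow_const (p := 2⁻¹) (Or.inr (by norm_num)))
  rw [Real.zero_rpow (by norm_num), ENNReal.ofReal_zero] at h2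
  refine h2.congr fun n => ?_
  rw [← (h.sub_bound n).integral_norm_field_sq, ← (h.sub_bound n).eLpNorm_field]
  refine eLpNorm_congr_ae ?_
  filter_upwards [ae_integrable_force (h.bound n).integrable,
    ae_integrable_force h.bound_limit.integrable] with x hx1 hx2
  simp only [field, Pi.sub_apply, sub_smul]
  exact integral_sub hx1 hx2

end SquareIntegrability

end VlasovPoisson

namespace VlasovPoisson

/-! ### The field is the weak gradient of the potential. -/

section WeakGradient

lemma integrable_mul_kernel {w k : Space → ℝ} (hw : Continuous w) (hc : HasCompactSupport w)
    (hkm : Measurable k) (hk : ∀ x, ‖k x‖ ≤ (‖x‖ ^ 2)⁻¹ + 1) (y : Space) :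
    Integrable fun x => w x * k (x - y) := by
  obtain ⟨W, hW⟩ := hw.bounded_above_of_compact_support hc
  obtain ⟨S, hS⟩ := hc.isCompact.isBounded.subset_ball 0
  have h1 : IntegrableOn (fun x => k (x - y)) (Metric.ball 0 S) := by
    refine ⟨(hkm.comp (by fun_prop)).aestronglyMeasurable, ?_⟩
    exact (lintegral_ball_kernel_le hk S y).trans_lt (ENNReal.add_lt_top.2 ⟨ENNReal.ofReal_lt_top,
      ENNReal.mul_lt_top ENNReal.ofNat_lt_top measure_ball_lt_top⟩)
  have h2 : IntegrableOn (fun x => w x * k (x - y)) (Metric.ball 0 S) :=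
    h1.bdd_mul hw.aestronglyMeasurable (ae_of_all _ hW)
  refine (integrableOn_iff_integrable_of_support_subset fun x hx => hS ?_).1 h2
  exact subset_tsupport w (left_ne_zero_of_mul hx)

lemma integral_mul_kernel_swap {ρ : Space → ℝ} (hρ : Integrable ρ) {w k : Space → ℝ}
    (hw : Continuous w) (hc : HasCompactSupport w) (hkm : Measurable k)
    (hk : ∀ x, ‖k x‖ ≤ (‖x‖ ^ 2)⁻¹ + 1) :
    ∫ x, w x * ∫ y, ρ y * k (x - y) = ∫ y, ρ y * ∫ x, w x * k (x - y) := by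
  obtain ⟨W, hW⟩ := hw.bounded_above_of_compact_support hc
  obtain ⟨S, hS⟩ := hc.isCompact.isBounded.subset_ball 0
  have h0 : ∀ x ∉ Metric.ball (0 : Space) S, w x = 0 := fun x hx =>
    image_eq_zero_of_notMem_tsupport fun h => hx (hS h)
  have h1 := (integrable_prod_kernel hρ hkm hk S).bdd_mul (f := fun p : Space × Space => w p.1)
    (c := W) (by fun_prop) (ae_of_all _ fun p => hW p.1)
  simp only [smul_eq_mul] at h1
  rw [← setIntegral_eq_integral_of_forall_compl_eq_zero (s := Metric.ball (0 : Space) S)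
    (fun x hx => by rw [h0 x hx, zero_mul])]
  simp only [← integral_const_mul]
  rw [integral_integral_swap h1]
  refine integral_congr_ae (ae_of_all _ fun y => ?_)
  have e : ∫ x in Metric.ball (0 : Space) S, ρ y * (w x * k (x - y)) =
      ∫ x, ρ y * (w x * k (x - y)) :=
    setIntegral_eq_integral_of_forall_compl_eq_zero fun x hx => by rw [h0 x hx, zero_mul, mul_zero]
  simpa only [mul_left_comm (ρ y)] using e

lemma hasFDerivAt_regularized {δ : ℝ} (hδ : 0 < δ) (y x : Space) :
    HasFDerivAt (fun x : Space => (√(‖x - y‖ ^ 2 + δ))⁻¹)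
      (-(√(‖x - y‖ ^ 2 + δ) ^ 3)⁻¹ • innerSL ℝ (x - y)) x := by
  have h1 : HasFDerivAt (fun x : Space => ‖x - y‖ ^ 2 + δ) (2 • innerSL ℝ (x - y)) x := by
    have := ((hasFDerivAt_id x).sub_const y).norm_sq
    simpa using this.add_const δ
  have h0 : 0 < ‖x - y‖ ^ 2 + δ := by positivity
  have h2 : HasDerivAt (fun t : ℝ => (√t)⁻¹) (-(1 / (2 * √(‖x - y‖ ^ 2 + δ))) /
      √(‖x - y‖ ^ 2 + δ) ^ 2) (‖x - y‖ ^ 2 + δ) :=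
    (Real.hasDerivAt_sqrt h0.ne').inv (Real.sqrt_ne_zero'.2 h0)
  refine (h2.comp_hasFDerivAt x h1).congr_fderiv ?_
  ext v
  have : 0 < √(‖x - y‖ ^ 2 + δ) := Real.sqrt_pos.2 h0
  simp
  field_simp

/-- Integrate by parts with the smooth kernel (|x-y|² + δ)^(-1/2) and let δ tend to zero. The
regularized kernels are dominated by the singular ones, which are locally integrable. -/
lemma integral_inv_norm_mul_fderiv {ψ : Space → ℝ} (hψ : ContDiff ℝ ∞ ψ)
    (hc : HasCompactSupport ψ) {v : Space} (hv : ‖v‖ ≤ 1) (y : Space) :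
    ∫ x, fderiv ℝ ψ x v * ‖x - y‖⁻¹ = ∫ x, ψ x * inner ℝ (force (x - y)) v := by
  have hd : Continuous fun x => fderiv ℝ ψ x v :=
    (hψ.continuous_fderiv (by simp)).clm_apply continuous_const
  have hdc : HasCompactSupport fun x => fderiv ℝ ψ x v := hc.fderiv_apply ℝ v
  have hfm : Measurable fun x => inner ℝ (force x) v := measurable_force.inner measurable_const
  have hfb : ∀ x, ‖inner ℝ (force x) v‖ ≤ (‖x‖ ^ 2)⁻¹ + 1 := by
    intro x
    refine (norm_inner_le_norm _ _).trans ((mul_le_of_le_one_right (norm_nonneg _) hv).trans ?_)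
    exact norm_force_le x
  set δ : ℕ → ℝ := fun n => 1 / ((n : ℝ) + 1) with hδdef
  have hδ : ∀ n, 0 < δ n := fun n => by positivity
  have hδ0 : Tendsto δ atTop (𝓝 0) := tendsto_one_div_add_atTop_nhds_zero_nat
  have hs : ∀ n x, 0 < √(‖x - y‖ ^ 2 + δ n) := fun n x =>
    Real.sqrt_pos.2 (by have := hδ n; positivity)
  have hsle : ∀ n x, ‖x - y‖ ≤ √(‖x - y‖ ^ 2 + δ n) := fun n x =>
    Real.le_sqrt_of_sq_le (by linarith [hδ n])
  have hcont : ∀ n, Continuous fun x : Space => (√(‖x - y‖ ^ 2 + δ n))⁻¹ := fun n =>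
    (by fun_prop : Continuous fun x : Space => √(‖x - y‖ ^ 2 + δ n)).inv₀ fun x => (hs n x).ne'
  have hibp : ∀ n, ∫ x, fderiv ℝ ψ x v * (√(‖x - y‖ ^ 2 + δ n))⁻¹ =
      ∫ x, ψ x * ((√(‖x - y‖ ^ 2 + δ n) ^ 3)⁻¹ * inner ℝ (x - y) v) := by
    intro n
    have hg : ∀ x, fderiv ℝ (fun x : Space => (√(‖x - y‖ ^ 2 + δ n))⁻¹) x v =
        -((√(‖x - y‖ ^ 2 + δ n) ^ 3)⁻¹ * inner ℝ (x - y) v) := by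
      intro x
      rw [(hasFDerivAt_regularized (hδ n) y x).fderiv]
      simp [inner_sub_left]
    have hgc : Continuous fun x => fderiv ℝ (fun x : Space => (√(‖x - y‖ ^ 2 + δ n))⁻¹) x v := by
      simp only [hg]
      have h3 : Continuous fun x : Space => (√(‖x - y‖ ^ 2 + δ n) ^ 3)⁻¹ :=
        (by fun_prop : Continuous fun x : Space => √(‖x - y‖ ^ 2 + δ n) ^ 3).inv₀
          fun x => (pow_pos (hs n x) 3).ne'
      fun_prop
    have := integral_mul_fderiv_eq_neg_fderiv_mul_of_integrable (μ := volume) (v := v)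
      (f := fun x : Space => (√(‖x - y‖ ^ 2 + δ n))⁻¹) (g := ψ)
      ((hgc.mul hψ.continuous).integrable_of_hasCompactSupport hc.mul_left)
      (((hcont n).mul hd).integrable_of_hasCompactSupport hdc.mul_left)
      (((hcont n).mul hψ.continuous).integrable_of_hasCompactSupport hc.mul_left)
      (fun x _ => (hasFDerivAt_regularized (hδ n) y x).differentiableAt)
      (fun x _ => hψ.differentiable (by simp) x)
    simp only [hg] at this
    rw [← integral_neg] at this
    refine Eq.trans ?_ (this.trans ?_) <;>
      refine integral_congr_ae (ae_of_all _ fun x => ?_) <;> simp only <;> ring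
  have hae : ∀ᵐ x : Space, x ≠ y := by
    rw [ae_iff]
    simp
  have hroot : ∀ x, Tendsto (fun n => √(‖x - y‖ ^ 2 + δ n)) atTop (𝓝 ‖x - y‖) := by
    intro x
    have h := (hδ0.const_add (‖x - y‖ ^ 2)).sqrt
    rwa [add_zero, Real.sqrt_sq (norm_nonneg _)] at h
  have hL : Tendsto (fun n => ∫ x, fderiv ℝ ψ x v * (√(‖x - y‖ ^ 2 + δ n))⁻¹) atTop
      (𝓝 (∫ x, fderiv ℝ ψ x v * ‖x - y‖⁻¹)) := by
    refine tendsto_integral_of_dominated_convergence (fun x => ‖fderiv ℝ ψ x v * ‖x - y‖⁻¹‖)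
      (fun n => (hd.mul (hcont n)).aestronglyMeasurable)
      (integrable_mul_kernel hd hdc (k := fun x => ‖x‖⁻¹) (by fun_prop) inv_norm_le y).norm
      (fun n => ?_) ?_
    · filter_upwards [hae] with x hx
      have : 0 < ‖x - y‖ := norm_pos_iff.2 (sub_ne_zero.2 hx)
      rw [norm_mul, norm_mul, norm_inv, norm_inv, norm_norm, Real.norm_of_nonneg (hs n x).le]
      gcongr
      exact hsle n x
    · filter_upwards [hae] with x hx
      exact ((hroot x).inv₀ (norm_ne_zero_iff.2 (sub_ne_zero.2 hx))).const_mul _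
  have hR : Tendsto (fun n => ∫ x, ψ x * ((√(‖x - y‖ ^ 2 + δ n) ^ 3)⁻¹ * inner ℝ (x - y) v)) atTop
      (𝓝 (∫ x, ψ x * inner ℝ (force (x - y)) v)) := by
    refine tendsto_integral_of_dominated_convergence (fun x => ‖ψ x‖ * ‖force (x - y)‖)
      (fun n => ?_) ?_ (fun n => ?_) ?_
    · have h3 : Continuous fun x : Space => (√(‖x - y‖ ^ 2 + δ n) ^ 3)⁻¹ :=
        (by fun_prop : Continuous fun x : Space => √(‖x - y‖ ^ 2 + δ n) ^ 3).inv₀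
          fun x => (pow_pos (hs n x) 3).ne'
      exact (hψ.continuous.mul (h3.mul (by fun_prop))).aestronglyMeasurable
    · refine integrable_mul_kernel hψ.continuous.norm hc.norm (k := fun x => ‖force x‖)
        measurable_force.norm (fun x => ?_) y
      rw [norm_norm]
      exact norm_force_le x
    · filter_upwards [hae] with x hx
      have : 0 < ‖x - y‖ := norm_pos_iff.2 (sub_ne_zero.2 hx)
      rw [norm_mul, force, norm_smul, norm_mul, norm_inv, norm_inv, norm_pow, norm_pow, norm_norm,
        Real.norm_of_nonneg (hs n x).le]
      gcongr
      · exact hsle n x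
      · exact (norm_inner_le_norm _ _).trans (mul_le_of_le_one_right (norm_nonneg _) hv)
    · filter_upwards [hae] with x hx
      rw [force, real_inner_smul_left]
      refine Tendsto.const_mul _ (Tendsto.mul_const _ (((hroot x).pow 3).inv₀ ?_))
      exact pow_ne_zero _ (norm_ne_zero_iff.2 (sub_ne_zero.2 hx))
  exact tendsto_nhds_unique hL (hR.congr fun n => (hibp n).symm)

lemma potential_eq (f : Phase → ℝ) (x : Space) :
    potential f x = -∫ y, density f y * ‖x - y‖⁻¹ := by
  simp only [potential, div_eq_mul_inv]

lemma locallyIntegrable_potential {f : Phase → ℝ} (hf : Integrable f) :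
    LocallyIntegrable (potential f) := by
  have h := (locallyIntegrable_kernel (integrable_density hf) (k := fun x => ‖x‖⁻¹)
    (by fun_prop) inv_norm_le).neg
  simp only [smul_eq_mul] at h
  exact h.congr (ae_of_all _ fun x => (potential_eq f x).symm)

/-- The weak gradient of the potential. -/
lemma isWeakGradient_potential {f : Phase → ℝ} (hf : Integrable f) :
    IsWeakGradient (potential f) (field (density f)) := by
  have hρ := integrable_density hf
  have hu := locallyIntegrable_potential hf
  have hG := locallyIntegrable_field hρ
  refine ⟨hu, hG, fun ψ hψ hc => ?_⟩
  have hgc : Continuous (gradient ψ) :=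
    (InnerProductSpace.toDual ℝ Space).symm.continuous.comp (hψ.continuous_fderiv (by simp))
  have hgs : HasCompactSupport (gradient ψ) :=
    (hc.fderiv ℝ).comp_left (g := (InnerProductSpace.toDual ℝ Space).symm) (map_zero _)
  have hi1 : Integrable fun x => potential f x • gradient ψ x :=
    hu.integrable_smul_right_of_hasCompactSupport hgc hgs
  have hi2 : Integrable fun x => ψ x • field (density f) x :=
    hG.integrable_smul_left_of_hasCompactSupport hψ.continuous hc
  ext i
  set v : Space := EuclideanSpace.single i 1 with hv
  have hv1 : ‖v‖ ≤ 1 := by simp [hv]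
  have hcoord : ∀ w : Space, w i = inner ℝ v w := fun w => by
    rw [hv, EuclideanSpace.inner_single_left]
    simp
  rw [hcoord, hcoord, inner_neg_right, ← integral_inner hi1, ← integral_inner hi2]
  have hd : Continuous fun x => fderiv ℝ ψ x v :=
    (hψ.continuous_fderiv (by simp)).clm_apply continuous_const
  have hdc : HasCompactSupport fun x => fderiv ℝ ψ x v := hc.fderiv_apply ℝ v
  have hfm : Measurable fun x => inner ℝ (force x) v := measurable_force.inner measurable_const
  have hfb : ∀ x, ‖inner ℝ (force x) v‖ ≤ (‖x‖ ^ 2)⁻¹ + 1 := by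
    intro x
    refine (norm_inner_le_norm _ _).trans ((mul_le_of_le_one_right (norm_nonneg _) hv1).trans ?_)
    exact norm_force_le x
  -- Fubini moves the derivative onto the kernel and back. The signs agree because x/|x|³ is minus
  -- the gradient of 1/|x| and the potential carries a minus sign.
  calc ∫ x, inner ℝ v (potential f x • gradient ψ x)
      = -∫ x, fderiv ℝ ψ x v * ∫ y, density f y * ‖x - y‖⁻¹ := by
        rw [← integral_neg]
        congr 1 with x
        rw [real_inner_smul_right, real_inner_comm, inner_gradient_left, potential_eq]
        ring
    _ = -∫ y, density f y * ∫ x, ψ x * inner ℝ (force (x - y)) v := by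
        rw [integral_mul_kernel_swap hρ hd hdc (k := fun x => ‖x‖⁻¹) (by fun_prop) inv_norm_le]
        simp only [integral_inv_norm_mul_fderiv hψ hc hv1]
    _ = -∫ x, ψ x * ∫ y, density f y * inner ℝ (force (x - y)) v := by
        rw [integral_mul_kernel_swap hρ hψ.continuous hc hfm hfb]
    _ = -∫ x, inner ℝ v (ψ x • field (density f) x) := by
        congr 1
        refine integral_congr_ae ?_
        filter_upwards [ae_integrable_force hρ] with x hx
        rw [real_inner_smul_right, field, ← integral_inner hx]
        congr 2 with y
        rw [real_inner_smul_right, real_inner_comm]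

end WeakGradient

end VlasovPoisson

namespace VlasovPoisson

variable {Q : ℝ → ℝ → ℝ} {k : ℝ}

/-! ### Weak limits of minimizing sequences and conclusion. -/

section WeakLimits

variable {M : ℝ} {f : ℕ → Phase → ℝ} {f₀ : Phase → ℝ}

/-- Convergence when tested with bounded measurable functions. -/
def TendstoBounded (f : ℕ → Phase → ℝ) (f₀ : Phase → ℝ) : Prop :=
  ∀ g : Phase → ℝ, Measurable g → (∃ G, ∀ p, |g p| ≤ G) →
    Tendsto (fun n => ∫ p, f n p * g p) atTop (𝓝 (∫ p, f₀ p * g p))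

lemma TendstoBounded.tendsto_integral (h : TendstoBounded f f₀) :
    Tendsto (fun n => ∫ p, f n p) atTop (𝓝 (∫ p, f₀ p)) := by
  simpa using h (fun _ => 1) measurable_const ⟨1, fun _ => by simp⟩

lemma TendstoBounded.tendsto_massIn (h : TendstoBounded f f₀) (a : Space) (R : ℝ) :
    Tendsto (fun n => massIn (f n) a R) atTop (𝓝 (massIn f₀ a R)) := by
  have hB : MeasurableSet (Metric.closedBall a R ×ˢ (univ : Set Space)) :=
    measurableSet_closedBall.prod MeasurableSet.univ
  have h1 := h _ (measurable_one.indicator hB) ⟨1, fun p => by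
    by_cases hp : p ∈ Metric.closedBall a R ×ˢ (univ : Set Space)
    · rw [indicator_of_mem hp]; simp
    · rw [indicator_of_notMem hp]; simp⟩
  have h2 : ∀ u : Phase → ℝ, ∫ p, u p * (Metric.closedBall a R ×ˢ (univ : Set Space)).indicator 1 p =
      massIn u a R := by
    intro u
    rw [massIn, ← integral_indicator hB]
    congr 1 with p
    by_cases hp : p ∈ Metric.closedBall a R ×ˢ (univ : Set Space)
    · rw [indicator_of_mem hp, indicator_of_mem hp]; simp
    · rw [indicator_of_notMem hp, indicator_of_notMem hp, mul_zero]
  simpa only [h2] using h1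

lemma TendstoBounded.densityConvergence {A : ℝ} (h : TendstoBounded f f₀) (hM : 0 ≤ M) (hA : 0 ≤ A)
    (hf : ∀ n, Integrable (f n)) (hf₀ : Integrable f₀)
    (hb : ∀ n, DensityBound (density (f n)) M A) (hb₀ : DensityBound (density f₀) M A)
    (htight : ∀ ε : ℝ, 0 < ε → ∃ R : ℝ, ∀ n,
      ∫⁻ p in (Metric.closedBall 0 R)ᶜ, ENNReal.ofReal |f n p| ≤ ENNReal.ofReal ε) :
    DensityConvergence (fun n => density (f n)) (density f₀) M A where
  nonneg_m := hM
  nonneg_A := hA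
  bound := hb
  bound_limit := hb₀
  tight ε hε := by
    obtain ⟨R, hR⟩ := htight ε hε
    exact ⟨R, fun n => (lintegral_compl_ball_density_le (hf n) R).trans (hR n)⟩
  tight_limit ε hε := exists_tight_of_integrable hb₀.integrable hε
  tendsto g hg hG := by
    obtain ⟨G, hG⟩ := hG
    rw [integral_density_mul hf₀ hg ⟨G, hG⟩]
    refine (h (fun p => g p.1) (hg.comp measurable_fst) ⟨G, fun p => hG p.1⟩).congr fun n => ?_
    rw [integral_density_mul (hf n) hg ⟨G, hG⟩]

lemma DensityConvergence.gradientsTendstoL2 {A : ℝ} (hf : ∀ n, Integrable (f n))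
    (hf₀ : Integrable f₀) (h : DensityConvergence (fun n => density (f n)) (density f₀) M A) :
    GradientsTendstoL2 (fun n => potential (f n)) (potential f₀) :=
  ⟨fun n => field (density (f n)), field (density f₀),
    fun n => ⟨isWeakGradient_potential (hf n), (h.bound n).memLp_field⟩,
    isWeakGradient_potential hf₀, h.bound_limit.memLp_field, h.tendsto_field⟩

/-- Since H and D converge along the sequence, so does T = H + D/2; only T needs lower
semicontinuity. -/
lemma energyCasimir_le_of_tendsto (hQ : CasimirAssumptions Q k) {A h : ℝ}
    (hf : ∀ n, f n ∈ admissible Q M) (hf₀ : f₀ ∈ admissible Q M) (hm : Measurable f₀)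
    (h0 : ∀ p, 0 ≤ f₀ p) (hlim : TendstoBounded f f₀)
    (hρ : DensityConvergence (fun n => density (f n)) (density f₀) M A)
    (hH : Tendsto (fun n => energyCasimir Q (f n)) atTop (𝓝 h)) : energyCasimir Q f₀ ≤ h := by
  have hT : Tendsto (fun n => (freeEnergy Q (f n)).toReal) atTop
      (𝓝 (h + 1 / 2 * coulomb (density f₀) (density f₀))) := by
    refine (hH.add (hρ.tendsto_coulomb.const_mul (1 / 2))).congr fun n => ?_
    rw [energyCasimir_eq hQ (hf n), sub_add_cancel]
  set c := h + 1 / 2 * coulomb (density f₀) (density f₀) with hc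
  rw [energyCasimir_eq hQ hf₀]
  suffices (freeEnergy Q f₀).toReal ≤ c by linarith
  have hc0 : 0 ≤ c := ge_of_tendsto' hT fun n => ENNReal.toReal_nonneg
  refine le_of_forall_pos_le_add fun ε hε => ?_
  have := freeEnergy_le_of_weak_limit hQ hf hm hf₀.1 h0 hlim (c := c + ε)
    (hT.eventually_le_const (by linarith)).frequently
  exact ENNReal.toReal_le_of_le_ofReal (by positivity) this

end WeakLimits

end VlasovPoisson

open VlasovPoisson

theorem theoremA1 (Q : ℝ → ℝ → ℝ) (k : ℝ) (hQ : VlasovPoisson.CasimirAssumptions Q k)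
    (M : ℝ) (hM : 0 < M)
    (f : ℕ → VlasovPoisson.Phase → ℝ) (hf : VlasovPoisson.IsMinimizingSeq Q M f) :
    ∃ (z : ℕ → ℝ) (φ : ℕ → ℕ) (f₀ : VlasovPoisson.Phase → ℝ),
      StrictMono φ ∧
      (∀ ε : ℝ, 0 < ε → ∃ R : ℝ, 0 < R ∧
        (∀ i, M - ε ≤
          VlasovPoisson.massIn (f (φ i)) (VlasovPoisson.axisPoint (z (φ i))) R) ∧
        M - ε ≤ VlasovPoisson.massIn f₀ 0 R) ∧
      VlasovPoisson.WeakTendstoLp (1 + 1 / k)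
        (fun i => VlasovPoisson.shift (z (φ i)) (f (φ i))) f₀ ∧
      VlasovPoisson.GradientsTendstoL2
        (fun i => VlasovPoisson.potential (VlasovPoisson.shift (z (φ i)) (f (φ i))))
        (VlasovPoisson.potential f₀) ∧
      f₀ ∈ VlasovPoisson.admissibleS Q M ∧
      IsMinOn (VlasovPoisson.energyCasimir Q) (VlasovPoisson.admissibleS Q M) f₀ := by
  obtain ⟨h, S, z, hh, hlim, hS, hconc⟩ := hf.exists_shifts hQ hM
  set g : ℕ → Phase → ℝ := fun i => shift (z i) (f i) with hg
  have hgS : ∀ i, g i ∈ admissibleS Q M := fun i => shift_mem_admissibleS (hf.1 i) (z i)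
  have hgT : ∀ i, (freeEnergy Q (g i)).toReal ≤ S := fun i => by
    rw [hg, freeEnergy_shift]
    exact hS i
  have hS0 : 0 ≤ S := ENNReal.toReal_nonneg.trans (hS 0)
  -- After the shift, the concentration about points of the axis becomes concentration about the
  -- origin.
  have htight := fun ε (hε : 0 < ε) => exists_tight (f := g) (fun i => (hgS i).1) hgT
    (fun ε hε => by
      obtain ⟨R, hR0, hR⟩ := hconc ε hε
      refine ⟨R, hR0, fun n => ?_⟩
      rw [massIn_shift]
      exact hR n) hε
  obtain ⟨B, hB, hBf⟩ := exists_fiveThirds_le hQ M S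
  obtain ⟨φ, f₀, hφ, hm, hi, h0, hw⟩ := exists_weak_limit hM hB (fun n => (hgS n).1.1)
    (fun n => (hgS n).1.2.1) (fun n => (hgS n).1.2.2.1) (fun n => hBf _ (hgS n).1 (hgT n)) htight
  have hw' : TendstoBounded (fun n => g (φ n)) f₀ := hw
  have hgφ : ∀ n, g (φ n) ∈ admissible Q M := fun n => (hgS (φ n)).1
  have hT₀ : freeEnergy Q f₀ ≤ ENNReal.ofReal S :=
    freeEnergy_le_of_weak_limit hQ hgφ hm hi h0 hw (Frequently.of_forall fun n => hgT (φ n))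
  have hf₀ : f₀ ∈ admissible Q M := by
    refine ⟨hi, ae_of_all _ h0, ?_, hT₀.trans_lt ENNReal.ofReal_lt_top⟩
    refine tendsto_nhds_unique hw'.tendsto_integral (tendsto_const_nhds.congr fun n => ?_)
    exact (hgφ n).2.2.1.symm
  have hT₀' : (freeEnergy Q f₀).toReal ≤ S := ENNReal.toReal_le_of_le_ofReal hS0 hT₀
  have hf₀S : f₀ ∈ admissibleS Q M :=
    ⟨hf₀, symmetric_of_weak_limit (fun n => hgS (φ n)) hi hw⟩
  obtain ⟨A, hA, hAf⟩ := exists_densityBound_of_freeEnergy_le hQ M S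
  have hρ := hw'.densityConvergence hM.le hA.le (fun n => (hgφ n).1) hi
    (fun n => hAf _ M le_rfl (hgφ n) (hgT _)) (hAf _ M le_rfl hf₀ hT₀') fun ε hε => by
      obtain ⟨R, hR⟩ := htight ε hε
      exact ⟨R, fun n => hR (φ n)⟩
  refine ⟨z, φ, f₀, hφ, fun ε hε => ?_, weakTendstoLp_of_bounded hQ hgφ (fun n => hgT _) hf₀ hT₀' hw,
    hρ.gradientsTendstoL2 (fun n => (hgφ n).1) hi, hf₀S, fun u hu => ?_⟩
  · obtain ⟨R, hR0, hR⟩ := hconc ε hε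
    refine ⟨R, hR0, fun i => hR (φ i), ge_of_tendsto' (hw'.tendsto_massIn 0 R) fun n => ?_⟩
    rw [hg, massIn_shift]
    exact hR (φ n)
  -- The limit h of the energies is also a lower bound for every competitor, so an energy of at most
  -- h is minimal.
  · refine (energyCasimir_le_of_tendsto hQ hgφ hf₀ hm h0 hw' hρ ?_).trans (hh u hu)
    refine (hlim.comp hφ.tendsto_atTop).congr fun n => ?_
    exact (energyCasimir_shift hQ (hf.1 (φ n)) (z (φ n))).symm
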